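/- **Setting.** A (sub-stochastic) Markov decision process (MDP) $\mathcal M=(S,\mathrm{Act},P,\iota)$ has a finite set $S$ of states, a non-empty finite set $\mathrm{Act}(s)$ of enabled actions for each state $s$, transition probabilities $P(s,\alpha,t)\in\mathbb Q_{\ge 0}$ with $\sum_t P(s,\alpha,t)\le 1$ for $\alpha\in\mathrm{Act}(s)$, and initial probabilities $\iota(s)\in\mathbb Q_{\ge0}$ with $\sum_s\iota(s)\le 1$. $\mathrm{Goal}\subseteq S$ is a set of trap states (all transition probabilities out of them are $0$). $\mathbf{Pr}^{\max}_{\mathcal M}(\lozenge\mathrm{Goal})$ is the supremum, over all history-dependent deterministic schedulers, of the probability of the paths that contain a state of $\mathrm{Goal}$. A *subsystem* of $\mathcal M$ is an MDP on a subset $T\subseteq S$ with the same actions in which every transition and initial probability is that of $\mathcal M$ or $0$; $\mathcal M_T$ is the subsystem that keeps all probabilities inside $T$. A subsystem $\mathcal M'$ is a *witness* for $\mathbf{Pr}^{\max}_{\mathcal M}(\lozenge \mathrm{Goal})\ge\lambda$ if $\mathbf{Pr}^{\max}_{\mathcal M'}(\lozenge \mathrm{Goal})\ge\lambda$. A set $S'\subseteq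 S$ is (induces) a *minimal witness* if $\mathcal M_{S'}$ is a witness and no witnessing subsystem has fewer than $|S'|$ states. The underlying graph of $\mathcal M$ has an edge $(s,t)$ iff $P(s,\alpha,t)>0$ for some $\alpha\in\mathrm{Act}(s)$. A *directed tree partition* $\mathcal P$ is a partition of $S$ into non-empty blocks whose quotient graph (ignoring edges inside a block) is a directed tree: its underlying undirected graph is a tree without double edges, and all in-degrees are at most one. We assume that every block is contained in, or disjoint from, $\mathrm{Goal}$, and that all initial states lie in the root block. For a block $B$, $\mathrm{inc}(B)$ is the set of states of $B$ that are initial or have an incoming edge from the parent of $B$; $\mathrm{out}(B)$ is the union of $\mathrm{inc}(C)$ over the children $C$ of $B$; and $\mathrm{exit}(B)$ is the set of states of $B$ with an edge into another block. For $Y\subseteq S$ and a partial function $f:S\to[0,1]$, $\mathrm{maxval}^f_Y(q)$ is the maximal probability of reaching $\mathrm{Goal}$ from $q\in Y$ in the MDP obtained from $\mathcal M_Y$ by replacing the outgoing edges of every state $s$ in the domain of $f$ by one transition to the goal with probability $f(s)$. **The algorithm.** On input $(\mathcal M,\mathcal P,\lambda)$ with $\lambda\in\mathbb Q$ it treats the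 blocks in reverse topological order and stores for each block $B$ a list $\mathrm{psubsys}[B]$ of pairs $(Y,\mathrm{val}(Y))$ with $\mathrm{val}(Y)\in\mathbb Q^{\mathrm{inc}(B)}$. For each $X\subseteq B$ such that every $s\in X$ is in $\mathrm{inc}(B)$ or has a predecessor in $X$, and is in $\mathrm{exit}(B)\cup\mathrm{Goal}$ or has a successor in $X$, it does the following: 1. For each choice of one stored pair $(T_C,\mathrm{val}(T_C))$ for every child $C$ of $B$, it inserts into $\mathrm{psubsys}[B]$ the set $Y=X\cup\bigcup_C T_C$ with $\mathrm{val}(Y)(q)=\mathrm{maxval}^f_Y(q)$ for $q\in \mathrm{inc}(B)\cap Y$ and $0$ for $q\in\mathrm{inc}(B)\setminus Y$. Here $f$, with domain $\mathrm{out}(B)$, is the concatenation of the vectors $\mathrm{val}(T_C)$. 2. It then replaces $\mathrm{psubsys}[B]$ by $\mathrm{removeDominated}(\mathrm{psubsys}[B])$. This subroutine goes through the sizes $j=0,1,2,\dots$. For each $j$ it adds to a point set $H$ all projections of the vectors $\mathrm{val}(Y)$ with $|Y|=j$ onto subsets of the coordinates (setting the other coordinates to $0$), and keeps those $Y$ with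 $|Y|=j$ for which $\mathrm{val}(Y)$ is a vertex of the convex hull of $H$. Finally, with $B_r$ the root block, it returns a set $Y$ of least cardinality among the pairs in $\mathrm{psubsys}[B_r]$ with $\sum_{s}\iota(s)\,\mathrm{val}(Y)(s)\ge\lambda$, if there is one, and otherwise reports that there is none. The values are computed by a linear program and the vertices by testing membership in convex hulls. Both subroutines enumerate basic solutions of linear systems by Gauss–Jordan elimination in exact rational arithmetic. **Proposition.** Let $(\mathcal M,\mathcal P,\lambda)$ be an input as above. If the algorithm returns $S'$, then $S'$ is a minimal witness for $\mathbf{Pr}^{\max}_{\mathcal M}(\lozenge\mathrm{Goal})\ge\lambda$; if it reports that there is none, then no subsystem of $\mathcal M$ is a witness. Moreover, there is a polynomial $p$, independent of the input, such that the algorithm terminates after at most $2^{p(N)}$ steps, where $N$ is the size of the input (the numbers of states, actions and blocks plus the numbers of bits of all probabilities and of $\lambda$) and an arithmetic operation on rationals counts as the square of the number of bits of its operands. -/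

import Mathlib

namespace TreeWitness

/-! ## Markov decision processes and the reachability probability -/

section Semantics

variable {S A : Type} [Fintype S]

/-- A finite sub-stochastic Markov decision process with rational probabilities. Every state has an
enabled action, since otherwise no scheduler could be defined on a path ending in that state. -/
structure MDP (S A : Type) [Fintype S] where
  act : S → Finset A
  act_nonempty : ∀ s, (act s).Nonempty
  P : S → A → S → ℚ
  P_nonneg : ∀ s α t, 0 ≤ P s α t
  P_sum : ∀ s, ∀ α ∈ act s, ∑ t, P s α t ≤ 1
  init : S → ℚ
  init_nonneg : ∀ s, 0 ≤ init s
  init_sum : ∑ s, init s ≤ 1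

/-- A scheduler chooses an enabled action after every finite history
`s₀ α₀ s₁ α₁ … sₙ`; the list holds the completed steps `(sᵢ, αᵢ)`, `i < n`, and the second
argument is the current state `sₙ`. -/
def MDP.Scheduler (M : MDP S A) : Type :=
  {σ : List (S × A) → S → A // ∀ h s, σ h s ∈ M.act s}

/-- One position of a path: a state together with the action chosen there, or `none` once the path
has ended (or has lost the probability that is missing in a sub-stochastic row). -/
def Step (S A : Type) : Type := Option (S × A)

instance : MeasurableSpace (Step S A) := ⊤

instance : DiscreteMeasurableSpace (Step S A) := ⟨fun _ => trivial⟩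

instance [Finite A] : Finite (Step S A) := inferInstanceAs (Finite (Option (S × A)))

/-- A sub-distribution completed to a distribution: `none` carries the missing probability. -/
noncomputable def subPMF (w : S → ℚ) (h0 : ∀ s, 0 ≤ w s) (h1 : ∑ s, w s ≤ 1) : PMF (Option S) :=
  PMF.ofFintype (fun o => ENNReal.ofReal ((o.elim (1 - ∑ s, w s) w : ℚ) : ℝ)) (by
    have hnn : ∀ o : Option S, 0 ≤ (((o.elim (1 - ∑ s, w s) w : ℚ)) : ℝ) := by
      intro o
      cases o with
      | none => simpa using (by exact_mod_cast h1 : (∑ s, (w s : ℝ)) ≤ 1)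
      | some s => simpa using h0 s
    rw [← ENNReal.ofReal_sum_of_nonneg (fun o _ => hnn o), Fintype.sum_option]
    simp)

open Classical in
/-- The distribution of the next step after the completed steps `h` and the present step `o`. -/
noncomputable def MDP.nextStep (M : MDP S A) (σ : M.Scheduler) (h : List (S × A)) :
    Step S A → PMF (Step S A)
  | none => PMF.pure none
  | some (s, α) =>
    if hα : α ∈ M.act s then
      (subPMF (M.P s α) (M.P_nonneg s α) (M.P_sum s α hα)).map
        (fun o => o.map (fun t => (t, σ.1 (h ++ [(s, α)]) t)))
    else PMF.pure none

/-- The distribution of the first step. -/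
noncomputable def MDP.firstStep (M : MDP S A) (σ : M.Scheduler) : PMF (Step S A) :=
  (subPMF M.init M.init_nonneg M.init_sum).map (fun o => o.map (fun s => (s, σ.1 [] s)))

/-- The completed steps before time `n`. -/
def pastSteps (n : ℕ) (h : (i : Finset.Iic n) → Step S A) : List (S × A) :=
  List.reduceOption (List.ofFn (fun i : Fin n => h ⟨i, Finset.mem_Iic.mpr i.2.le⟩))

variable [Finite A]

/-- The transition kernel at time `n` of the Markov chain induced by a scheduler. -/
noncomputable def MDP.stepKernel (M : MDP S A) (σ : M.Scheduler) (n : ℕ) :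
    ProbabilityTheory.Kernel ((i : Finset.Iic n) → Step S A) (Step S A) :=
  ProbabilityTheory.Kernel.ofFunOfCountable
    (fun h => (M.nextStep σ (pastSteps n h) (h ⟨n, Finset.mem_Iic.mpr le_rfl⟩)).toMeasure)

instance (M : MDP S A) (σ : M.Scheduler) (n : ℕ) :
    ProbabilityTheory.IsMarkovKernel (M.stepKernel σ n) :=
  ⟨fun h => PMF.toMeasure.isProbabilityMeasure
    (M.nextStep σ (pastSteps n h) (h ⟨n, Finset.mem_Iic.mpr le_rfl⟩))⟩

/-- The measure on paths induced by a scheduler (paths that end are continued by `none`). -/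
noncomputable def MDP.pathMeasure (M : MDP S A) (σ : M.Scheduler) :
    MeasureTheory.Measure (ℕ → Step S A) :=
  ProbabilityTheory.Kernel.trajMeasure (X := fun _ => Step S A)
    (M.firstStep σ).toMeasure (M.stepKernel σ)

/-- The event `◇Goal`: the path contains a state of `Goal`. -/
def eventuallyIn (Goal : Finset S) : Set (ℕ → Step S A) :=
  {ω | ∃ i : ℕ, ∃ s ∈ Goal, ∃ α : A, ω i = some (s, α)}

/-- `Pr^max(◇Goal)`: the supremum over all schedulers of the probability of `◇Goal`. -/
noncomputable def MDP.prMax (M : MDP S A) (Goal : Finset S) : ℝ :=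
  ⨆ σ : M.Scheduler, (M.pathMeasure σ).real (eventuallyIn Goal)

end Semantics

/-! ## Subsystems and minimal witnesses -/

section Subsystems

variable {S A : Type} [Fintype S]

/-- `M'`, an MDP whose set of states is `T ⊆ S`, is a subsystem of `M`: the enabled actions are the
same, and every transition or initial probability is either retained or set to zero. -/
def IsSubsystem (M : MDP S A) {T : Finset S} (M' : MDP {s // s ∈ T} A) : Prop :=
  (∀ s, M'.act s = M.act s.1) ∧
  (∀ s, ∀ α ∈ M.act s.1, ∀ t, M'.P s α t = M.P s.1 α t.1 ∨ M'.P s α t = 0) ∧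
  (∀ s, M'.init s = M.init s.1 ∨ M'.init s = 0)

theorem sum_subtype_le (T : Finset S) (w : S → ℚ) (h : ∀ s, 0 ≤ w s) :
    ∑ s : {s // s ∈ T}, w s.1 ≤ ∑ s, w s := by
  rw [Finset.sum_coe_sort T w]
  exact Finset.sum_le_sum_of_subset_of_nonneg (Finset.subset_univ T) (fun s _ _ => h s)

/-- The subsystem induced by a set of states. -/
def MDP.induced (M : MDP S A) (T : Finset S) : MDP {s // s ∈ T} A where
  act s := M.act s.1
  act_nonempty s := M.act_nonempty s.1
  P s α t := M.P s.1 α t.1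
  P_nonneg s α t := M.P_nonneg s.1 α t.1
  P_sum s α hα := (sum_subtype_le T (M.P s.1 α) (M.P_nonneg s.1 α)).trans (M.P_sum s.1 α hα)
  init s := M.init s.1
  init_nonneg s := M.init_nonneg s.1
  init_sum := (sum_subtype_le T M.init M.init_nonneg).trans M.init_sum

variable [DecidableEq S] [Finite A]

/-- A system on the states `T` is a witness for `Pr^max(◇Goal) ≥ lam` if its own maximal
probability of reaching (the goal states among its states) is at least `lam`. -/
def IsWitness {T : Finset S} (M' : MDP {s // s ∈ T} A) (Goal : Finset S) (lam : ℚ) : Prop :=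
  (lam : ℝ) ≤ M'.prMax (Goal.subtype (· ∈ T))

/-- The subsystem induced by `T` is a witness with the least number of states among all
witnessing subsystems (induced or not). -/
def IsMinimalWitness (M : MDP S A) (Goal : Finset S) (lam : ℚ) (T : Finset S) : Prop :=
  IsWitness (M.induced T) Goal lam ∧
  ∀ (T' : Finset S) (M' : MDP {s // s ∈ T'} A),
    IsSubsystem M M' → IsWitness M' Goal lam → T.card ≤ T'.card

end Subsystems

/-! ## Directed tree partitions -/

section Partitions

variable {S A B : Type} [Fintype S]

/-- The edge relation of the underlying graph. -/
def MDP.Edge (M : MDP S A) (s t : S) : Prop := ∃ α ∈ M.act s, 0 < M.P s α t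

/-- The quotient of a directed graph under the indexed partition whose blocks are the fibres of
`blk`; edges inside a block are disregarded. -/
def QuotientEdge (E : S → S → Prop) (blk : S → B) (b c : B) : Prop :=
  b ≠ c ∧ ∃ s t, blk s = b ∧ blk t = c ∧ E s t

/-- A directed graph (without loops) is a tree: its underlying undirected graph is a tree (there
are no two opposite edges, which would be a double edge), and all in-degrees are at most one. -/
def IsDirectedTree (E : B → B → Prop) : Prop :=
  (SimpleGraph.fromRel E).IsTree ∧ (∀ b c, E b c → ¬ E c b) ∧
  (∀ b c d, E b d → E c d → b = c)

/-- The nonempty fibres of `blk` form a directed tree partition of the graph. -/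
def IsDirectedTreePartition (E : S → S → Prop) (blk : S → B) : Prop :=
  Function.Surjective blk ∧ IsDirectedTree (QuotientEdge E blk)

end Partitions

/-! ## Computations with a step count

A value of type `Timed α` is a result together with the number of steps spent on it. Elementary
steps are: reading or writing one cell of an array or of a list, following or copying a pointer, a
comparison of two indices, and a Boolean operation. A set of states is a bit vector: a membership
test is one step, every other operation takes as many steps as there are states. A function out of
a finite index type is an array; it is built by `tabulate`, which pays for all its entries.
Arithmetic on rational numbers is exact, on reduced fractions, and is charged by the square of the
number of bits of the operands. -/

structure Timed (α : Type) where
  val : α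
  time : ℕ

namespace Timed

instance : Monad Timed where
  pure a := ⟨a, 0⟩
  bind x f := ⟨(f x.val).val, x.time + (f x.val).time⟩

/-- The result `a` of an operation of `c` steps. -/
def op {α : Type} (c : ℕ) (a : α) : Timed α := ⟨a, c⟩

def mapL {α β : Type} (f : α → Timed β) : List α → Timed (List β)
  | [] => op 1 []
  | a :: l => do
    let b ← f a
    let r ← mapL f l
    op 1 (b :: r)

def append {α : Type} (l r : List α) : Timed (List α) := op (l.length + 1) (l ++ r)

def flatMapL {α β : Type} (f : α → Timed (List β)) : List α → Timed (List β)
  | [] => op 1 []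
  | a :: l => do
    let b ← f a
    let r ← flatMapL f l
    append b r

def filterL {α : Type} (p : α → Timed Bool) : List α → Timed (List α)
  | [] => op 1 []
  | a :: l => do
    let b ← p a
    let r ← filterL p l
    op 1 (if b then a :: r else r)

def anyL {α : Type} (p : α → Timed Bool) : List α → Timed Bool
  | [] => op 1 false
  | a :: l => do
    let b ← p a
    let r ← anyL p l
    op 1 (b || r)

def allL {α : Type} (p : α → Timed Bool) : List α → Timed Bool
  | [] => op 1 true
  | a :: l => do
    let b ← p a
    let r ← allL p l
    op 1 (b && r)

def foldL {α β : Type} (f : β → α → Timed β) : β → List α → Timed β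
  | x, [] => op 1 x
  | x, a :: l => do
    let y ← f x a
    let _ ← op 1 ()
    foldL f y l

/-- Build an array. -/
def tabulate {ι β : Type} [FinEnum ι] (f : ι → Timed β) : Timed (ι → β) :=
  ⟨fun i => (f i).val, ((FinEnum.toList ι).map (fun i => (f i).time + 1)).sum + 1⟩

end Timed

open Timed

/-- The number of bits of a rational number. -/
def ratBits (q : ℚ) : ℕ := Nat.size q.num.natAbs + Nat.size q.den

def ratCost (a b : ℚ) : ℕ := (ratBits a + ratBits b + 1) ^ 2

def addQ (a b : ℚ) : Timed ℚ := op (ratCost a b) (a + b)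
def subQ (a b : ℚ) : Timed ℚ := op (ratCost a b) (a - b)
def mulQ (a b : ℚ) : Timed ℚ := op (ratCost a b) (a * b)
def divQ (a b : ℚ) : Timed ℚ := op (ratCost a b) (a / b)
def leQ (a b : ℚ) : Timed Bool := op (ratCost a b) (decide (a ≤ b))
def eqQ (a b : ℚ) : Timed Bool := op (ratCost a b) (decide (a = b))

def sumQ {ι : Type} (f : ι → Timed ℚ) : List ι → Timed ℚ
  | [] => op 1 0
  | i :: l => do
    let x ← f i
    let y ← sumQ f l
    addQ x y

/-! ### Linear programs in standard form

A system of linear equations with rows `ρ` and columns `ι` is an array `T : ρ → Option ι → ℚ`: the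
equation of row `i` is `∑ j, T i (some j) * y j = T i none`. -/

section LinearPrograms

variable {ρ ι : Type} [FinEnum ρ] [FinEnum ι]

/-- Gauss–Jordan pivot on row `i` and column `j`. -/
def pivot (T : ρ → Option ι → ℚ) (i : ρ) (j : ι) : Timed (ρ → Option ι → ℚ) := do
  let row ← tabulate (fun l => divQ (T i l) (T i (some j)))
  tabulate (fun i' => tabulate (fun l =>
    if i' = i then op 1 (row l)
    else do
      let x ← mulQ (T i' (some j)) (row l)
      subQ (T i' l) x))

/-- Enumerate the basic solutions: every row of the list is either skipped or used as a pivot row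
together with a column in which its current entry is nonzero; `basis j` is the pivot row of `j`. -/
def basicSolutions : List ρ → (ρ → Option ι → ℚ) → (ι → Option ρ) → Timed (List (ι → ℚ))
  | [], T, basis => do
    let y ← tabulate (fun j => op 1 (match basis j with
      | none => 0
      | some i => T i none))
    op 1 [y]
  | i :: l, T, basis => do
    let skipped ← basicSolutions l T basis
    let used ← flatMapL (fun j => do
      let z ← eqQ (T i (some j)) 0
      if z then op 1 []
      else do
        let T' ← pivot T i j
        let basis' ← tabulate (fun j' => op 1 (if j' = j then some i else basis j'))
        basicSolutions l T' basis') (FinEnum.toList ι)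
    append skipped used

/-- Is `y` a nonnegative solution of the system? -/
def isFeasible (T : ρ → Option ι → ℚ) (y : ι → ℚ) : Timed Bool := do
  let nonneg ← allL (fun j => leQ 0 (y j)) (FinEnum.toList ι)
  let solves ← allL (fun i => do
    let x ← sumQ (fun j => mulQ (T i (some j)) (y j)) (FinEnum.toList ι)
    eqQ x (T i none)) (FinEnum.toList ρ)
  op 1 (nonneg && solves)

/-- The basic feasible solutions of `{y ≥ 0 | T y = rhs}`. -/
def basicFeasible (T : ρ → Option ι → ℚ) : Timed (List (ι → ℚ)) := do
  let basis ← tabulate (fun _ : ι => op 1 (none : Option ρ))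
  let ys ← basicSolutions (FinEnum.toList ρ) T basis
  filterL (isFeasible T) ys

/-- A member of the list with the least objective value. -/
def argminObjective (obj : (ι → ℚ) → Timed ℚ) (ys : List (ι → ℚ)) : Timed (Option (ι → ℚ)) := do
  let r ← foldL (fun (best : Option ((ι → ℚ) × ℚ)) y => do
    let v ← obj y
    match best with
    | none => op 1 (some (y, v))
    | some (z, w) => do
      let c ← leQ w v
      op 1 (if c then some (z, w) else some (y, v))) none ys
  op 1 (r.map Prod.fst)

end LinearPrograms

/-! ### The value of a state -/

section Algorithm

variable {n m k : ℕ}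

/-- The constraints `x s = ∑ t ∈ X, P s α t * x t + rhs s + z (s, α)`, with slack `z (s, α) ≥ 0`,
for all `s ∈ X` and all enabled `α`. They describe the system induced by `X` in which the outgoing
edges of each state `s ∈ X` with `dom s` are replaced by one transition to the goal with probability
`f s`; a state of `Goal` has value `1`. -/
def valueConstraints (M : MDP (Fin n) (Fin m)) (Goal X : Finset (Fin n)) (dom : Fin n → Bool)
    (f : Fin n → ℚ) :
    Timed (Fin n × Fin m → Option (Fin n ⊕ Fin n × Fin m) → ℚ) :=
  tabulate (fun (r : Fin n × Fin m) => tabulate (fun c =>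
    if r.1 ∉ X ∨ r.2 ∉ M.act r.1 then op 5 0
    else match c with
      | none => op 5 (if r.1 ∈ Goal then 1 else if dom r.1 then f r.1 else 0)
      | some (Sum.inl t) => do
        let p ← op 5 (if r.1 ∈ Goal ∨ dom r.1 ∨ t ∉ X then 0 else M.P r.1 r.2 t)
        subQ (if t = r.1 then 1 else 0) p
      | some (Sum.inr r') => op 5 (if r' = r then -1 else 0)))

/-- The vector of the values `max-val` of the states in the system described by
`valueConstraints`, computed by a linear program (minimize `∑ s, x s`). -/
def maxVal (M : MDP (Fin n) (Fin m)) (Goal X : Finset (Fin n)) (dom : Fin n → Bool)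
    (f : Fin n → ℚ) : Timed (Fin n → ℚ) := do
  let T ← valueConstraints M Goal X dom f
  let ys ← basicFeasible T
  let best ← argminObjective
    (fun y => sumQ (fun s => op 1 (y (Sum.inl s))) (List.finRange n)) ys
  match best with
  | none => tabulate (fun _ => op 1 0)
  | some y => tabulate (fun s => op 1 (y (Sum.inl s)))

/-! ### Removing dominated partial subsystems -/

/-- A partial subsystem with its vector of interface values (an array over all states, zero at
the states that are not interface states of the block). -/
structure PartialSubsystem (n : ℕ) where
  states : Finset (Fin n)
  val : Fin n → ℚ

/-- All subsets of the set of the states in a list. -/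
def subsetsOf : List (Fin n) → Timed (List (Finset (Fin n)))
  | [] => op (n + 1) [∅]
  | s :: l => do
    let without ← subsetsOf l
    let with_s ← mapL (fun X => op (n + 1) (insert s X)) without
    append without with_s

/-- All projections of a vector onto subsets of the axes `I`. -/
def projections (I : List (Fin n)) (θ : Fin n → ℚ) : Timed (List (Fin n → ℚ)) := do
  let Ds ← subsetsOf I
  mapL (fun D => tabulate (fun q => op 1 (if q ∈ D then θ q else 0))) Ds

def vecEq (v w : Fin n → ℚ) : Timed Bool :=
  allL (fun q => eqQ (v q) (w q)) (List.finRange n)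

/-- Is `p` a convex combination of the points of the list? -/
def inConvexHull (pts : List (Fin n → ℚ)) (p : Fin n → ℚ) : Timed Bool := do
  let T ← tabulate (fun (r : Option (Fin n)) => tabulate (fun (c : Option (Fin pts.length)) =>
    match r, c with
    | none, _ => op 1 1
    | some q, none => op 1 (p q)
    | some q, some j => op 1 (pts.get j q)))
  let ys ← basicFeasible T
  op 1 (!ys.isEmpty)

/-- The vertices of the convex hull of the points of the list. -/
def hullVertices (pts : List (Fin n → ℚ)) : Timed (List (Fin n → ℚ)) :=
  filterL (fun p => do
    let others ← filterL (fun q => do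
      let e ← vecEq q p
      op 1 (!e)) pts
    let h ← inConvexHull others p
    op 1 (!h)) pts

/-- Go through the partial subsystems by increasing size, add the projections of their value
vectors to the point set `H`, and keep those whose value vector is a vertex of the hull of `H`. -/
def removeDominated (I : List (Fin n)) (L : List (PartialSubsystem n)) :
    Timed (List (PartialSubsystem n)) := do
  let size ← foldL (fun c U => op (n + 1) (max c U.states.card)) 0 L
  let res ← foldL (fun (HR : List (Fin n → ℚ) × List (PartialSubsystem n)) j => do
    let Lj ← filterL (fun U => op (n + 1) (decide (U.states.card = j))) L
    let pts ← flatMapL (fun U => projections I U.val) Lj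
    let H ← append HR.1 pts
    let V ← hullVertices H
    let Rj ← filterL (fun U => anyL (fun v => vecEq v U.val) V) Lj
    let R ← append HR.2 Rj
    op 1 (H, R)) ([], []) (List.range (size + 1))
  op 1 res.2

/-! ### The algorithm -/

/-- The precomputed graph data. -/
structure GraphData (n k : ℕ) where
  /-- edges of the underlying graph -/
  edge : Fin n → Fin n → Bool
  /-- `child b c`: block `c` is a child of block `b` in the quotient -/
  child : Fin k → Fin k → Bool
  /-- the state is initial or has an incoming edge from the parent of its block -/
  inc : Fin n → Bool
  /-- the state has an edge into another block -/
  exit : Fin n → Bool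

def graphData (M : MDP (Fin n) (Fin m)) (blk : Fin n → Fin k) : Timed (GraphData n k) := do
  let edge ← tabulate (fun s => tabulate (fun t => anyL (fun α =>
    if α ∈ M.act s then do
      let z ← leQ (M.P s α t) 0
      op 1 (!z)
    else op 1 false) (List.finRange m)))
  let child ← tabulate (fun b => tabulate (fun c => anyL (fun s => anyL (fun t =>
    op 5 (decide (b ≠ c ∧ blk s = b ∧ blk t = c) && edge s t))
      (List.finRange n)) (List.finRange n)))
  let inc ← tabulate (fun t => do
    let z ← leQ (M.init t) 0
    let e ← anyL (fun s => op 3 (child (blk s) (blk t) && edge s t)) (List.finRange n)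
    op 1 (!z || e))
  let exit ← tabulate (fun s => anyL (fun t =>
    op 3 (decide (blk t ≠ blk s) && edge s t)) (List.finRange n))
  op 1 ⟨edge, child, inc, exit⟩

/-- A reverse topological order of the blocks: repeatedly append a block that is not yet listed
and whose children are all listed. -/
def reverseTopological (child : Fin k → Fin k → Bool) : ℕ → List (Fin k) → Timed (List (Fin k))
  | 0, acc => op 1 acc
  | fuel + 1, acc => do
    let ready ← filterL (fun b => do
      let listed ← op (k + 1) (decide (b ∈ acc))
      let below ← allL (fun c => op (k + 2) (!child b c || decide (c ∈ acc))) (List.finRange k)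
      op 1 (!listed && below)) (List.finRange k)
    match ready with
    | [] => op 1 acc
    | b :: _ => do
      let acc' ← append acc [b]
      reverseTopological child fuel acc'

/-- The filter on subsets `X` of a block: a state of `X` is an interface state or has a predecessor
in `X`, and it is a goal state, has an edge into another block, or has a successor in `X`. -/
def satisfiesFilter (g : GraphData n k) (Goal X : Finset (Fin n)) : Timed Bool :=
  allL (fun s => do
    let pre ← anyL (fun s' => op 2 (decide (s' ∈ X) && g.edge s' s)) (List.finRange n)
    let post ← anyL (fun s' => op 2 (decide (s' ∈ X) && g.edge s s')) (List.finRange n)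
    op 5 (decide (s ∉ X) ||
      ((g.inc s || pre) && (g.exit s || decide (s ∈ Goal) || post)))) (List.finRange n)

/-- All combinations of one partial subsystem for each child of the block `b`: the sets of states
are united and the value vectors concatenated. -/
def successorPoints (g : GraphData n k) (blk : Fin n → Fin k)
    (psubsys : Fin k → List (PartialSubsystem n)) (b : Fin k) :
    Timed (List (PartialSubsystem n)) := do
  let children ← filterL (fun c => op 1 (g.child b c)) (List.finRange k)
  foldL (fun combos c => flatMapL (fun T => mapL (fun U => do
    let X ← op (n + 1) (T.states ∪ U.states)
    let v ← tabulate (fun q => op 2 (if blk q = c then U.val q else T.val q))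
    op 1 ⟨X, v⟩) (psubsys c)) combos) [⟨∅, fun _ => 0⟩] children

/-- The new partial subsystem that combines `X ⊆ b` with a partial subsystem `T` for `out(b)`. -/
def newSubsystem (M : MDP (Fin n) (Fin m)) (Goal : Finset (Fin n)) (g : GraphData n k)
    (blk : Fin n → Fin k) (b : Fin k) (X : Finset (Fin n)) (T : PartialSubsystem n) :
    Timed (PartialSubsystem n) := do
  let Y ← op (n + 1) (X ∪ T.states)
  let out ← tabulate (fun q => op 3 (g.child b (blk q) && g.inc q))
  let x ← maxVal M Goal Y out T.val
  let v ← tabulate (fun q => op 4 (if blk q = b ∧ g.inc q = true ∧ q ∈ Y then x q else 0))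
  op 1 ⟨Y, v⟩

/-- The partial subsystems that are stored for the block `b`. -/
def processBlock (M : MDP (Fin n) (Fin m)) (Goal : Finset (Fin n)) (g : GraphData n k)
    (blk : Fin n → Fin k) (psubsys : Fin k → List (PartialSubsystem n)) (b : Fin k) :
    Timed (List (PartialSubsystem n)) := do
  let block ← filterL (fun s => op 1 (decide (blk s = b))) (List.finRange n)
  let I ← filterL (fun s => op 1 (g.inc s)) block
  let subsets ← subsetsOf block
  let models ← filterL (satisfiesFilter g Goal) subsets
  foldL (fun stored X => do
    let succ ← successorPoints g blk psubsys b
    let new ← mapL (newSubsystem M Goal g blk b X) succ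
    let all ← append stored new
    removeDominated I all) [] models

/-- The algorithm: it returns a set of states, or `none` if no partial subsystem that is stored for
the root block reaches the threshold. -/
def treeAlgorithm (M : MDP (Fin n) (Fin m)) (Goal : Finset (Fin n)) (blk : Fin n → Fin k)
    (lam : ℚ) : Timed (Option (Finset (Fin n))) := do
  let g ← graphData M blk
  let order ← reverseTopological g.child k []
  let empty ← tabulate (fun _ : Fin k => op 1 ([] : List (PartialSubsystem n)))
  let psubsys ← foldL (fun ps b => do
    let L ← processBlock M Goal g blk ps b
    tabulate (fun c => op 1 (if c = b then L else ps c))) empty order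
  let roots ← filterL (fun b => do
    let e ← anyL (fun c => op 1 (g.child c b)) (List.finRange k)
    op 1 (!e)) (List.finRange k)
  match roots with
  | [] => op 1 none
  | root :: _ => do
    let good ← filterL (fun U => do
      let v ← sumQ (fun s => mulQ (M.init s) (U.val s)) (List.finRange n)
      leQ lam v) (psubsys root)
    let best ← foldL (fun (best : Option (PartialSubsystem n)) U =>
      match best with
      | none => op 1 (some U)
      | some V => op (2 * n + 1) (if V.states.card ≤ U.states.card then some V else some U))
      none good
    op 1 (best.map PartialSubsystem.states)

/-- The size of the input: the numbers of states, actions and blocks, and the numbers of bits of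
all initial and transition probabilities and of the threshold. -/
def inputSize (M : MDP (Fin n) (Fin m)) (k : ℕ) (lam : ℚ) : ℕ :=
  n + m + k + ∑ s, ratBits (M.init s) +
    ∑ s, ∑ α ∈ M.act s, ∑ t, ratBits (M.P s α t) + ratBits lam

end Algorithm

end TreeWitness

/-!
# Minimal witnesses along a directed tree partition

The maximal probability of reaching the goal is the initial value of the least nonnegative solution
of the Bellman inequalities: a solution is a supermartingale under every scheduler
(`MDP.IsExcessive.prMax_le`), and the values for bounded horizons, which are attained, increase to a
solution (`exists_isExcessive_le_prMax`). The linear program of the algorithm computes this least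
solution exactly, because solutions are closed under minima and some basic feasible solution has the
least sum (`maxVal_spec`). Every subsystem on a set `T` of states is bounded by the induced one, so
witnesses may be taken to be induced, and `setValue` is the vector of the values in the subsystem
induced by `T`.

The values in a subtree of blocks depend only on the states of `T` in that subtree
(`setValue_congr_subtree`), and a block sees its children only through their interface values. The
lists of the algorithm satisfy two invariants (`processBlock_spec`). They are sound: stored values
are true interface values. They are complete: for every `T`, the interface values of `T` lie below a
convex combination of stored vectors of partial subsystems that are no larger than the part of `T` in
the subtree. Completeness passes from the children to the parent since the values in a block are a
convex function of the values at its exits, so that a combination for the children yields one for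
the block (`newSubsystem_complete`), and since states that violate the filter contribute nothing
(`exists_satisfiesFilter`). It survives the removal of dominated partial subsystems: a finite set of
points is dominated by those of its members that are vertices of its hull and maximal, a maximal
vertex of the hull of all projections is no proper projection, and a vertex of the hull for one size
is a vertex of the hulls for smaller sizes (`exists_dominating_vertices`,
`removeDominated_dominates`). At the root, the sum weighted by the initial probabilities is a linear
functional, so if `T` reaches the threshold then so does one of the stored vectors that dominate it
(`exists_stored_of_le`). This gives `treeAlgorithm_correct`.

For the time, three quantities are to be controlled. A pivot multiplies the number of bits by at most
`5`, hence a linear program with at most `N ^ 2` rows multiplies it by `5 ^ (N ^ 2)`, and the at most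
`N` blocks in sequence give `2 ^ poly(N)` bits (`storedBits_le`). A list for a block `b` has length at
most `2 ^ e`, where `e` is the number of states in the subtree of `b`, because the subtrees of the
children are disjoint (`length_processBlock_le`). The enumeration of basic solutions of a system with
`r` rows and `c` columns has at most `(c + 2) ^ r` branches, where `r` is polynomial and `c` is at
most exponential (`time_basicSolutions_le`). All bounds are expressions in the input size alone that
are built by sums, products and powers with polynomial exponents, and such expressions are bounded by
`2 ^ p(N)` for a polynomial `p` (`expBounded_totalTime`).
-/

namespace TreeWitness

/-! ### Reachability probabilities and the Bellman inequalities -/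

section Reachability

open MeasureTheory ProbabilityTheory Preorder
open scoped ENNReal

variable {S A : Type} [Fintype S]

theorem lintegral_subPMF_map (w : S → ℚ) (h0 : ∀ s, 0 ≤ w s) (h1 : ∑ s, w s ≤ 1)
    (F : Option S → Step S A) (G : Step S A → ℝ≥0∞) :
    ∫⁻ y, G y ∂((subPMF w h0 h1).map F).toMeasure =
      ENNReal.ofReal ((1 - ∑ s, w s : ℚ) : ℝ) * G (F none) +
        ∑ s, ENNReal.ofReal (w s) * G (F (some s)) := by
  let _ : MeasurableSpace (Option S) := ⊤
  have : DiscreteMeasurableSpace (Option S) := ⟨fun _ => trivial⟩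
  have hm : ((subPMF w h0 h1).map F).toMeasure = (subPMF w h0 h1).toMeasure.map F :=
    (PMF.toMeasure_map _ _ Measurable.of_discrete).symm
  rw [hm, lintegral_map Measurable.of_discrete Measurable.of_discrete, lintegral_fintype,
    Fintype.sum_option]
  simp only [PMF.toMeasure_apply_singleton _ _ (MeasurableSet.singleton _)]
  simp [subPMF, mul_comm]

theorem lintegral_nextStep (M : MDP S A) (σ : M.Scheduler) (h : List (S × A)) {s : S} {α : A}
    (hα : α ∈ M.act s) (G : Step S A → ℝ≥0∞) :
    ∫⁻ y, G y ∂(M.nextStep σ h (some (s, α))).toMeasure =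
      ENNReal.ofReal ((1 - ∑ t, M.P s α t : ℚ) : ℝ) * G none +
        ∑ t, ENNReal.ofReal (M.P s α t) * G (some (t, σ.1 (h ++ [(s, α)]) t)) := by
  simp only [MDP.nextStep, dif_pos hα]
  exact lintegral_subPMF_map _ _ _ _ G

omit [Fintype S] in
theorem lintegral_pure_toMeasure (o : Step S A) (G : Step S A → ℝ≥0∞) :
    ∫⁻ y, G y ∂(PMF.pure o).toMeasure = G o := by
  rw [PMF.toMeasure_pure, lintegral_dirac]

theorem lintegral_firstStep (M : MDP S A) (σ : M.Scheduler) (G : Step S A → ℝ≥0∞) :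
    ∫⁻ y, G y ∂(M.firstStep σ).toMeasure =
      ENNReal.ofReal ((1 - ∑ t, M.init t : ℚ) : ℝ) * G none +
        ∑ t, ENNReal.ofReal (M.init t) * G (some (t, σ.1 [] t)) :=
  lintegral_subPMF_map _ _ _ _ G

theorem lintegral_nextStep_pure (M : MDP S A) (σ : M.Scheduler) (h : List (S × A)) (o : Step S A)
    (ho : ∀ s, ∀ α ∈ M.act s, o ≠ some (s, α)) (G : Step S A → ℝ≥0∞) :
    ∫⁻ y, G y ∂(M.nextStep σ h o).toMeasure = G none := by
  rcases o with _ | ⟨s, α⟩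
  · exact lintegral_pure_toMeasure none G
  · have hα : α ∉ M.act s := fun h => ho s α h rfl
    simp only [MDP.nextStep, dif_neg hα]
    exact lintegral_pure_toMeasure none G

/-- A step at a state of `Goal`. -/
def stepIn (Goal : Finset S) (o : Step S A) : Prop := ∃ s ∈ Goal, ∃ α : A, o = some (s, α)

/-- `Goal` is visited during the first `n + 1` steps. -/
def reachedBy (Goal : Finset S) (n : ℕ) (h : (i : Finset.Iic n) → Step S A) : Prop :=
  ∃ i, stepIn Goal (h i)

omit [Fintype S] in
theorem reachedBy_succ (Goal : Finset S) (n : ℕ) (ω : ℕ → Step S A) :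
    reachedBy Goal (n + 1) (frestrictLe (n + 1) ω) ↔
      reachedBy Goal n (frestrictLe n ω) ∨ stepIn Goal (ω (n + 1)) := by
  constructor
  · rintro ⟨⟨i, hi⟩, h⟩
    rcases Nat.lt_or_ge n i with hn | hn
    · have : i = n + 1 := le_antisymm (Finset.mem_Iic.1 hi) hn
      subst this
      exact Or.inr h
    · exact Or.inl ⟨⟨i, Finset.mem_Iic.2 hn⟩, h⟩
  · rintro (⟨⟨i, hi⟩, h⟩ | h)
    · exact ⟨⟨i, Finset.mem_Iic.2 ((Finset.mem_Iic.1 hi).trans n.le_succ)⟩, h⟩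
    · exact ⟨⟨n + 1, by simp⟩, h⟩

omit [Fintype S] in
theorem reachedBy_zero (Goal : Finset S) (ω : ℕ → Step S A) :
    reachedBy Goal 0 (frestrictLe 0 ω) ↔ stepIn Goal (ω 0) := by
  constructor
  · rintro ⟨⟨i, hi⟩, h⟩
    have : i = 0 := by simpa using hi
    subst this
    exact h
  · exact fun h => ⟨⟨0, by simp⟩, h⟩

omit [Fintype S] in
theorem eventuallyIn_eq_iUnion (Goal : Finset S) :
    (eventuallyIn Goal : Set (ℕ → Step S A)) =
      ⋃ n, {ω | reachedBy Goal n (frestrictLe n ω)} := by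
  ext ω
  simp only [eventuallyIn, Set.mem_iUnion, Set.mem_ofPred_eq]
  constructor
  · rintro ⟨i, s, hs, α, h⟩
    exact ⟨i, ⟨i, by simp⟩, s, hs, α, h⟩
  · rintro ⟨n, ⟨i, _⟩, s, hs, α, h⟩
    exact ⟨i, s, hs, α, h⟩

omit [Fintype S] in
theorem monotone_reachedBy (Goal : Finset S) :
    Monotone fun n => {ω : ℕ → Step S A | reachedBy Goal n (frestrictLe n ω)} :=
  monotone_nat_of_le_succ fun n ω h => (reachedBy_succ Goal n ω).2 (Or.inl h)

theorem sum_P_real_le_one (M : MDP S A) {s : S} {α : A} (hα : α ∈ M.act s) :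
    ∑ t, (M.P s α t : ℝ) ≤ 1 := by
  exact_mod_cast M.P_sum s α hα

variable [Finite A]

/-- The Markov property: step `n + 1` is drawn from the kernel, given the steps up to `n`. -/
theorem lintegral_pathMeasure_succ (M : MDP S A) (σ : M.Scheduler) (n : ℕ)
    (G : ((i : Finset.Iic n) → Step S A) → Step S A → ℝ≥0∞) :
    ∫⁻ ω, G (frestrictLe n ω) (ω (n + 1)) ∂(M.pathMeasure σ) =
      ∫⁻ ω, (∫⁻ y, G (frestrictLe n ω) y
        ∂(M.nextStep σ (pastSteps n (frestrictLe n ω)) (ω n)).toMeasure) ∂(M.pathMeasure σ) := by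
  have : Countable (Step S A) := Finite.to_countable
  have h := Kernel.map_frestrictLe_trajMeasure_compProd_eq_map_trajMeasure
    (X := fun _ => Step S A) (μ₀ := (M.firstStep σ).toMeasure) (κ := M.stepKernel σ) (a := n)
  have hG : Measurable (Function.uncurry G) := Measurable.of_discrete
  have h2 : ∫⁻ ω, G (frestrictLe n ω) (ω (n + 1)) ∂(M.pathMeasure σ) =
      ∫⁻ p, Function.uncurry G p ∂((M.pathMeasure σ).map
        (fun x => (frestrictLe n x, x (n + 1)))) := by
    rw [lintegral_map hG (by fun_prop)]
    rfl
  rw [h2, MDP.pathMeasure, ← h, Measure.lintegral_compProd hG,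
    lintegral_map Measurable.of_discrete (by fun_prop)]
  rfl

theorem lintegral_pathMeasure_zero (M : MDP S A) (σ : M.Scheduler) (G : Step S A → ℝ≥0∞) :
    ∫⁻ ω, G (ω 0) ∂(M.pathMeasure σ) = ∫⁻ y, G y ∂(M.firstStep σ).toMeasure := by
  have : Countable (Step S A) := Finite.to_countable
  have h1 : ∫⁻ ω, G (ω 0) ∂(M.pathMeasure σ) =
      ∫⁻ x, G (x ⟨0, by simp⟩)
        ∂((M.pathMeasure σ).map (frestrictLe (π := fun _ => Step S A) 0)) := by
    rw [lintegral_map Measurable.of_discrete (by fun_prop)]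
    rfl
  rw [h1, MDP.pathMeasure, Kernel.trajMeasure, Measure.map_comp _ _ (by fun_prop),
    Kernel.traj_map_frestrictLe, Kernel.partialTraj_self, Measure.id_comp,
    lintegral_map Measurable.of_discrete (by fun_prop)]
  rfl

theorem measurableSet_reachedBy (Goal : Finset S) (n : ℕ) :
    MeasurableSet {ω : ℕ → Step S A | reachedBy Goal n (frestrictLe n ω)} := by
  have : Countable (Step S A) := Finite.to_countable
  exact (measurable_frestrictLe (X := fun _ => Step S A) n)
    (MeasurableSet.of_discrete (s := {h | reachedBy Goal n h}))

instance (M : MDP S A) (σ : M.Scheduler) : IsProbabilityMeasure (M.pathMeasure σ) := by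
  unfold MDP.pathMeasure; infer_instance

/-- `x` is a pre-fixed point of the Bellman operator for the reachability of `Goal`. -/
structure MDP.IsExcessive (M : MDP S A) (Goal : Finset S) (x : S → ℝ) : Prop where
  nonneg : ∀ s, 0 ≤ x s
  goal : ∀ s ∈ Goal, 1 ≤ x s
  step : ∀ s, s ∉ Goal → ∀ α ∈ M.act s, ∑ t, (M.P s α t : ℝ) * x t ≤ x s

open Classical in
/-- An excessive function evaluated along a path, stopped with value `1` at `Goal`, is a
supermartingale. -/
theorem MDP.IsExcessive.pathMeasure_le {M : MDP S A} {Goal : Finset S} {x : S → ℝ}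
    (hx : M.IsExcessive Goal x) (σ : M.Scheduler) :
    (M.pathMeasure σ).real (eventuallyIn Goal) ≤ ∑ s, (M.init s : ℝ) * x s := by
  let φ : Step S A → ℝ≥0∞ := fun o => o.elim 0 fun p => ENNReal.ofReal (x p.1)
  have hφ : ∀ o, stepIn Goal o → 1 ≤ φ o := by
    rintro _ ⟨s, hs, α, rfl⟩
    simpa [φ] using hx.goal s hs
  let E : ℕ → ℝ≥0∞ := fun n => ∫⁻ ω,
    (if reachedBy Goal n (frestrictLe n ω) then 1 else φ (ω n)) ∂(M.pathMeasure σ)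
  have hE0 : E 0 ≤ ENNReal.ofReal (∑ s, (M.init s : ℝ) * x s) := by
    calc E 0 ≤ ∫⁻ ω, φ (ω 0) ∂(M.pathMeasure σ) := by
          refine lintegral_mono fun ω => ?_
          simp only [reachedBy_zero]
          split_ifs with h
          · exact hφ _ h
          · exact le_rfl
      _ = ENNReal.ofReal (∑ s, (M.init s : ℝ) * x s) := by
          rw [lintegral_pathMeasure_zero, lintegral_firstStep,
            ENNReal.ofReal_sum_of_nonneg fun s _ =>
              mul_nonneg (by exact_mod_cast M.init_nonneg s) (hx.nonneg s)]
          simp only [φ, Option.elim_none, Option.elim_some,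
            mul_zero, zero_add]
          refine Finset.sum_congr rfl fun s _ => ?_
          rw [ENNReal.ofReal_mul (by exact_mod_cast M.init_nonneg s)]
  have hEs : ∀ n, E (n + 1) ≤ E n := by
    intro n
    simp only [E, reachedBy_succ]
    rw [lintegral_pathMeasure_succ M σ n
      (fun h y => if reachedBy Goal n h ∨ stepIn Goal y then 1 else φ y)]
    refine lintegral_mono fun ω => ?_
    by_cases hr : reachedBy Goal n (frestrictLe n ω)
    · simp [hr]
    · have hle : ∀ y, (if False ∨ stepIn Goal y then 1 else φ y) ≤ φ y := by
        intro y
        split_ifs with h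
        · exact hφ _ (by simpa using h)
        · exact le_rfl
      simp only [hr, if_false]
      refine (lintegral_mono hle).trans ?_
      by_cases ho : ∃ s, ∃ α ∈ M.act s, ω n = some (s, α)
      · obtain ⟨s, α, hα, ho⟩ := ho
        have hs : s ∉ Goal := fun hs => hr ⟨⟨n, by simp⟩, s, hs, α, ho⟩
        rw [ho, lintegral_nextStep M σ _ hα]
        simp only [φ, Option.elim_none, Option.elim_some, mul_zero, zero_add]
        refine le_trans (le_of_eq ?_) (ENNReal.ofReal_le_ofReal (hx.step s hs α hα))
        rw [ENNReal.ofReal_sum_of_nonneg fun t _ =>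
          mul_nonneg (by exact_mod_cast M.P_nonneg s α t) (hx.nonneg t)]
        refine Finset.sum_congr rfl fun t _ => ?_
        rw [ENNReal.ofReal_mul (by exact_mod_cast M.P_nonneg s α t)]
      · push Not at ho
        rw [lintegral_nextStep_pure M σ _ _ ho]
        exact zero_le
  have hE : ∀ n, E n ≤ ENNReal.ofReal (∑ s, (M.init s : ℝ) * x s) := by
    intro n
    induction n with
    | zero => exact hE0
    | succ n ih => exact (hEs n).trans ih
  have hn : ∀ n, M.pathMeasure σ {ω | reachedBy Goal n (frestrictLe n ω)} ≤
      ENNReal.ofReal (∑ s, (M.init s : ℝ) * x s) := by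
    intro n
    refine le_trans ?_ (hE n)
    rw [← lintegral_indicator_one (measurableSet_reachedBy Goal n)]
    refine lintegral_mono fun ω => ?_
    by_cases h : reachedBy Goal n (frestrictLe n ω) <;> simp [h]
  have hle : M.pathMeasure σ (eventuallyIn Goal) ≤
      ENNReal.ofReal (∑ s, (M.init s : ℝ) * x s) := by
    rw [eventuallyIn_eq_iUnion, (monotone_reachedBy Goal).measure_iUnion]
    exact iSup_le hn
  exact ENNReal.toReal_le_of_le_ofReal (Finset.sum_nonneg fun s _ =>
    mul_nonneg (by exact_mod_cast M.init_nonneg s) (hx.nonneg s)) hle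

theorem MDP.IsExcessive.prMax_le {M : MDP S A} {Goal : Finset S} {x : S → ℝ}
    (hx : M.IsExcessive Goal x) : M.prMax Goal ≤ ∑ s, (M.init s : ℝ) * x s := by
  have : Nonempty M.Scheduler :=
    ⟨⟨fun _ s => (M.act_nonempty s).choose, fun _ s => (M.act_nonempty s).choose_spec⟩⟩
  exact ciSup_le fun σ => hx.pathMeasure_le σ

/-- The maximal probability of reaching `Goal` within `n` steps. -/
noncomputable def MDP.boundedValue (M : MDP S A) (Goal : Finset S) [DecidableEq S] :
    ℕ → S → ℝ
  | 0, s => if s ∈ Goal then 1 else 0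
  | n + 1, s => if s ∈ Goal then 1 else
      (M.act s).sup' (M.act_nonempty s) fun α => ∑ t, (M.P s α t : ℝ) * M.boundedValue Goal n t

section BoundedValue

variable [DecidableEq S] (M : MDP S A) (Goal : Finset S)

omit [Finite A]

theorem boundedValue_goal (n : ℕ) {s : S} (hs : s ∈ Goal) : M.boundedValue Goal n s = 1 := by
  cases n <;> simp [MDP.boundedValue, hs]

theorem boundedValue_nonneg (n : ℕ) (s : S) : 0 ≤ M.boundedValue Goal n s := by
  induction n generalizing s with
  | zero => simp only [MDP.boundedValue]; split_ifs <;> norm_num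
  | succ n ih =>
    simp only [MDP.boundedValue]
    split_ifs
    · norm_num
    · obtain ⟨α, hα⟩ := M.act_nonempty s
      exact (Finset.sum_nonneg fun t _ =>
        mul_nonneg (by exact_mod_cast M.P_nonneg s α t) (ih t)).trans
        (Finset.le_sup' (fun α => ∑ t, (M.P s α t : ℝ) * M.boundedValue Goal n t) hα)

theorem boundedValue_le_one (n : ℕ) (s : S) : M.boundedValue Goal n s ≤ 1 := by
  induction n generalizing s with
  | zero => simp only [MDP.boundedValue]; split_ifs <;> norm_num
  | succ n ih =>
    simp only [MDP.boundedValue]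
    split_ifs
    · exact le_rfl
    · refine Finset.sup'_le _ _ fun α hα => (Finset.sum_le_sum fun t _ =>
        mul_le_of_le_one_right (by exact_mod_cast M.P_nonneg s α t) (ih t)).trans
        (sum_P_real_le_one M hα)

theorem sum_boundedValue_le {n : ℕ} {s : S} (hs : s ∉ Goal) {α : A} (hα : α ∈ M.act s) :
    ∑ t, (M.P s α t : ℝ) * M.boundedValue Goal n t ≤ M.boundedValue Goal (n + 1) s := by
  simp only [MDP.boundedValue, if_neg hs]
  exact Finset.le_sup' (fun α => ∑ t, (M.P s α t : ℝ) * M.boundedValue Goal n t) hα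

theorem boundedValue_le_succ (n : ℕ) (s : S) :
    M.boundedValue Goal n s ≤ M.boundedValue Goal (n + 1) s := by
  induction n generalizing s with
  | zero =>
    by_cases hs : s ∈ Goal
    · rw [boundedValue_goal M Goal _ hs, boundedValue_goal M Goal _ hs]
    · simpa [MDP.boundedValue, hs] using boundedValue_nonneg M Goal 1 s
  | succ n ih =>
    by_cases hs : s ∈ Goal
    · rw [boundedValue_goal M Goal _ hs, boundedValue_goal M Goal _ hs]
    · conv_lhs => simp only [MDP.boundedValue, if_neg hs]
      refine Finset.sup'_le _ _ fun α hα => le_trans (Finset.sum_le_sum fun t _ => ?_)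
        (sum_boundedValue_le M Goal hs hα)
      exact mul_le_mul_of_nonneg_left (ih t) (by exact_mod_cast M.P_nonneg s α t)

/-- The value within `j + 1` steps is attained by an action. For `n = 0`, and at a state of `Goal`,
any enabled action will do. -/
theorem exists_optimal_action (n : ℕ) (s : S) : ∃ α ∈ M.act s, s ∉ Goal →
    ∀ j, n = j + 1 →
      M.boundedValue Goal n s = ∑ t, (M.P s α t : ℝ) * M.boundedValue Goal j t := by
  cases n with
  | zero =>
    obtain ⟨α, hα⟩ := M.act_nonempty s
    exact ⟨α, hα, fun _ j hj => by omega⟩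
  | succ n =>
    obtain ⟨α, hα, h⟩ := Finset.exists_mem_eq_sup' (M.act_nonempty s)
      fun α => ∑ t, (M.P s α t : ℝ) * M.boundedValue Goal n t
    refine ⟨α, hα, fun hs j hj => ?_⟩
    obtain rfl : n = j := by omega
    simp only [MDP.boundedValue, if_neg hs]
    exact h

end BoundedValue

omit [Fintype S] [Finite A] in
theorem length_pastSteps {n : ℕ} {h : (i : Finset.Iic n) → Step S A}
    (hh : ∀ i, h i ≠ (none : Option (S × A))) : (pastSteps n h).length = n := by
  have := (List.reduceOption_length_eq_iff (l := List.ofFn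
    (fun i : Fin n => (h ⟨i, Finset.mem_Iic.mpr i.2.le⟩ : Option (S × A))))).2 (by
      intro x hx
      obtain ⟨i, rfl⟩ := (List.mem_ofFn' _ _).1 hx
      exact Option.isSome_iff_ne_none.2 (hh _))
  exact this.trans List.length_ofFn

open Classical in
/-- The scheduler that plays optimally for the remaining number of steps attains the bounded value:
along the paths that are consistent with it, the value of the remaining steps is a
submartingale. -/
theorem boundedValue_le_prMax (M : MDP S A) (Goal : Finset S) (N : ℕ) :
    ∑ s, (M.init s : ℝ) * M.boundedValue Goal N s ≤ M.prMax Goal := by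
  choose a ha hopt using exists_optimal_action M Goal
  let σ : M.Scheduler := ⟨fun h s => a (N - h.length) s, fun h s => ha _ s⟩
  -- The weight of a step with `j` steps to go; it vanishes if the step is not consistent with `σ`.
  let w : ℕ → Step S A → ℝ≥0∞ := fun j o =>
    o.elim 0 fun p => if p.2 = a j p.1 then ENNReal.ofReal (M.boundedValue Goal j p.1) else 0
  -- The path has not ended yet; only then does the length of the past steps tell the time.
  let allSome : (n : ℕ) → ((i : Finset.Iic n) → Step S A) → Prop :=
    fun n h => ∀ i, h i ≠ (none : Option (S × A))
  let E : ℕ → ℝ≥0∞ := fun n => ∫⁻ ω,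
    (if reachedBy Goal n (frestrictLe n ω) then 1 else
      if allSome n (frestrictLe n ω) then w (N - n) (ω n) else 0) ∂(M.pathMeasure σ)
  have hw0 : ∀ j, w j none = 0 := fun j => rfl
  have hE0 : ENNReal.ofReal (∑ s, (M.init s : ℝ) * M.boundedValue Goal N s) ≤ E 0 := by
    have h0 : ∫⁻ ω, w N (ω 0) ∂(M.pathMeasure σ) ≤ E 0 := by
      refine lintegral_mono fun ω => ?_
      dsimp only
      simp only [reachedBy_zero]
      split_ifs with h h'
      · obtain ⟨s, hs, α, h⟩ := h
        rw [h]
        simp only [w, Option.elim_some]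
        split_ifs
        · simpa using boundedValue_le_one M Goal N s
        · exact zero_le
      · exact le_rfl
      · have : ω 0 = none := by
          simp only [allSome, not_forall, not_not] at h'
          obtain ⟨⟨i, hi⟩, h'⟩ := h'
          obtain rfl : i = 0 := by simpa using hi
          exact h'
        rw [this, hw0]
    refine le_trans (le_of_eq ?_) h0
    rw [lintegral_pathMeasure_zero, lintegral_firstStep, ENNReal.ofReal_sum_of_nonneg fun s _ =>
      mul_nonneg (by exact_mod_cast M.init_nonneg s) (boundedValue_nonneg M Goal N s), hw0,
      mul_zero, zero_add]
    refine Finset.sum_congr rfl fun s _ => ?_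
    rw [ENNReal.ofReal_mul (by exact_mod_cast M.init_nonneg s)]
    simp [w, σ]
  have hEs : ∀ n, n + 1 ≤ N → E n ≤ E (n + 1) := by
    intro n hn
    have hsucc : ∀ ω : ℕ → Step S A, allSome (n + 1) (frestrictLe (n + 1) ω) ↔
        allSome n (frestrictLe n ω) ∧ ω (n + 1) ≠ (none : Option (S × A)) := by
      intro ω
      constructor
      · intro h
        exact ⟨fun i => h ⟨i, Finset.mem_Iic.2 ((Finset.mem_Iic.1 i.2).trans n.le_succ)⟩,
          h ⟨n + 1, by simp⟩⟩
      · rintro ⟨h1, h2⟩ ⟨i, hi⟩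
        rcases Nat.lt_or_ge n i with hn | hn
        · obtain rfl : i = n + 1 := le_antisymm (Finset.mem_Iic.1 hi) hn
          exact h2
        · exact h1 ⟨i, Finset.mem_Iic.2 hn⟩
    simp only [E, reachedBy_succ, hsucc]
    rw [lintegral_pathMeasure_succ M σ n
      (fun h y => if reachedBy Goal n h ∨ stepIn Goal y then 1 else
        if allSome n h ∧ y ≠ (none : Option (S × A)) then w (N - (n + 1)) y else 0)]
    refine lintegral_mono fun ω => ?_
    by_cases hr : reachedBy Goal n (frestrictLe n ω)
    · simp [hr]
    by_cases hs : allSome n (frestrictLe n ω)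
    swap
    · simp [hr, hs]
    have hlen := length_pastSteps hs
    simp only [hr, hs, if_false, if_true, false_or, true_and]
    obtain ⟨⟨s, α⟩, ho⟩ := Option.ne_none_iff_exists'.1 (hs ⟨n, by simp⟩)
    replace ho : ω n = some (s, α) := ho
    have hsG : s ∉ Goal := fun h => hr ⟨⟨n, by simp⟩, s, h, α, ho⟩
    rw [ho]
    by_cases hα : α = a (N - n) s
    swap
    · simp [w, hα]
    have hact : α ∈ M.act s := hα ▸ ha _ s
    rw [lintegral_nextStep M σ _ hact]
    have hv : w (N - n) (some (s, α)) =
        ∑ t, ENNReal.ofReal (M.P s α t) *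
          ENNReal.ofReal (M.boundedValue Goal (N - (n + 1)) t) := by
      simp only [w, Option.elim_some, if_pos hα]
      rw [hopt (N - n) s hsG (N - (n + 1)) (by omega), ← hα,
        ENNReal.ofReal_sum_of_nonneg fun t _ =>
          mul_nonneg (by exact_mod_cast M.P_nonneg s α t) (boundedValue_nonneg M Goal _ t)]
      refine Finset.sum_congr rfl fun t _ => ?_
      rw [ENNReal.ofReal_mul (by exact_mod_cast M.P_nonneg s α t)]
    rw [hv]
    refine le_trans (Finset.sum_le_sum fun t _ => ?_) le_add_self
    refine mul_le_mul_right ?_ _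
    split_ifs with h1 h2
    · simpa using boundedValue_le_one M Goal _ t
    · simp [w, σ, hlen]
    · simp at h2
  have hE : ∀ n ≤ N, ENNReal.ofReal (∑ s, (M.init s : ℝ) * M.boundedValue Goal N s) ≤ E n := by
    intro n
    induction n with
    | zero => exact fun _ => hE0
    | succ n ih => exact fun hn => (ih (by omega)).trans (hEs n hn)
  have hev : ENNReal.ofReal (∑ s, (M.init s : ℝ) * M.boundedValue Goal N s) ≤
      M.pathMeasure σ (eventuallyIn Goal) := by
    refine (hE N le_rfl).trans ?_
    rw [eventuallyIn_eq_iUnion]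
    refine le_trans ?_ (measure_mono (Set.subset_iUnion _ N))
    rw [← lintegral_indicator_one (measurableSet_reachedBy Goal N)]
    refine lintegral_mono fun ω => ?_
    by_cases h : reachedBy Goal N (frestrictLe N ω)
    · simp [h]
    · simp only [h, if_false]
      split_ifs
      · rw [Nat.sub_self]
        rcases ho : ω N with _ | ⟨s, α⟩
        · exact zero_le
        · have hs : s ∉ Goal := fun hs => h ⟨⟨N, by simp⟩, s, hs, α, ho⟩
          simp [w, MDP.boundedValue, hs]
      · exact zero_le
  have hb : BddAbove
      (Set.range fun σ : M.Scheduler => (M.pathMeasure σ).real (eventuallyIn Goal)) :=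
    ⟨1, by rintro _ ⟨σ, rfl⟩; exact measureReal_le_one⟩
  exact ((ENNReal.ofReal_le_iff_le_toReal (measure_ne_top _ _)).1 hev).trans (le_ciSup hb σ)

/-- The limit of the bounded values is excessive, and the supremum over the schedulers is at least
its initial value. Together with `MDP.IsExcessive.prMax_le` this determines the maximal probability as the
least solution of the Bellman inequalities. -/
theorem exists_isExcessive_le_prMax (M : MDP S A) (Goal : Finset S) :
    ∃ x, M.IsExcessive Goal x ∧ ∑ s, (M.init s : ℝ) * x s ≤ M.prMax Goal := by
  classical
  have hmono : ∀ s, Monotone fun n => M.boundedValue Goal n s := fun s =>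
    monotone_nat_of_le_succ fun n => boundedValue_le_succ M Goal n s
  have hbdd : ∀ s, BddAbove (Set.range fun n => M.boundedValue Goal n s) := fun s =>
    ⟨1, by rintro _ ⟨n, rfl⟩; exact boundedValue_le_one M Goal n s⟩
  have hlim := fun s => tendsto_atTop_ciSup (hmono s) (hbdd s)
  refine ⟨fun s => ⨆ n, M.boundedValue Goal n s, ⟨fun s => ?_, fun s hs => ?_,
    fun s hs α hα => ?_⟩, ?_⟩
  · exact (boundedValue_nonneg M Goal 0 s).trans (le_ciSup (hbdd s) 0)
  · exact (boundedValue_goal M Goal 0 hs).ge.trans (le_ciSup (hbdd s) 0)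
  · refine le_of_tendsto (tendsto_finsetSum _ fun t _ => (hlim t).const_mul _)
      (Filter.Eventually.of_forall fun n => (sum_boundedValue_le M Goal hs hα).trans
        (le_ciSup (hbdd s) (n + 1)))
  · exact le_of_tendsto (tendsto_finsetSum _ fun t _ => (hlim t).const_mul _)
      (Filter.Eventually.of_forall fun n => boundedValue_le_prMax M Goal n)

end Reachability

/-! ### Results of timed computations -/

section TimedValues

open Timed

variable {α β : Type}

namespace Timed

@[simp] theorem val_bind (x : Timed α) (f : α → Timed β) : (x >>= f).val = (f x.val).val := rfl
@[simp] theorem val_op (c : ℕ) (a : α) : (op c a).val = a := rfl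
@[simp] theorem val_append (l r : List α) : (append l r).val = l ++ r := rfl
@[simp] theorem val_tabulate {ι : Type} [FinEnum ι] (f : ι → Timed β) :
    (tabulate f).val = fun i => (f i).val := rfl

@[simp] theorem val_mapL (f : α → Timed β) (l : List α) :
    (mapL f l).val = l.map fun a => (f a).val := by
  induction l with
  | nil => rfl
  | cons a l ih => simp [mapL, ih]

@[simp] theorem val_flatMapL (f : α → Timed (List β)) (l : List α) :
    (flatMapL f l).val = l.flatMap fun a => (f a).val := by
  induction l with
  | nil => rfl
  | cons a l ih => simp [flatMapL, ih]

@[simp] theorem val_filterL (p : α → Timed Bool) (l : List α) :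
    (filterL p l).val = l.filter fun a => (p a).val := by
  induction l with
  | nil => rfl
  | cons a l ih => simp [filterL, ih, List.filter_cons]

@[simp] theorem val_anyL (p : α → Timed Bool) (l : List α) :
    (anyL p l).val = l.any fun a => (p a).val := by
  induction l with
  | nil => rfl
  | cons a l ih => simp [anyL, ih]

@[simp] theorem val_allL (p : α → Timed Bool) (l : List α) :
    (allL p l).val = l.all fun a => (p a).val := by
  induction l with
  | nil => rfl
  | cons a l ih => simp [allL, ih]

@[simp] theorem val_foldL (f : β → α → Timed β) (x : β) (l : List α) :
    (foldL f x l).val = l.foldl (fun y a => (f y a).val) x := by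
  induction l generalizing x with
  | nil => rfl
  | cons a l ih => simp [foldL, ih]

end Timed

@[simp] theorem val_addQ (a b : ℚ) : (addQ a b).val = a + b := rfl
@[simp] theorem val_mulQ (a b : ℚ) : (mulQ a b).val = a * b := rfl
@[simp] theorem val_divQ (a b : ℚ) : (divQ a b).val = a / b := rfl
@[simp] theorem val_leQ (a b : ℚ) : (leQ a b).val = decide (a ≤ b) := rfl
@[simp] theorem val_eqQ (a b : ℚ) : (eqQ a b).val = decide (a = b) := rfl

@[simp] theorem val_sumQ {ι : Type} (f : ι → Timed ℚ) (l : List ι) :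
    (sumQ f l).val = (l.map fun i => (f i).val).sum := by
  induction l with
  | nil => rfl
  | cons a l ih => simp [sumQ, ih]

theorem sum_map_toList {ι R : Type} [FinEnum ι] [Fintype ι] [AddCommMonoid R] (f : ι → R) :
    ((FinEnum.toList ι).map f).sum = ∑ i, f i := by
  classical
  rw [← List.sum_toFinset f FinEnum.nodup_toList]
  congr 1
  ext i
  simp

theorem sum_map_finRange {n : ℕ} {R : Type} [AddCommMonoid R] (f : Fin n → R) :
    ((List.finRange n).map f).sum = ∑ i, f i := by
  rw [← List.sum_toFinset f (List.nodup_finRange n)]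
  congr 1
  ext i
  simp

end TimedValues

/-! ### Basic feasible solutions -/

section LinearPrograms

variable {ρ ι : Type}

theorem val_pivot [FinEnum ρ] [FinEnum ι] (T : ρ → Option ι → ℚ) (i : ρ) (j : ι) :
    (pivot T i j).val = fun i' l => if i' = i then T i l / T i (some j)
      else T i' l - T i' (some j) * (T i l / T i (some j)) := by
  funext i' l
  simp only [pivot, Timed.val_bind, Timed.val_tabulate]
  split_ifs <;> rfl

theorem argminObjective_spec (obj : (ι → ℚ) → Timed ℚ) (ys : List (ι → ℚ)) :
    (ys = [] ∧ (argminObjective obj ys).val = none) ∨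
      ∃ y ∈ ys, (argminObjective obj ys).val = some y ∧
        ∀ z ∈ ys, (obj y).val ≤ (obj z).val := by
  have key : ∀ (ys : List (ι → ℚ)) (z : ι → ℚ), ∃ y ∈ z :: ys,
      ys.foldl (fun (best : Option ((ι → ℚ) × ℚ)) y => ((do
        let v ← obj y
        match best with
        | none => Timed.op 1 (some (y, v))
        | some (z, w) => do
          let c ← leQ w v
          Timed.op 1 (if c then some (z, w) else some (y, v))) : Timed _).val)
        (some (z, (obj z).val)) = some (y, (obj y).val) ∧
        ∀ z' ∈ z :: ys, (obj y).val ≤ (obj z').val := by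
    intro ys
    induction ys with
    | nil => intro z; exact ⟨z, by simp, rfl, by simp⟩
    | cons a ys ih =>
      intro z
      simp only [List.foldl_cons, Timed.val_bind, val_leQ, Timed.val_op, decide_eq_true_eq]
      split_ifs with h
      · obtain ⟨y, hy, h1, h2⟩ := ih z
        refine ⟨y, ?_, h1, ?_⟩
        · rcases List.mem_cons.1 hy with rfl | hy <;> simp_all
        · intro z' hz'
          rcases List.mem_cons.1 hz' with rfl | hz'
          · exact h2 _ (by simp)
          · rcases List.mem_cons.1 hz' with rfl | hz'
            · exact (h2 z (by simp)).trans h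
            · exact h2 _ (by simp [hz'])
      · obtain ⟨y, hy, h1, h2⟩ := ih a
        refine ⟨y, by simp [hy], h1, ?_⟩
        intro z' hz'
        rcases List.mem_cons.1 hz' with rfl | hz'
        · exact (h2 a (by simp)).trans (le_of_not_ge h)
        · exact h2 _ hz'
  rcases ys with _ | ⟨z, ys⟩
  · exact Or.inl ⟨rfl, rfl⟩
  · right
    obtain ⟨y, hy, h1, h2⟩ := key ys z
    refine ⟨y, hy, ?_, h2⟩
    simp only [argminObjective, Timed.val_bind, Timed.val_foldL, List.foldl_cons, Timed.val_op]
    exact congrArg (Option.map Prod.fst) h1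

variable [Fintype ι]

/-- `y` is a real solution of the linear system `T`. -/
def Solves (T : ρ → Option ι → ℚ) (y : ι → ℝ) : Prop :=
  ∀ i, ∑ j, (T i (some j) : ℝ) * y j = T i none

/-- The columns of `T` in the support of `y` are linearly independent. -/
def IndependentSupport (T : ρ → Option ι → ℚ) (y : ι → ℝ) : Prop :=
  ∀ d : ι → ℝ, (∀ j, y j = 0 → d j = 0) → (∀ i, ∑ j, (T i (some j) : ℝ) * d j = 0) → d = 0

/-- Costs are nonnegative, so that one of the directions `d` and `-d` decreases a coordinate without
increasing the cost. -/
theorem exists_descent_direction (c : ι → ℝ) (hc : ∀ j, 0 ≤ c j) {d : ι → ℝ} (hd : d ≠ 0) :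
    ∃ e : ι → ℝ, (e = d ∨ e = -d) ∧ ∑ j, c j * e j ≤ 0 ∧ ∃ j, e j < 0 := by
  have hneg : ∑ j, c j * (-d) j = -∑ j, c j * d j := by
    simp [Finset.sum_neg_distrib]
  rcases le_or_gt (∑ j, c j * d j) 0 with h | h
  · by_cases hn : ∃ j, d j < 0
    · exact ⟨d, Or.inl rfl, h, hn⟩
    · push Not at hn
      obtain ⟨j, hj⟩ := Function.ne_iff.1 hd
      have h0 : 0 ≤ ∑ j, c j * d j := Finset.sum_nonneg fun j _ => mul_nonneg (hc j) (hn j)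
      refine ⟨-d, Or.inr rfl, by rw [hneg]; linarith, j, ?_⟩
      have : d j ≠ 0 := hj
      have := lt_of_le_of_ne (hn j) this.symm
      simpa using this
  · refine ⟨-d, Or.inr rfl, by rw [hneg]; linarith, ?_⟩
    by_contra hn
    push Not at hn
    have : 0 ≤ ∑ j, c j * (-d) j := Finset.sum_nonneg fun j _ => mul_nonneg (hc j) (hn j)
    linarith

/-- A linear program with nonnegative costs: moving along a kernel direction in the support until a
coordinate vanishes turns a feasible point into a vertex that costs no more. -/
theorem exists_independentSupport (T : ρ → Option ι → ℚ) (c : ι → ℝ) (hc : ∀ j, 0 ≤ c j)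
    (y : ι → ℝ) (hy : ∀ j, 0 ≤ y j) (hT : Solves T y) :
    ∃ z : ι → ℝ, (∀ j, 0 ≤ z j) ∧ Solves T z ∧ IndependentSupport T z ∧
      ∑ j, c j * z j ≤ ∑ j, c j * y j := by
  classical
  induction hN : (Finset.univ.filter fun j => y j ≠ 0).card using Nat.strong_induction_on
    generalizing y with
  | _ N ih =>
    by_cases hI : IndependentSupport T y
    · exact ⟨y, hy, hT, hI, le_rfl⟩
    simp only [IndependentSupport, not_forall] at hI
    obtain ⟨d, hsupp, hker, hd⟩ := hI
    obtain ⟨e, he, hce, hneg⟩ := exists_descent_direction c hc hd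
    have hes : ∀ j, y j = 0 → e j = 0 := by
      rcases he with rfl | rfl
      · exact hsupp
      · intro j hj; simp [hsupp j hj]
    have hek : ∀ i, ∑ j, (T i (some j) : ℝ) * e j = 0 := by
      rcases he with rfl | rfl
      · exact hker
      · intro i; simp [Finset.sum_neg_distrib, hker i]
    obtain ⟨j1, hj1⟩ := hneg
    -- The longest step along `e` that keeps all coordinates nonnegative annihilates one of them.
    obtain ⟨j0, hj0, hmin⟩ := Finset.exists_min_image (Finset.univ.filter fun j => e j < 0)
      (fun j => y j / (-e j)) ⟨j1, by simpa using hj1⟩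
    simp only [Finset.mem_filter, Finset.mem_univ, true_and] at hj0 hmin
    set t := y j0 / (-e j0) with ht
    have ht0 : 0 ≤ t := div_nonneg (hy j0) (by linarith)
    have hz : ∀ j, 0 ≤ y j + t * e j := by
      intro j
      rcases lt_or_ge (e j) 0 with h | h
      · have h1 := hmin j h
        rw [le_div_iff₀ (by linarith)] at h1
        linarith
      · exact add_nonneg (hy j) (mul_nonneg ht0 h)
    have hz0 : y j0 + t * e j0 = 0 := by
      rw [ht]; field_simp [hj0.ne]; ring
    have hyj0 : y j0 ≠ 0 := fun h => hj0.ne (hes j0 h)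
    obtain ⟨z, h1, h2, h3, h4⟩ := ih (Finset.univ.filter fun j => y j + t * e j ≠ 0).card (by
      rw [← hN]
      apply Finset.card_lt_card
      refine Finset.ssubset_iff_of_subset (fun j hj => ?_) |>.2 ⟨j0, by simpa using hyj0, by
        simpa using hz0⟩
      simp only [Finset.mem_filter, Finset.mem_univ, true_and] at hj ⊢
      intro h
      apply hj
      rw [h, hes j h]; simp) (fun j => y j + t * e j) hz (by
        intro i
        simp only [mul_add, Finset.sum_add_distrib, hT i]
        have : ∑ j, (T i (some j) : ℝ) * (t * e j) = t * ∑ j, (T i (some j) : ℝ) * e j := by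
          rw [Finset.mul_sum]; exact Finset.sum_congr rfl fun j _ => by ring
        rw [this, hek i]; simp) rfl
    refine ⟨z, h1, h2, h3, h4.trans ?_⟩
    simp only [mul_add, Finset.sum_add_distrib]
    have : ∑ j, c j * (t * e j) = t * ∑ j, c j * e j := by
      rw [Finset.mul_sum]; exact Finset.sum_congr rfl fun j _ => by ring
    rw [this]
    nlinarith

variable [FinEnum ρ] [FinEnum ι]

theorem sum_pivot (T : ρ → Option ι → ℚ) (i : ρ) (j : ι) (i' : ρ) (y : ι → ℝ) :
    ∑ l, ((pivot T i j).val i' (some l) : ℝ) * y l =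
      if i' = i then (∑ l, (T i (some l) : ℝ) * y l) / T i (some j)
      else ∑ l, (T i' (some l) : ℝ) * y l -
        T i' (some j) * ((∑ l, (T i (some l) : ℝ) * y l) / T i (some j)) := by
  rw [val_pivot]
  split_ifs with h
  · simp only [h, if_true, Rat.cast_div, Finset.sum_div]
    exact Finset.sum_congr rfl fun l _ => by ring
  · simp only [h, if_false, Rat.cast_sub, Rat.cast_mul, Rat.cast_div, Finset.sum_div,
      Finset.mul_sum, ← Finset.sum_sub_distrib]
    exact Finset.sum_congr rfl fun l _ => by ring

theorem Solves.pivot {T : ρ → Option ι → ℚ} {y : ι → ℝ} (h : Solves T y) (i : ρ) (j : ι) :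
    Solves (pivot T i j).val y := by
  intro i'
  rw [sum_pivot, h i, h i', val_pivot]
  split_ifs with hi <;> simp [hi]

theorem IndependentSupport.pivot {T : ρ → Option ι → ℚ} {y : ι → ℝ} (h : IndependentSupport T y)
    {i : ρ} {j : ι} (hij : T i (some j) ≠ 0) : IndependentSupport (pivot T i j).val y := by
  intro d hd hk
  have hi : ∑ l, (T i (some l) : ℝ) * d l = 0 := by
    have := hk i
    rw [sum_pivot, if_pos rfl, div_eq_zero_iff] at this
    exact this.resolve_right (by exact_mod_cast hij)
  refine h d hd fun i' => ?_
  by_cases hi' : i' = i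
  · rw [hi', hi]
  · have := hk i'
    rw [sum_pivot, if_neg hi', hi] at this
    simpa using this

/-- The state of the Gauss–Jordan elimination that heads for the vertex `y`: the columns chosen so
far are unit columns in the support of `y`, and every row that was skipped vanishes on the whole
support. -/
structure PivotState (y : ι → ℝ) (l : List ρ) (T : ρ → Option ι → ℚ) (basis : ι → Option ρ) :
    Prop where
  solves : Solves T y
  indep : IndependentSupport T y
  support : ∀ j i, basis j = some i → y j ≠ 0
  used : ∀ j i, basis j = some i → i ∉ l
  unit : ∀ j i, basis j = some i → ∀ i', T i' (some j) = if i' = i then 1 else 0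
  inj : ∀ j j' i, basis j = some i → basis j' = some i → j = j'
  skipped : ∀ i, i ∉ l → (∀ j, basis j ≠ some i) → ∀ j, y j ≠ 0 → T i (some j) = 0

theorem PivotState.basis_ne_none {y : ι → ℝ} {T : ρ → Option ι → ℚ} {basis : ι → Option ρ}
    (h : PivotState y [] T basis) {j0 : ι} (hj0 : y j0 ≠ 0) : basis j0 ≠ none := by
  intro hb
  -- Otherwise the column `j0` is a combination of the unit columns of the basis.
  have hd := h.indep (fun j => if j = j0 then 1 else (basis j).elim 0 fun i => -(T i (some j0) : ℝ))
    (by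
      intro j hj
      rw [if_neg (by rintro rfl; exact hj0 hj)]
      rcases hbj : basis j with _ | i
      · rfl
      · exact absurd hj (h.support j i hbj))
    (by
      intro i
      by_cases hi : ∃ j1, basis j1 = some i
      · obtain ⟨j1, hj1⟩ := hi
        have hne : j0 ≠ j1 := by rintro rfl; simp [hb] at hj1
        rw [Finset.sum_eq_add j0 j1 hne _ (by simp) (by simp)]
        · rw [if_pos rfl, if_neg hne.symm, hj1, h.unit j1 i hj1 i]
          simp
        · rintro j - ⟨h0, h1⟩
          rw [if_neg h0]
          rcases hbj : basis j with _ | i'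
          · simp
          · have : i ≠ i' := by rintro rfl; exact h1 (h.inj _ _ _ hbj hj1)
            rw [h.unit j i' hbj i, if_neg this]
            simp
      · push Not at hi
        refine Finset.sum_eq_zero fun j _ => ?_
        by_cases hj : y j = 0
        · rw [if_neg (by rintro rfl; exact hj0 hj)]
          rcases hbj : basis j with _ | i'
          · simp
          · exact absurd hj (h.support j i' hbj)
        · rw [h.skipped i (by simp) hi j hj]
          simp)
  have := congrFun hd j0
  simp at this

/-- The enumeration finds every vertex `y`: in each row, pivot on an unused column in the support of
`y` if there is one with a nonzero entry, and skip the row otherwise. -/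
theorem PivotState.exists_mem_basicSolutions {y : ι → ℝ} {l : List ρ} {T : ρ → Option ι → ℚ}
    {basis : ι → Option ρ} (hl : l.Nodup) (h : PivotState y l T basis) :
    ∃ q ∈ (basicSolutions l T basis).val, ∀ j, (q j : ℝ) = y j := by
  induction l generalizing T basis with
  | nil =>
    simp only [basicSolutions, Timed.val_bind, Timed.val_tabulate, Timed.val_op,
      List.mem_singleton, exists_eq_left]
    intro j
    rcases hbj : basis j with _ | i
    · by_contra hy
      exact h.basis_ne_none (by simpa using Ne.symm hy) hbj
    · have hi := h.solves i
      rw [Finset.sum_eq_single j] at hi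
      · rw [h.unit j i hbj i] at hi
        simpa using hi.symm
      · intro j' _ hj'
        by_cases hy : y j' = 0
        · simp [hy]
        · rcases hbj' : basis j' with _ | i'
          · exact absurd hbj' (h.basis_ne_none hy)
          · have : i ≠ i' := by rintro rfl; exact hj' (h.inj _ _ _ hbj' hbj)
            rw [h.unit j' i' hbj' i, if_neg this]
            simp
      · simp
  | cons i l ih =>
    rw [List.nodup_cons] at hl
    simp only [basicSolutions, Timed.val_bind, Timed.val_append, List.mem_append,
      Timed.val_flatMapL, List.mem_flatMap]
    by_cases hex : ∃ j, y j ≠ 0 ∧ T i (some j) ≠ 0 ∧ basis j = none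
    · obtain ⟨j, hyj, hTj, hbj⟩ := hex
      have hcol : ∀ j2 i2, basis j2 = some i2 → i ≠ i2 := fun j2 i2 h2 hi =>
        h.used j2 i2 h2 (by simp [hi])
      obtain ⟨q, hq, hqy⟩ := ih hl.2 (T := (pivot T i j).val)
        (basis := fun j' => if j' = j then some i else basis j')
        { solves := h.solves.pivot i j
          indep := h.indep.pivot hTj
          support := by
            intro j2 i2 h2
            split_ifs at h2 with hj
            · rwa [hj]
            · exact h.support j2 i2 h2
          used := by
            intro j2 i2 h2
            split_ifs at h2 with hj
            · simp only [Option.some.injEq] at h2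
              exact h2 ▸ hl.1
            · exact fun hm => h.used j2 i2 h2 (List.mem_cons_of_mem _ hm)
          unit := by
            intro j2 i2 h2 i'
            rw [val_pivot]
            split_ifs at h2 with hj
            · simp only [Option.some.injEq] at h2
              subst h2 hj
              by_cases hi' : i' = i
              · simp [hi', hTj]
              · simp [hi', hTj]
            · have h3 := h.unit j2 i2 h2 i
              rw [if_neg (hcol j2 i2 h2)] at h3
              simp only [h3, zero_div, mul_zero, sub_zero]
              split_ifs with h4 h5 h5
              · exact absurd (h4.symm.trans h5) (hcol j2 i2 h2)
              · rfl
              · rw [h.unit j2 i2 h2 i', if_pos h5]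
              · rw [h.unit j2 i2 h2 i', if_neg h5]
          inj := by
            intro j2 j3 i2 h2 h3
            split_ifs at h2 h3 with hj2 hj3 hj3
            · rw [hj2, hj3]
            · simp only [Option.some.injEq] at h2
              exact absurd h2 (hcol j3 i2 h3)
            · simp only [Option.some.injEq] at h3
              exact absurd h3 (hcol j2 i2 h2)
            · exact h.inj _ _ _ h2 h3
          skipped := by
            intro i' hi' hb' j' hj'
            have hne : i' ≠ i := by rintro rfl; exact hb' j (by simp)
            have h0 := h.skipped i' (by simp [hne, hi']) (by
              intro j2 h2
              apply hb' j2
              rw [if_neg (by rintro rfl; simp [hbj] at h2), h2])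
            rw [val_pivot]
            simp [hne, h0 j' hj', h0 j hyj] }
      refine ⟨q, Or.inr ⟨j, by simp, ?_⟩, hqy⟩
      simp only [val_eqQ, decide_eq_true_eq, if_neg hTj, Timed.val_bind]
      simpa using hq
    · push Not at hex
      obtain ⟨q, hq, hqy⟩ := ih hl.2 (T := T) (basis := basis)
        { h with
          used := fun j2 i2 h2 hm => h.used j2 i2 h2 (List.mem_cons_of_mem _ hm)
          skipped := by
            intro i' hi' hb' j' hj'
            by_cases hii : i' = i
            · subst hii
              by_contra hT
              have := hex j' hj' hT
              rcases hbj : basis j' with _ | i2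
              · exact this hbj
              · have h3 := h.unit j' i2 hbj i'
                rw [if_neg (by rintro rfl; exact hb' _ hbj)] at h3
                exact hT h3
            · exact h.skipped i' (by simp [hii, hi']) hb' j' hj' }
      exact ⟨q, Or.inl hq, hqy⟩

theorem isFeasible_iff (T : ρ → Option ι → ℚ) (q : ι → ℚ) :
    (isFeasible T q).val = true ↔ (∀ j, 0 ≤ q j) ∧ Solves T fun j => (q j : ℝ) := by
  simp only [isFeasible, Timed.val_bind, Timed.val_allL, Timed.val_op, Bool.and_eq_true,
    List.all_eq_true, FinEnum.mem_toList, val_leQ, val_eqQ, val_sumQ, val_mulQ, decide_eq_true_eq,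
    true_implies, Solves, sum_map_toList]
  refine and_congr_right fun _ => forall_congr' fun i => ?_
  rw [← Rat.cast_inj (α := ℝ)]
  push_cast
  rfl

theorem mem_basicFeasible {T : ρ → Option ι → ℚ} {q : ι → ℚ} (hq : q ∈ (basicFeasible T).val) :
    (∀ j, 0 ≤ q j) ∧ Solves T fun j => (q j : ℝ) := by
  simp only [basicFeasible, Timed.val_bind, Timed.val_filterL, List.mem_filter] at hq
  exact (isFeasible_iff T q).1 hq.2

/-- A linear program with nonnegative costs attains its minimum at a basic feasible solution of the
list, if it is feasible at all. -/
theorem exists_mem_basicFeasible (T : ρ → Option ι → ℚ) (c : ι → ℝ) (hc : ∀ j, 0 ≤ c j)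
    (y : ι → ℝ) (hy : ∀ j, 0 ≤ y j) (hT : Solves T y) :
    ∃ q ∈ (basicFeasible T).val, ∑ j, c j * (q j : ℝ) ≤ ∑ j, c j * y j := by
  obtain ⟨z, hz, hTz, hI, hcz⟩ := exists_independentSupport T c hc y hy hT
  obtain ⟨q, hq, hqz⟩ := PivotState.exists_mem_basicSolutions (y := z) (T := T)
    (basis := fun _ => none) (l := FinEnum.toList ρ) FinEnum.nodup_toList
    { solves := hTz, indep := hI, support := by simp, used := by simp, unit := by simp
      inj := by simp, skipped := by simp }
  have hqz' : (fun j => (q j : ℝ)) = z := funext hqz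
  refine ⟨q, ?_, by simpa only [hqz] using hcz⟩
  simp only [basicFeasible, Timed.val_bind, Timed.val_filterL, List.mem_filter]
  refine ⟨hq, (isFeasible_iff T q).2 ⟨fun j => ?_, ?_⟩⟩
  · exact_mod_cast (hqz j).symm ▸ hz j
  · rw [hqz']; exact hTz

end LinearPrograms

/-! ### The values of the states of a subsystem -/

section Values

variable {n m : ℕ}

/-- `x` satisfies the Bellman inequalities of the system induced by `X` in which the states of `dom`
have the fixed value `f`. -/
structure IsBellman (M : MDP (Fin n) (Fin m)) (Goal X : Finset (Fin n)) (dom : Fin n → Bool)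
    (f x : Fin n → ℝ) : Prop where
  nonneg : ∀ s, 0 ≤ x s
  goal : ∀ s ∈ X, s ∈ Goal → 1 ≤ x s
  fixed : ∀ s ∈ X, s ∉ Goal → dom s = true → f s ≤ x s
  step : ∀ s ∈ X, s ∉ Goal → dom s = false → ∀ α ∈ M.act s, ∑ t ∈ X, (M.P s α t : ℝ) * x t ≤ x s

theorem IsBellman.min {M : MDP (Fin n) (Fin m)} {Goal X : Finset (Fin n)} {dom : Fin n → Bool}
    {f x y : Fin n → ℝ} (hx : IsBellman M Goal X dom f x) (hy : IsBellman M Goal X dom f y) :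
    IsBellman M Goal X dom f fun s => min (x s) (y s) where
  nonneg s := le_min (hx.nonneg s) (hy.nonneg s)
  goal s hs hg := le_min (hx.goal s hs hg) (hy.goal s hs hg)
  fixed s hs hg hd := le_min (hx.fixed s hs hg hd) (hy.fixed s hs hg hd)
  step s hs hg hd α hα := by
    have hP : ∀ t, (0 : ℝ) ≤ M.P s α t := fun t => by exact_mod_cast M.P_nonneg s α t
    exact le_min
      ((Finset.sum_le_sum fun t _ => mul_le_mul_of_nonneg_left (min_le_left _ _) (hP t)).trans
        (hx.step s hs hg hd α hα))
      ((Finset.sum_le_sum fun t _ => mul_le_mul_of_nonneg_left (min_le_right _ _) (hP t)).trans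
        (hy.step s hs hg hd α hα))

theorem isBellman_one (M : MDP (Fin n) (Fin m)) (Goal X : Finset (Fin n)) (dom : Fin n → Bool)
    {f : Fin n → ℝ} (hf : ∀ s, f s ≤ 1) : IsBellman M Goal X dom f fun _ => 1 where
  nonneg _ := zero_le_one
  goal _ _ _ := le_rfl
  fixed s _ _ _ := hf s
  step s _ _ _ α hα := by
    simp only [mul_one]
    exact (Finset.sum_le_sum_of_subset_of_nonneg (Finset.subset_univ X)
      (fun t _ _ => by exact_mod_cast M.P_nonneg s α t)).trans (sum_P_real_le_one M hα)

section ValueConstraints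

variable (M : MDP (Fin n) (Fin m)) (Goal X : Finset (Fin n)) (dom : Fin n → Bool) (f : Fin n → ℚ)

theorem val_valueConstraints (r : Fin n × Fin m) (c : Option (Fin n ⊕ Fin n × Fin m)) :
    (valueConstraints M Goal X dom f).val r c =
      if r.1 ∉ X ∨ r.2 ∉ M.act r.1 then 0
      else match c with
        | none => if r.1 ∈ Goal then 1 else if dom r.1 then f r.1 else 0
        | some (Sum.inl t) => (if t = r.1 then 1 else 0) -
            (if r.1 ∈ Goal ∨ dom r.1 ∨ t ∉ X then 0 else M.P r.1 r.2 t)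
        | some (Sum.inr r') => if r' = r then -1 else 0 := by
  simp only [valueConstraints, Timed.val_tabulate]
  by_cases h : r.1 ∉ X ∨ r.2 ∉ M.act r.1
  · rw [if_pos h, if_pos h]
    rfl
  · rw [if_neg h, if_neg h]
    rcases c with _ | t | r' <;> rfl

theorem sum_valueConstraints (y : Fin n ⊕ Fin n × Fin m → ℝ) {s : Fin n} {α : Fin m}
    (hs : s ∈ X) (hα : α ∈ M.act s) :
    ∑ j, ((valueConstraints M Goal X dom f).val (s, α) (some j) : ℝ) * y j =
      y (Sum.inl s) - (if s ∈ Goal ∨ dom s = true then 0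
        else ∑ t ∈ X, (M.P s α t : ℝ) * y (Sum.inl t)) - y (Sum.inr (s, α)) := by
  have hns : ¬(s ∉ X ∨ α ∉ M.act s) := by tauto
  simp only [val_valueConstraints, hns, if_false, Fintype.sum_sum_type]
  congr 1
  · push_cast
    simp only [sub_mul, Finset.sum_sub_distrib]
    congr 1
    · rw [Finset.sum_eq_single s (fun t _ ht => by simp [ht]) (by simp)]
      simp
    split_ifs with h
    · refine Finset.sum_eq_zero fun t _ => ?_
      rw [if_pos (by tauto)]
      simp
    · rw [← Finset.sum_filter_add_sum_filter_not Finset.univ (· ∈ X)]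
      rw [Finset.sum_eq_zero (s := Finset.univ.filter (· ∉ X)), add_zero]
      · simp only [Finset.filter_mem_eq_inter, Finset.univ_inter]
        refine Finset.sum_congr rfl fun t ht => ?_
        rw [if_neg (by tauto)]
      · intro t ht
        rw [if_pos (by simp at ht; tauto)]
        simp
  · rw [Finset.sum_eq_single (s, α) (fun r _ hr => by simp [hr]) (by simp)]
    simp

/-- The slack variables that complete a solution of the Bellman inequalities to a solution of the
linear system. -/
noncomputable def slack (x : Fin n → ℝ) (r : Fin n × Fin m) : ℝ :=
  if r.1 ∈ X ∧ r.2 ∈ M.act r.1 then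
    x r.1 - (if r.1 ∈ Goal ∨ dom r.1 = true then 0 else ∑ t ∈ X, (M.P r.1 r.2 t : ℝ) * x t) -
      (if r.1 ∈ Goal then 1 else if dom r.1 then (f r.1 : ℝ) else 0)
  else 0

theorem IsBellman.solves {x : Fin n → ℝ} (hx : IsBellman M Goal X dom (fun s => (f s : ℝ)) x) :
    (∀ j, 0 ≤ Sum.elim x (slack M Goal X dom f x) j) ∧
      Solves (valueConstraints M Goal X dom f).val (Sum.elim x (slack M Goal X dom f x)) := by
  constructor
  · rintro (s | ⟨s, α⟩)
    · exact hx.nonneg s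
    · simp only [Sum.elim_inr, slack]
      by_cases h : s ∈ X ∧ α ∈ M.act s
      · rw [if_pos h]
        by_cases hg : s ∈ Goal
        · simpa [hg] using hx.goal s h.1 hg
        · cases hd : dom s
          · simpa [hg] using hx.step s h.1 hg hd α h.2
          · simpa [hg] using hx.fixed s h.1 hg hd
      · rw [if_neg h]
  · rintro ⟨s, α⟩
    by_cases h : s ∈ X ∧ α ∈ M.act s
    · have hns : ¬(s ∉ X ∨ α ∉ M.act s) := by tauto
      rw [sum_valueConstraints M Goal X dom f _ h.1 h.2]
      simp only [val_valueConstraints, hns, if_false, Sum.elim_inl, Sum.elim_inr, slack, if_pos h]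
      by_cases hg : s ∈ Goal
      · simp [hg]
      · cases hd : dom s <;> simp [hg]
    · have h' : s ∉ X ∨ α ∉ M.act s := by tauto
      simp [val_valueConstraints, h']

theorem IsBellman.of_solves {y : Fin n ⊕ Fin n × Fin m → ℝ} (h0 : ∀ j, 0 ≤ y j)
    (hy : Solves (valueConstraints M Goal X dom f).val y) :
    IsBellman M Goal X dom (fun s => (f s : ℝ)) fun s => y (Sum.inl s) := by
  have key : ∀ s ∈ X, ∀ α ∈ M.act s,
      (if s ∈ Goal ∨ dom s = true then 0 else ∑ t ∈ X, (M.P s α t : ℝ) * y (Sum.inl t)) +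
        (if s ∈ Goal then 1 else if dom s then (f s : ℝ) else 0) ≤ y (Sum.inl s) := by
    intro s hs α hα
    have h := hy (s, α)
    have hns : ¬(s ∉ X ∨ α ∉ M.act s) := by tauto
    rw [sum_valueConstraints M Goal X dom f _ hs hα] at h
    simp only [val_valueConstraints, hns, if_false] at h
    have := h0 (Sum.inr (s, α))
    by_cases hg : s ∈ Goal
    · simp only [hg, true_or, if_true, Rat.cast_one] at h ⊢
      linarith
    · cases hd : dom s
      · simp only [hg, hd, false_or, Bool.false_eq_true, if_false, Rat.cast_zero] at h ⊢
        linarith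
      · simp only [hg, hd, or_true, if_true, if_false] at h ⊢
        linarith
  refine ⟨fun s => h0 _, fun s hs hg => ?_, fun s hs hg hd => ?_, fun s hs hg hd α hα => ?_⟩
  · obtain ⟨α, hα⟩ := M.act_nonempty s
    simpa [hg] using key s hs α hα
  · obtain ⟨α, hα⟩ := M.act_nonempty s
    simpa [hg, hd] using key s hs α hα
  · simpa [hg, hd] using key s hs α hα

/-- The linear program computes the least solution of the Bellman inequalities: solutions are closed
under minima, so that a solution with the least sum is the least solution. -/
theorem maxVal_spec (hf : ∀ s, f s ≤ 1) :
    IsBellman M Goal X dom (fun s => (f s : ℝ)) (fun s => ((maxVal M Goal X dom f).val s : ℝ)) ∧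
      ∀ x, IsBellman M Goal X dom (fun s => (f s : ℝ)) x →
        ∀ s, ((maxVal M Goal X dom f).val s : ℝ) ≤ x s := by
  let c : Fin n ⊕ Fin n × Fin m → ℝ := Sum.elim (fun _ => 1) fun _ => 0
  have hc : ∀ j, 0 ≤ c j := by rintro (j | j) <;> simp [c]
  have hcy : ∀ y : Fin n ⊕ Fin n × Fin m → ℝ, ∑ j, c j * y j = ∑ s, y (Sum.inl s) := by
    intro y
    simp [c, Fintype.sum_sum_type]
  have hex : ∀ x, IsBellman M Goal X dom (fun s => (f s : ℝ)) x →
      ∃ q ∈ (basicFeasible (valueConstraints M Goal X dom f).val).val,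
        ∑ s, (q (Sum.inl s) : ℝ) ≤ ∑ s, x s := by
    intro x hx
    obtain ⟨h0, hs⟩ := hx.solves
    obtain ⟨q, hq, hle⟩ := exists_mem_basicFeasible _ c hc _ h0 hs
    rw [hcy, hcy] at hle
    exact ⟨q, hq, hle⟩
  have hval : ∃ y ∈ (basicFeasible (valueConstraints M Goal X dom f).val).val,
      (maxVal M Goal X dom f).val = (fun s => y (Sum.inl s)) ∧
      ∀ z ∈ (basicFeasible (valueConstraints M Goal X dom f).val).val,
        ∑ s, y (Sum.inl s) ≤ ∑ s, z (Sum.inl s) := by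
    rcases argminObjective_spec
      (fun y : Fin n ⊕ Fin n × Fin m → ℚ => sumQ (fun s => Timed.op 1 (y (Sum.inl s)))
        (List.finRange n)) (basicFeasible (valueConstraints M Goal X dom f).val).val with
      ⟨hnil, -⟩ | ⟨y, hy, harg, hmin⟩
    · obtain ⟨q, hq, -⟩ := hex _ (isBellman_one M Goal X dom fun s => by exact_mod_cast hf s)
      rw [hnil] at hq
      simp at hq
    · refine ⟨y, hy, ?_, fun z hz => ?_⟩
      · simp only [maxVal, Timed.val_bind, harg]
        rfl
      · simpa [sum_map_finRange] using hmin z hz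
  obtain ⟨y, hy, hval, hmin⟩ := hval
  obtain ⟨h0, hs⟩ := mem_basicFeasible hy
  have hB := IsBellman.of_solves M Goal X dom f (fun j => by exact_mod_cast h0 j) hs
  rw [hval]
  refine ⟨hB, fun x hx s => ?_⟩
  obtain ⟨q, hq, hle⟩ := hex _ (hB.min hx)
  have h1 : ∑ s, (y (Sum.inl s) : ℝ) ≤ ∑ s, min (y (Sum.inl s) : ℝ) (x s) :=
    le_trans (by exact_mod_cast hmin q hq) hle
  by_contra hlt
  push Not at hlt
  exact absurd h1 (not_le.2 (Finset.sum_lt_sum (fun t _ => min_le_left _ _)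
    ⟨s, Finset.mem_univ s, by simpa using hlt⟩))

end ValueConstraints

variable (M : MDP (Fin n) (Fin m)) (Goal : Finset (Fin n))

/-- The Bellman inequalities of the subsystem induced by `T`. -/
abbrev IsBellmanOn (T : Finset (Fin n)) (x : Fin n → ℝ) : Prop :=
  IsBellman M Goal T (fun _ => false) (fun _ => 0) x

/-- The value of a state in the subsystem induced by `T`, as the least solution of the Bellman
inequalities; it is `0` outside of `T`. -/
noncomputable def setValue (T : Finset (Fin n)) (s : Fin n) : ℝ :=
  sInf ((fun x => x s) '' {x | IsBellmanOn M Goal T x})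

theorem setValue_le {T : Finset (Fin n)} {x : Fin n → ℝ} (hx : IsBellmanOn M Goal T x)
    (s : Fin n) : setValue M Goal T s ≤ x s :=
  csInf_le ⟨0, by rintro _ ⟨y, hy, rfl⟩; exact hy.nonneg s⟩ ⟨x, hx, rfl⟩

theorem le_setValue {T : Finset (Fin n)} {s : Fin n} {c : ℝ}
    (h : ∀ x, IsBellmanOn M Goal T x → c ≤ x s) : c ≤ setValue M Goal T s := by
  refine le_csInf ⟨_, _, isBellman_one M Goal T _ fun _ => zero_le_one, rfl⟩ ?_
  rintro _ ⟨x, hx, rfl⟩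
  exact h x hx

theorem isBellmanOn_setValue (T : Finset (Fin n)) :
    IsBellmanOn M Goal T (setValue M Goal T) where
  nonneg s := le_setValue M Goal fun x hx => hx.nonneg s
  goal s hs hg := le_setValue M Goal fun x hx => hx.goal s hs hg
  fixed s hs hg hd := by simp at hd
  step s hs hg hd α hα := le_setValue M Goal fun x hx =>
    (Finset.sum_le_sum fun t _ => mul_le_mul_of_nonneg_left (setValue_le M Goal hx t)
      (by exact_mod_cast M.P_nonneg s α t)).trans (hx.step s hs hg hd α hα)

theorem setValue_eq_zero {T : Finset (Fin n)} {s : Fin n} (hs : s ∉ T) :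
    setValue M Goal T s = 0 := by
  have h1 := isBellman_one M Goal T (fun _ => false) (f := fun _ => 0) fun _ => zero_le_one
  have h : IsBellmanOn M Goal T fun t => if t = s then 0 else 1 :=
    { nonneg := fun t => by split_ifs <;> norm_num
      goal := fun t ht hg => by rw [if_neg (by rintro rfl; exact hs ht)]
      fixed := fun t ht hg hd => by simp at hd
      step := fun t ht hg hd α hα => by
        rw [if_neg (by rintro rfl; exact hs ht)]
        refine le_trans (Finset.sum_le_sum fun u _ => ?_) (h1.step t ht hg hd α hα)
        have : (0 : ℝ) ≤ M.P t α u := by exact_mod_cast M.P_nonneg t α u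
        split_ifs <;> simp [this] }
  refine le_antisymm ?_ ((isBellmanOn_setValue M Goal T).nonneg s)
  simpa using setValue_le M Goal h s

theorem setValue_le_one (T : Finset (Fin n)) (s : Fin n) : setValue M Goal T s ≤ 1 :=
  setValue_le M Goal (isBellman_one M Goal T _ fun _ => zero_le_one) s

/-- Every subsystem on `T` is bounded by the value of the induced one. -/
theorem prMax_le_setValue {T : Finset (Fin n)} {M' : MDP {s // s ∈ T} (Fin m)}
    (h : IsSubsystem M M') :
    M'.prMax (Goal.subtype (· ∈ T)) ≤ ∑ s, (M.init s : ℝ) * setValue M Goal T s := by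
  have hV := isBellmanOn_setValue M Goal T
  have hx : M'.IsExcessive (Goal.subtype (· ∈ T)) fun s => setValue M Goal T s.1 :=
    { nonneg := fun s => hV.nonneg _
      goal := fun s hs => hV.goal s.1 s.2 (by simpa using hs)
      step := fun s hs α hα => by
        rw [h.1 s] at hα
        refine le_trans ?_ (hV.step s.1 s.2 (by simpa using hs) rfl α hα)
        rw [← Finset.sum_coe_sort T]
        refine Finset.sum_le_sum fun t _ => mul_le_mul_of_nonneg_right ?_ (hV.nonneg _)
        rcases h.2.1 s α hα t with h | h
        · rw [h]
        · rw [h]; exact_mod_cast M.P_nonneg _ _ _ }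
  refine hx.prMax_le.trans ?_
  refine le_trans (Finset.sum_le_sum (g := fun s => (M.init s.1 : ℝ) * setValue M Goal T s.1)
    fun s _ => mul_le_mul_of_nonneg_right ?_ (hV.nonneg _)) ?_
  · rcases h.2.2 s with h | h
    · rw [h]
    · rw [h]; exact_mod_cast M.init_nonneg _
  · rw [Finset.sum_coe_sort T fun s => (M.init s : ℝ) * setValue M Goal T s]
    exact Finset.sum_le_sum_of_subset_of_nonneg (Finset.subset_univ T) fun s _ _ =>
      mul_nonneg (by exact_mod_cast M.init_nonneg s) (hV.nonneg s)

/-- The converse bound: the maximal probability in the induced subsystem is at least the value. -/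
theorem setValue_le_prMax_induced (T : Finset (Fin n)) :
    ∑ s, (M.init s : ℝ) * setValue M Goal T s ≤
      (M.induced T).prMax (Goal.subtype (· ∈ T)) := by
  obtain ⟨x, hx, hle⟩ := exists_isExcessive_le_prMax (M.induced T) (Goal.subtype (· ∈ T))
  refine le_trans ?_ hle
  have hB : IsBellmanOn M Goal T fun s => if h : s ∈ T then x ⟨s, h⟩ else 0 :=
    { nonneg := fun s => by
        split_ifs
        · exact hx.nonneg _
        · exact le_rfl
      goal := fun s hs hg => by
        rw [dif_pos hs]
        exact hx.goal _ (by simpa using hg)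
      fixed := fun s hs hg hd => by simp at hd
      step := fun s hs hg hd α hα => by
        rw [dif_pos hs, ← Finset.sum_coe_sort T]
        refine le_trans (le_of_eq ?_) (hx.step ⟨s, hs⟩ (by simpa using hg) α hα)
        refine Finset.sum_congr rfl fun t _ => ?_
        rw [dif_pos t.2]
        rfl }
  have h0 : ∑ s, (M.init s : ℝ) * setValue M Goal T s =
      ∑ s ∈ T, (M.init s : ℝ) * setValue M Goal T s := by
    refine (Finset.sum_subset (Finset.subset_univ T) fun s _ hs => ?_).symm
    rw [setValue_eq_zero M Goal hs, mul_zero]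
  rw [h0, ← Finset.sum_coe_sort T]
  refine Finset.sum_le_sum fun s _ => ?_
  have := setValue_le M Goal hB s.1
  rw [dif_pos s.2] at this
  exact mul_le_mul_of_nonneg_left this (by exact_mod_cast M.init_nonneg _)

end Values

/-! ### Domination by convex combinations -/

section Domination

variable {E : Type} [AddCommGroup E] [PartialOrder E] [Module ℝ E]

/-- `v` lies below a convex combination of the points of `K`. -/
def Dominates (K : Set E) (v : E) : Prop := ∃ w ∈ convexHull ℝ K, v ≤ w

theorem dominates_of_mem {K : Set E} {v : E} (h : v ∈ K) : Dominates K v :=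
  ⟨v, subset_convexHull ℝ K h, le_rfl⟩

theorem Dominates.mono {K K' : Set E} (h : K ⊆ K') {v : E} (hv : Dominates K v) :
    Dominates K' v :=
  let ⟨w, hw, hle⟩ := hv
  ⟨w, convexHull_mono h hw, hle⟩

variable [IsOrderedAddMonoid E] [PosSMulMono ℝ E]

theorem convex_dominates (K : Set E) : Convex ℝ {v | Dominates K v} := by
  rintro v ⟨w, hw, hv⟩ v' ⟨w', hw', hv'⟩ a b ha hb hab
  exact ⟨a • w + b • w', convex_convexHull ℝ K hw hw' ha hb hab,
    add_le_add (smul_le_smul_of_nonneg_left hv ha) (smul_le_smul_of_nonneg_left hv' hb)⟩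

theorem Dominates.trans {K K' : Set E} (h : ∀ p ∈ K, Dominates K' p) {v : E}
    (hv : Dominates K v) : Dominates K' v := by
  obtain ⟨w, hw, hle⟩ := hv
  obtain ⟨u, hu, hwu⟩ := convexHull_min (t := {v | Dominates K' v}) h (convex_dominates K') hw
  exact ⟨u, hu, hle.trans hwu⟩

/-- The points that lie below a combination of `p` and of points of `S` with a weight of `p` less
than one, together with the points strictly below `p`, form a convex set. -/
theorem convex_below_or_lt (S : Set E) (p : E) :
    Convex ℝ {v | (∃ a : ℝ, 0 ≤ a ∧ a < 1 ∧ ∃ u ∈ convexHull ℝ S, v ≤ a • p + (1 - a) • u) ∨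
      (v ≤ p ∧ v ≠ p)} := by
  rw [convex_iff_forall_pos]
  -- A combination with a positive share of a point of the first kind is of the first kind.
  have key : ∀ v w : E, ∀ a b : ℝ, 0 < a → 0 ≤ b → a + b = 1 →
      (∃ c : ℝ, 0 ≤ c ∧ c < 1 ∧ ∃ u ∈ convexHull ℝ S, v ≤ c • p + (1 - c) • u) → w ≤ p →
      ∃ c : ℝ, 0 ≤ c ∧ c < 1 ∧ ∃ u ∈ convexHull ℝ S, a • v + b • w ≤ c • p + (1 - c) • u := by
    rintro v w a b ha hb hab ⟨c, hc, hc1, u, hu, hv⟩ hw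
    refine ⟨a * c + b, by positivity, by nlinarith, u, hu, ?_⟩
    refine (add_le_add (smul_le_smul_of_nonneg_left hv ha.le)
      (smul_le_smul_of_nonneg_left hw hb)).trans (le_of_eq ?_)
    have : 1 - (a * c + b) = a * (1 - c) := by linarith
    rw [this]
    module
  rintro v hv w hw a b ha hb hab
  rcases hv with hv | hv <;> rcases hw with hw | hw
  · obtain ⟨c, hc, hc1, u, hu, hv⟩ := hv
    obtain ⟨d, hd, hd1, u', hu', hw⟩ := hw
    left
    have hpos : 0 < a * (1 - c) + b * (1 - d) := by
      have := mul_pos ha (sub_pos.2 hc1)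
      have := mul_pos hb (sub_pos.2 hd1)
      linarith
    refine ⟨a * c + b * d, by positivity, by linarith,
      (a * (1 - c) / (a * (1 - c) + b * (1 - d))) • u +
        (b * (1 - d) / (a * (1 - c) + b * (1 - d))) • u',
      convex_convexHull ℝ S hu hu' ?_ ?_ ?_, ?_⟩
    · exact div_nonneg (mul_nonneg ha.le (by linarith)) hpos.le
    · exact div_nonneg (mul_nonneg hb.le (by linarith)) hpos.le
    · rw [← add_div, div_self hpos.ne']
    · refine (add_le_add (smul_le_smul_of_nonneg_left hv ha.le)
        (smul_le_smul_of_nonneg_left hw hb.le)).trans (le_of_eq ?_)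
      have h1 : 1 - (a * c + b * d) = a * (1 - c) + b * (1 - d) := by linarith
      rw [h1, smul_add (a * (1 - c) + b * (1 - d)), smul_smul (a * (1 - c) + b * (1 - d)),
        smul_smul (a * (1 - c) + b * (1 - d)), mul_div_cancel₀ _ hpos.ne',
        mul_div_cancel₀ _ hpos.ne']
      module
  · exact Or.inl (key v w a b ha hb.le hab hv hw.1)
  · left
    rw [add_comm]
    exact key w v b a hb ha.le (by linarith) hw hv.1
  · right
    have h1 : a • p + b • p = p := by rw [← add_smul, hab, one_smul]
    have hle : a • v + b • w ≤ p := by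
      rw [← h1]
      exact add_le_add (smul_le_smul_of_nonneg_left hv.1 ha.le)
        (smul_le_smul_of_nonneg_left hw.1 hb.le)
    refine ⟨hle, fun heq => hv.2 (le_antisymm hv.1 ?_)⟩
    have h2 : a • v + b • w ≤ a • v + b • p :=
      add_le_add_right (smul_le_smul_of_nonneg_left hw.1 hb.le) _
    have h3 : a • p ≤ a • v :=
      (add_le_add_iff_right (b • p)).1 (h1.le.trans (heq.ge.trans h2))
    have h4 := smul_le_smul_of_nonneg_left h3 (inv_nonneg.2 ha.le)
    rwa [smul_smul, smul_smul, inv_mul_cancel₀ ha.ne', one_smul, one_smul] at h4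

/-- A finite set of points is dominated by those of its members that are vertices of its convex hull
and maximal in it: a minimal dominating subset consists of such points. -/
theorem exists_dominating_vertices {K : Set E} (hK : K.Finite) :
    ∃ S ⊆ K, (∀ p ∈ K, Dominates S p) ∧ ∀ p ∈ S,
      p ∉ convexHull ℝ (K \ {p}) ∧ ∀ h ∈ K, p ≤ h → h = p := by
  have hfin : {S | S ⊆ K ∧ ∀ p ∈ K, Dominates S p}.Finite :=
    hK.finite_subsets.subset fun S hS => hS.1
  obtain ⟨S, ⟨hSK, hS⟩, hmin⟩ := hfin.exists_minimal
    ⟨K, subset_rfl, fun p hp => dominates_of_mem hp⟩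
  refine ⟨S, hSK, hS, fun p hp => ?_⟩
  have hnot : ¬ Dominates (S \ {p}) p := by
    intro hd
    have : S ⊆ S \ {p} := hmin ⟨Set.sdiff_subset.trans hSK, fun q hq => (hS q hq).trans
      fun r hr => by
        by_cases hrp : r = p
        · rw [hrp]; exact hd
        · exact dominates_of_mem ⟨hr, hrp⟩⟩ Set.sdiff_subset
    exact (this hp).2 rfl
  set C := {v | (∃ a : ℝ, 0 ≤ a ∧ a < 1 ∧ ∃ u ∈ convexHull ℝ (S \ {p}), v ≤ a • p + (1 - a) • u) ∨
      (v ≤ p ∧ v ≠ p)} with hC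
  have hself : ∀ v, (∃ a : ℝ, 0 ≤ a ∧ a < 1 ∧ ∃ u ∈ convexHull ℝ (S \ {p}),
      v ≤ a • p + (1 - a) • u) → ¬ p ≤ v := by
    rintro v ⟨a, ha, ha1, u, hu, hv⟩ hpv
    refine hnot ⟨u, hu, ?_⟩
    have h1 : (1 - a) • p ≤ (1 - a) • u := by
      have := hpv.trans hv
      have h2 : p = a • p + (1 - a) • p := by rw [← add_smul]; simp
      nth_rewrite 1 [h2] at this
      exact (add_le_add_iff_left (a • p)).1 this
    have h0 : 0 < 1 - a := by linarith
    have h4 := smul_le_smul_of_nonneg_left h1 (inv_nonneg.2 h0.le)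
    rwa [smul_smul, smul_smul, inv_mul_cancel₀ h0.ne', one_smul, one_smul] at h4
  have hKC : ∀ h ∈ K, h ≠ p → h ∈ C := by
    intro h hh hne
    obtain ⟨w, hw, hle⟩ := hS h hh
    rw [← Set.insert_sdiff_self_of_mem hp] at hw
    rcases (S \ {p}).eq_empty_or_nonempty with he | hne'
    · rw [he] at hw
      simp only [insert_empty_eq, convexHull_singleton, Set.mem_singleton_iff] at hw
      exact Or.inr ⟨hw ▸ hle, hne⟩
    · rw [convexHull_insert hne', mem_convexJoin] at hw
      obtain ⟨q, hq, u, hu, hw⟩ := hw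
      rw [Set.mem_singleton_iff] at hq
      subst hq
      obtain ⟨a, b, ha, hb, hab, rfl⟩ := hw
      obtain rfl : b = 1 - a := by linarith
      rcases (show a ≤ 1 by linarith).lt_or_eq with h1 | h1
      · exact Or.inl ⟨a, ha, h1, u, hu, hle⟩
      · refine Or.inr ⟨?_, hne⟩
        simpa [h1] using hle
  refine ⟨fun hmem => ?_, fun h hh hle => ?_⟩
  · rcases convexHull_min (fun h hh => hKC h hh.1 hh.2) (convex_below_or_lt (S \ {p}) p) hmem with
      h | h
    · exact hself p h le_rfl
    · exact h.2 rfl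
  · by_contra hne
    rcases hKC h hh hne with h' | h'
    · exact hself h h' hle
    · exact h'.2 (le_antisymm h'.1 hle)

end Domination

/-! ### The vertices of a convex hull and the removal of dominated subsystems -/

section RemoveDominated

variable {n : ℕ}

/-- A rational vector as a real vector. -/
def realVec (v : Fin n → ℚ) : Fin n → ℝ := fun q => v q

theorem realVec_injective : Function.Injective (realVec (n := n)) := fun v w h => by
  funext q
  have := congrFun h q
  simpa [realVec] using this

theorem mem_subsetsOf (l : List (Fin n)) (X : Finset (Fin n)) :
    X ∈ (subsetsOf l).val ↔ ∀ s ∈ X, s ∈ l := by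
  induction l generalizing X with
  | nil => simp [subsetsOf, Finset.eq_empty_iff_forall_notMem]
  | cons a l ih =>
    simp only [subsetsOf, Timed.val_bind, Timed.val_append, Timed.val_mapL, Timed.val_op,
      List.mem_append, List.mem_map, ih]
    constructor
    · rintro (h | ⟨Y, hY, rfl⟩)
      · exact fun s hs => List.mem_cons_of_mem _ (h s hs)
      · intro s hs
        rcases Finset.mem_insert.1 hs with rfl | hs
        · simp
        · exact List.mem_cons_of_mem _ (hY s hs)
    · intro h
      by_cases ha : a ∈ X
      · refine Or.inr ⟨X.erase a, fun s hs => ?_, Finset.insert_erase ha⟩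
        rw [Finset.mem_erase] at hs
        exact (List.mem_cons.1 (h s hs.2)).resolve_left hs.1
      · exact Or.inl fun s hs => (List.mem_cons.1 (h s hs)).resolve_left
          (by rintro rfl; exact ha hs)

theorem mem_projections (I : List (Fin n)) (θ v : Fin n → ℚ) :
    v ∈ (projections I θ).val ↔
      ∃ D : Finset (Fin n), (∀ s ∈ D, s ∈ I) ∧ v = fun q => if q ∈ D then θ q else 0 := by
  simp only [projections, Timed.val_bind, Timed.val_mapL, Timed.val_tabulate, Timed.val_op,
    List.mem_map, mem_subsetsOf]
  exact exists_congr fun D => and_congr_right fun _ => eq_comm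

theorem vecEq_iff (v w : Fin n → ℚ) : (vecEq v w).val = true ↔ v = w := by
  simp [vecEq, funext_iff]

theorem inConvexHull_iff (pts : List (Fin n → ℚ)) (p : Fin n → ℚ) :
    (inConvexHull pts p).val = true ↔
      realVec p ∈ convexHull ℝ (realVec '' {q | q ∈ pts}) := by
  set T : Option (Fin n) → Option (Fin pts.length) → ℚ := fun r c =>
    match r, c with
    | none, _ => 1
    | some q, none => p q
    | some q, some j => pts.get j q with hT
  have hsolves : ∀ y : Fin pts.length → ℝ, Solves T y ↔
      ∑ j, y j = 1 ∧ ∑ j, y j • realVec (pts.get j) = realVec p := by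
    intro y
    constructor
    · intro h
      refine ⟨by simpa [hT] using h none, ?_⟩
      funext q
      have := h (some q)
      simpa [hT, realVec, Finset.sum_apply, mul_comm] using this
    · rintro ⟨h1, h2⟩ (_ | q)
      · simpa [hT] using h1
      · have := congrFun h2 q
        simpa [hT, realVec, Finset.sum_apply, mul_comm] using this
  have hval : (inConvexHull pts p).val = true ↔ (basicFeasible T).val ≠ [] := by
    have hT' : (Timed.tabulate (fun (r : Option (Fin n)) => Timed.tabulate
        (fun (c : Option (Fin pts.length)) =>
      match r, c with
      | none, _ => Timed.op 1 (1 : ℚ)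
      | some q, none => Timed.op 1 (p q)
      | some q, some j => Timed.op 1 (pts.get j q)))).val = T := by
      funext r c
      rcases r with _ | q
      · rfl
      · rcases c with _ | j <;> rfl
    have h : (inConvexHull pts p).val = !(basicFeasible T).val.isEmpty :=
      congrArg (fun T' => !(basicFeasible T').val.isEmpty) hT'
    simp [h]
  rw [hval]
  constructor
  · intro h
    obtain ⟨y, hy⟩ := List.exists_mem_of_ne_nil _ h
    obtain ⟨h0, hs⟩ := mem_basicFeasible hy
    obtain ⟨h1, h2⟩ := (hsolves _).1 hs
    exact mem_convexHull_of_exists_fintype _ (fun j => realVec (pts.get j))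
      (fun j => by exact_mod_cast h0 j) h1 (fun j => ⟨_, List.get_mem pts j, rfl⟩) h2
  · intro h
    have hsub : convexHull ℝ (realVec '' {q | q ∈ pts}) ⊆ {x | ∃ y : Fin pts.length → ℝ,
        (∀ j, 0 ≤ y j) ∧ ∑ j, y j = 1 ∧ ∑ j, y j • realVec (pts.get j) = x} := by
      refine convexHull_min ?_ ?_
      · rintro _ ⟨q, hq, rfl⟩
        obtain ⟨j, rfl⟩ := List.get_of_mem hq
        refine ⟨Pi.single j 1, fun i => ?_, by simp, ?_⟩
        · rcases eq_or_ne i j with rfl | hij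
          · simp
          · simp [hij]
        · rw [Finset.sum_eq_single j (fun i _ hij => by simp [hij]) (by simp)]
          simp
      · rintro x ⟨y, hy, hy1, rfl⟩ x' ⟨y', hy', hy1', rfl⟩ a b ha hb hab
        refine ⟨fun j => a * y j + b * y' j, fun j => ?_, ?_, ?_⟩
        · exact add_nonneg (mul_nonneg ha (hy j)) (mul_nonneg hb (hy' j))
        · rw [Finset.sum_add_distrib, ← Finset.mul_sum, ← Finset.mul_sum, hy1, hy1', mul_one,
            mul_one, hab]
        · simp only [add_smul, Finset.sum_add_distrib, Finset.smul_sum, smul_smul]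
    obtain ⟨y, hy0, hy1, hy2⟩ := hsub h
    obtain ⟨q, hq, -⟩ := exists_mem_basicFeasible T (fun _ => 0) (fun _ => le_rfl) y hy0
      ((hsolves y).2 ⟨hy1, hy2⟩)
    exact List.ne_nil_of_mem hq

theorem mem_hullVertices (pts : List (Fin n → ℚ)) (p : Fin n → ℚ) :
    p ∈ (hullVertices pts).val ↔
      p ∈ pts ∧ realVec p ∉ convexHull ℝ (realVec '' {q | q ∈ pts} \ {realVec p}) := by
  simp only [hullVertices, Timed.val_filterL, Timed.val_bind, Timed.val_op, List.mem_filter]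
  refine and_congr_right fun _ => ?_
  rw [Bool.not_eq_true', ← Bool.not_eq_true, inConvexHull_iff]
  have : realVec '' {q | q ∈ pts.filter fun a => !(vecEq a p).val} =
      realVec '' {q | q ∈ pts} \ {realVec p} := by
    ext x
    simp only [List.mem_filter, Bool.not_eq_true', ← Bool.not_eq_true, vecEq_iff, Set.mem_image,
      Set.mem_sdiff, Set.mem_singleton_iff, Set.mem_ofPred_eq]
    constructor
    · rintro ⟨q, ⟨h1, h2⟩, rfl⟩
      exact ⟨⟨q, h1, rfl⟩, fun h => h2 (realVec_injective h)⟩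
    · rintro ⟨⟨q, h1, rfl⟩, h2⟩
      exact ⟨q, ⟨h1, fun h => h2 (by rw [h])⟩, rfl⟩
  rw [this]

/-- The projections of the value vectors of the members of `L` whose size satisfies `p`. -/
def projectionSet (I : List (Fin n)) (L : List (PartialSubsystem n)) (p : ℕ → Prop) :
    Set (Fin n → ℚ) :=
  {v | ∃ U ∈ L, p U.states.card ∧ v ∈ (projections I U.val).val}

/-- One round of `removeDominated`, for the size `j`. -/
def removeDominatedStep (I : List (Fin n)) (L : List (PartialSubsystem n))
    (HR : List (Fin n → ℚ) × List (PartialSubsystem n)) (j : ℕ) :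
    List (Fin n → ℚ) × List (PartialSubsystem n) :=
  let Lj := L.filter fun U => decide (U.states.card = j)
  let H := HR.1 ++ Lj.flatMap fun U => (projections I U.val).val
  (H, HR.2 ++ Lj.filter fun U => (hullVertices H).val.any fun v => (vecEq v U.val).val)

theorem val_removeDominated (I : List (Fin n)) (L : List (PartialSubsystem n)) :
    (removeDominated I L).val =
      ((List.range (L.foldl (fun c U => max c U.states.card) 0 + 1)).foldl
        (removeDominatedStep I L) ([], [])).2 := by
  simp only [removeDominated, Timed.val_bind, Timed.val_foldL, Timed.val_filterL,
    Timed.val_flatMapL, Timed.val_append, Timed.val_anyL, Timed.val_op]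
  rfl

theorem foldl_removeDominatedStep (I : List (Fin n)) (L : List (PartialSubsystem n)) (r : ℕ) :
    (∀ v, v ∈ ((List.range r).foldl (removeDominatedStep I L) ([], [])).1 ↔
      v ∈ projectionSet I L (· < r)) ∧
    (∀ U, U ∈ ((List.range r).foldl (removeDominatedStep I L) ([], [])).2 ↔
      U ∈ L ∧ U.states.card < r ∧ U.val ∈ projectionSet I L (· ≤ U.states.card) ∧
        realVec U.val ∉ convexHull ℝ
          (realVec '' projectionSet I L (· ≤ U.states.card) \ {realVec U.val})) := by
  induction r with
  | zero => simp [projectionSet]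
  | succ r ih =>
    rw [List.range_succ, List.foldl_append, List.foldl_cons, List.foldl_nil]
    generalize (List.range r).foldl (removeDominatedStep I L) ([], []) = HR at ih
    have h1 : ∀ v, v ∈ (removeDominatedStep I L HR r).1 ↔ v ∈ projectionSet I L (· < r + 1) := by
      intro v
      simp only [removeDominatedStep, List.mem_append, ih.1, List.mem_flatMap, List.mem_filter,
        decide_eq_true_eq, projectionSet, Set.mem_ofPred_eq]
      constructor
      · rintro (⟨U, hU, hc, hv⟩ | ⟨U, ⟨hU, hc⟩, hv⟩)
        · exact ⟨U, hU, by omega, hv⟩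
        · exact ⟨U, hU, by omega, hv⟩
      · rintro ⟨U, hU, hc, hv⟩
        rcases Nat.lt_succ_iff_lt_or_eq.1 hc with hc | hc
        · exact Or.inl ⟨U, hU, hc, hv⟩
        · exact Or.inr ⟨U, ⟨hU, hc⟩, hv⟩
    refine ⟨h1, fun U => ?_⟩
    have hset : {q | q ∈ (removeDominatedStep I L HR r).1} = projectionSet I L (· ≤ r) := by
      ext v
      rw [Set.mem_ofPred_eq, h1]
      simp only [Nat.lt_succ_iff]
    have h2 : U ∈ (removeDominatedStep I L HR r).2 ↔ U ∈ HR.2 ∨ (U ∈ L ∧ U.states.card = r) ∧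
        ∃ v ∈ (hullVertices (removeDominatedStep I L HR r).1).val, v = U.val := by
      simp only [removeDominatedStep, List.mem_append, List.mem_filter, decide_eq_true_eq,
        List.any_eq_true, vecEq_iff]
    rw [h2, ih.2]
    simp only [exists_eq_right, mem_hullVertices, hset]
    constructor
    · rintro (⟨hU, hc, h⟩ | ⟨⟨hU, rfl⟩, h, h'⟩)
      · exact ⟨hU, by omega, h⟩
      · refine ⟨hU, by omega, ?_, h'⟩
        rw [← hset]; exact h
    · rintro ⟨hU, hc, h, h'⟩
      rcases Nat.lt_succ_iff_lt_or_eq.1 hc with hc | hc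
      · exact Or.inl ⟨hU, hc, h, h'⟩
      · subst hc
        refine Or.inr ⟨⟨hU, rfl⟩, ?_, h'⟩
        rw [← hset] at h; exact h

theorem le_foldl_max (L : List (PartialSubsystem n)) (c : ℕ) :
    c ≤ L.foldl (fun c U => max c U.states.card) c ∧
      ∀ U ∈ L, U.states.card ≤ L.foldl (fun c U => max c U.states.card) c := by
  induction L generalizing c with
  | nil => simp
  | cons V L ih =>
    obtain ⟨h1, h2⟩ := ih (max c V.states.card)
    refine ⟨(le_max_left _ _).trans h1, fun U hU => ?_⟩
    rcases List.mem_cons.1 hU with rfl | hU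
    · exact (le_max_right _ _).trans h1
    · exact h2 U hU

theorem mem_removeDominated (I : List (Fin n)) (L : List (PartialSubsystem n))
    (U : PartialSubsystem n) :
    U ∈ (removeDominated I L).val ↔
      U ∈ L ∧ U.val ∈ projectionSet I L (· ≤ U.states.card) ∧
        realVec U.val ∉ convexHull ℝ
          (realVec '' projectionSet I L (· ≤ U.states.card) \ {realVec U.val}) := by
  rw [val_removeDominated, (foldl_removeDominatedStep I L _).2]
  constructor
  · rintro ⟨h1, -, h2⟩
    exact ⟨h1, h2⟩
  · rintro ⟨h1, h2⟩
    exact ⟨h1, Nat.lt_succ_of_le ((le_foldl_max L 0).2 U h1), h2⟩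

/-- The value vectors of the members of `L` with at most `j` states. -/
def levelPoints (L : List (PartialSubsystem n)) (j : ℕ) : Set (Fin n → ℝ) :=
  {v | ∃ U ∈ L, U.states.card ≤ j ∧ v = realVec U.val}

theorem levelPoints_mono {L L' : List (PartialSubsystem n)} (h : ∀ U ∈ L, U ∈ L') {j j' : ℕ}
    (hj : j ≤ j') : levelPoints L j ⊆ levelPoints L' j' := by
  rintro _ ⟨U, hU, hc, rfl⟩
  exact ⟨U, h U hU, hc.trans hj, rfl⟩

/-- Every partial subsystem is dominated by those of at most its size that `removeDominated` keeps:
a maximal vertex of the hull of the projections is no proper projection, and a vertex of the hull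
for the size `j` is a vertex of the hulls for the smaller sizes. -/
theorem removeDominated_dominates {I : List (Fin n)} {L : List (PartialSubsystem n)}
    (h0 : ∀ U ∈ L, ∀ q, 0 ≤ U.val q) (hI : ∀ U ∈ L, ∀ q, q ∉ I → U.val q = 0) (j : ℕ)
    {v : Fin n → ℝ} (hv : Dominates (levelPoints L j) v) :
    Dominates (levelPoints (removeDominated I L).val j) v := by
  refine hv.trans ?_
  set K := realVec '' projectionSet I L (· ≤ j) with hK
  have hfull : ∀ U ∈ L, ∀ i, U.states.card ≤ i → U.val ∈ projectionSet I L (· ≤ i) := by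
    intro U hU i hi
    refine ⟨U, hU, hi, (mem_projections _ _ _).2 ⟨I.toFinset, by simp, ?_⟩⟩
    funext q
    split_ifs with hq
    · rfl
    · exact hI U hU q (by simpa using hq)
  have hfin : K.Finite := by
    refine Set.Finite.image _ (Set.Finite.subset
      (L.flatMap fun U => (projections I U.val).val).finite_toSet ?_)
    rintro v ⟨U, hU, -, hv⟩
    exact List.mem_flatMap.2 ⟨U, hU, hv⟩
  obtain ⟨S, hSK, hS, hvert⟩ := exists_dominating_vertices hfin
  rintro _ ⟨U, hU, hc, rfl⟩
  refine (hS _ ⟨_, hfull U hU j hc, rfl⟩).mono fun p hp => ?_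
  obtain ⟨hp1, hp2⟩ := hvert p hp
  obtain ⟨w, ⟨U', hU', hc', hw⟩, rfl⟩ := hSK hp
  have heq : realVec U'.val = realVec w := by
    refine hp2 _ ⟨_, hfull U' hU' j hc', rfl⟩ fun q => ?_
    obtain ⟨D, -, rfl⟩ := (mem_projections _ _ _).1 hw
    simp only [realVec]
    split_ifs
    · exact le_rfl
    · exact_mod_cast h0 U' hU' q
  refine ⟨U', (mem_removeDominated I L U').2 ⟨hU', hfull U' hU' _ le_rfl, ?_⟩, hc', heq.symm⟩
  rw [heq]
  refine fun hmem => hp1 (convexHull_mono (Set.sdiff_subset_sdiff_left (Set.image_mono ?_)) hmem)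
  rintro v ⟨V, hV, hcV, hv⟩
  exact ⟨V, hV, hcV.trans hc', hv⟩

end RemoveDominated

/-! ### Directed trees -/

section Trees

open Relation

variable {B : Type} {E : B → B → Prop}

/-- A tree has fewer edges than vertices, so that some vertex has no incoming edge. -/
theorem IsDirectedTree.exists_root [Finite B] (h : IsDirectedTree E) : ∃ r, ∀ b, ¬ E b r := by
  classical
  have := Fintype.ofFinite B
  by_contra hno
  push Not at hno
  choose p hp using hno
  have hcard := h.1.card_edgeFinset
  have hinj : Fintype.card B ≤ (SimpleGraph.fromRel E).edgeFinset.card := by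
    rw [← Finset.card_univ]
    refine Finset.card_le_card_of_injOn (fun b => s(p b, b)) (fun b _ => ?_) ?_
    · simp only [SimpleGraph.coe_edgeFinset, SimpleGraph.mem_edgeSet, SimpleGraph.fromRel_adj]
      refine ⟨fun heq => ?_, Or.inl (hp b)⟩
      have := hp b
      rw [heq] at this
      exact h.2.1 b b this this
    · intro b _ c _ heq
      simp only [Sym2.eq_iff] at heq
      rcases heq with ⟨-, h1⟩ | ⟨h1, h2⟩
      · exact h1
      · have hb := hp b
        have hc := hp c
        rw [h1] at hb
        rw [← h2] at hc
        exact absurd hc (h.2.1 c b hb)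
  omega

theorem IsDirectedTree.reflTransGen_root (h : IsDirectedTree E) {r : B} (hr : ∀ b, ¬ E b r)
    (b : B) : ReflTransGen E r b := by
  have hconn := h.1.1.preconnected r b
  rw [SimpleGraph.reachable_iff_reflTransGen] at hconn
  induction hconn with
  | refl => exact .refl
  | tail _ hadj ih =>
    rcases (SimpleGraph.fromRel_adj _ _ _).1 hadj with ⟨-, he | he⟩
    · exact ih.tail he
    · -- The unique predecessor of a proper descendant of the root is a descendant.
      rcases ReflTransGen.cases_tail ih with heq | ⟨d, hd, hdu⟩
      · exact absurd he (heq ▸ hr _)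
      · rw [h.2.2 _ _ _ he hdu]
        exact hd

theorem IsDirectedTree.not_transGen_self [Finite B] (h : IsDirectedTree E) (b : B) :
    ¬ TransGen E b b := by
  obtain ⟨r, hr⟩ := h.exists_root
  induction h.reflTransGen_root hr b with
  | refl =>
    intro ht
    obtain ⟨c, -, hc⟩ := TransGen.tail'_iff.1 ht
    exact hr c hc
  | tail _ he ih =>
    intro ht
    obtain ⟨d, hd, hde⟩ := TransGen.tail'_iff.1 ht
    rw [h.2.2 _ _ _ hde he] at hd
    exact ih (TransGen.head' he hd)

theorem IsDirectedTree.eq_root [Finite B] (h : IsDirectedTree E) {r r' : B} (hr : ∀ b, ¬ E b r)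
    (hr' : ∀ b, ¬ E b r') : r' = r := by
  rcases ReflTransGen.cases_tail (h.reflTransGen_root hr r') with heq | ⟨d, -, hd⟩
  · exact heq
  · exact absurd hd (hr' d)

theorem IsDirectedTree.eq_of_common_descendant [Finite B] (h : IsDirectedTree E) {b c c' d : B}
    (hc : E b c) (hc' : E b c') (hd : ReflTransGen E c d) (hd' : ReflTransGen E c' d) :
    c = c' := by
  have key : ∀ c c', E b c → E b c' → ReflTransGen E c c' → c = c' := by
    intro c c' hc hc' hcc
    rcases ReflTransGen.cases_tail hcc with heq | ⟨e, he, hec⟩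
    · exact heq.symm
    · rw [h.2.2 _ _ _ hec hc'] at he
      exact absurd (TransGen.head' hc he) (h.not_transGen_self b)
  have huniq : Relator.RightUnique (Function.swap E) := fun x y z hy hz => h.2.2 y z x hy hz
  rcases ReflTransGen.total_of_right_unique huniq hd.swap hd'.swap with ht | ht
  · exact (key c' c hc' hc (reflTransGen_swap.1 ht)).symm
  · exact key c c' hc hc' (reflTransGen_swap.1 ht)

end Trees

/-! ### The precomputed graph data -/

section Graph

variable {n m k : ℕ}

/-- The graph data describe the tree partition. -/
structure GraphData.Correct (M : MDP (Fin n) (Fin m)) (blk : Fin n → Fin k) (g : GraphData n k) :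
    Prop where
  edge : ∀ s t, g.edge s t = true ↔ M.Edge s t
  child : ∀ b c, g.child b c = true ↔ QuotientEdge M.Edge blk b c
  inc : ∀ t, g.inc t = true ↔
    0 < M.init t ∨ ∃ s, QuotientEdge M.Edge blk (blk s) (blk t) ∧ M.Edge s t
  exit : ∀ s, g.exit s = true ↔ ∃ t, blk t ≠ blk s ∧ M.Edge s t

theorem graphData_correct (M : MDP (Fin n) (Fin m)) (blk : Fin n → Fin k) :
    (graphData M blk).val.Correct M blk := by
  have hedge : ∀ s t, (graphData M blk).val.edge s t = true ↔ M.Edge s t := by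
    intro s t
    have : (graphData M blk).val.edge s t = (List.finRange m).any fun α =>
        (if α ∈ M.act s then do
          let z ← leQ (M.P s α t) 0
          Timed.op 1 (!z)
        else Timed.op 1 false : Timed Bool).val := by
      simp only [graphData, Timed.val_bind, Timed.val_tabulate, Timed.val_anyL, Timed.val_op]
    rw [this]
    simp only [List.any_eq_true, List.mem_finRange, true_and, MDP.Edge]
    refine exists_congr fun α => ?_
    split_ifs with h
    · simp [h]
    · simp [h]
  have hchild : ∀ b c, (graphData M blk).val.child b c = true ↔
      QuotientEdge M.Edge blk b c := by
    intro b c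
    have : (graphData M blk).val.child b c = (List.finRange n).any fun s =>
        (List.finRange n).any fun t => decide (b ≠ c ∧ blk s = b ∧ blk t = c) &&
          (graphData M blk).val.edge s t := by
      simp only [graphData, Timed.val_bind, Timed.val_tabulate, Timed.val_anyL, Timed.val_op]
    rw [this]
    simp only [List.any_eq_true, List.mem_finRange, true_and, Bool.and_eq_true, decide_eq_true_eq,
      hedge, QuotientEdge]
    constructor
    · rintro ⟨s, t, ⟨h1, h2, h3⟩, h4⟩
      exact ⟨h1, s, t, h2, h3, h4⟩
    · rintro ⟨h1, s, t, h2, h3, h4⟩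
      exact ⟨s, t, ⟨h1, h2, h3⟩, h4⟩
  refine ⟨hedge, hchild, fun t => ?_, fun s => ?_⟩
  · have : (graphData M blk).val.inc t = (!decide (M.init t ≤ 0) || (List.finRange n).any fun s =>
        (graphData M blk).val.child (blk s) (blk t) && (graphData M blk).val.edge s t) := by
      simp only [graphData, Timed.val_bind, Timed.val_tabulate, Timed.val_anyL, Timed.val_op,
        val_leQ]
    rw [this]
    simp [hchild, hedge]
  · have : (graphData M blk).val.exit s = (List.finRange n).any fun t =>
        decide (blk t ≠ blk s) && (graphData M blk).val.edge s t := by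
      simp only [graphData, Timed.val_bind, Timed.val_tabulate, Timed.val_anyL, Timed.val_op]
    rw [this]
    simp [hedge]

/-- Every block of the list comes after its children, and once only. -/
def ChildrenFirst (child : Fin k → Fin k → Bool) (l : List (Fin k)) : Prop :=
  ∀ l₁ b l₂, l = l₁ ++ b :: l₂ → b ∉ l₁ ∧ ∀ c, child b c = true → c ∈ l₁

theorem ChildrenFirst.append_singleton {child : Fin k → Fin k → Bool} {l : List (Fin k)}
    {b : Fin k} : ChildrenFirst child (l ++ [b]) ↔
      ChildrenFirst child l ∧ b ∉ l ∧ ∀ c, child b c = true → c ∈ l := by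
  constructor
  · intro h
    refine ⟨fun l₁ b' l₂ hl => h l₁ b' (l₂ ++ [b]) (by simp [hl]), h l b [] rfl⟩
  · rintro ⟨h1, h2⟩ l₁ b' l₂ hl
    rcases List.eq_nil_or_concat l₂ with rfl | ⟨l₃, b'', rfl⟩
    · obtain ⟨rfl, hb⟩ := List.append_inj' hl (by simp)
      obtain rfl : b = b' := by simpa using hb
      exact h2
    · have hl' : l ++ [b] = (l₁ ++ b' :: l₃) ++ [b''] := by simp [hl]
      obtain ⟨rfl, -⟩ := List.append_inj' hl' (by simp)
      exact h1 l₁ b' l₃ rfl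

theorem ChildrenFirst.nodup {child : Fin k → Fin k → Bool} {l : List (Fin k)}
    (h : ChildrenFirst child l) : l.Nodup := by
  induction l using List.reverseRecOn with
  | nil => simp
  | append_singleton l b ih =>
    obtain ⟨h1, h2, -⟩ := ChildrenFirst.append_singleton.1 h
    rw [List.nodup_append]
    exact ⟨ih h1, by simp, fun x hx y hy heq => h2 (by simp_all)⟩

theorem reverseTopological_spec {child : Fin k → Fin k → Bool}
    (hacyc : ∀ b, ¬ Relation.TransGen (fun b c => child b c = true) b b) (fuel : ℕ)
    (acc : List (Fin k)) (hacc : ChildrenFirst child acc) (hfuel : k ≤ fuel + acc.length) :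
    ChildrenFirst child (reverseTopological child fuel acc).val ∧
      ∀ b, b ∈ (reverseTopological child fuel acc).val := by
  have hfull : ∀ l : List (Fin k), l.Nodup → k ≤ l.length → ∀ b, b ∈ l := by
    intro l hl hk b
    have : l.toFinset = Finset.univ := by
      apply Finset.eq_univ_of_card
      rw [List.toFinset_card_of_nodup hl, Fintype.card_fin]
      refine le_antisymm ?_ hk
      simpa using hl.length_le_card
    have hb := Finset.mem_univ b
    rw [← this] at hb
    simpa using hb
  induction fuel generalizing acc with
  | zero => exact ⟨hacc, hfull acc hacc.nodup (by simpa using hfuel)⟩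
  | succ fuel ih =>
    obtain ⟨ready, hready⟩ : ∃ l, l = (List.finRange k).filter fun b => !decide (b ∈ acc) &&
      (List.finRange k).all fun c => !child b c || decide (c ∈ acc) := ⟨_, rfl⟩
    have hnil : ready = [] → (reverseTopological child (fuel + 1) acc).val = acc := by
      intro h
      simp only [reverseTopological, Timed.val_bind, Timed.val_filterL, Timed.val_op,
        Timed.val_allL]
      rw [← hready, h]
      rfl
    have hcons : ∀ b l, ready = b :: l → (reverseTopological child (fuel + 1) acc).val =
        (reverseTopological child fuel (acc ++ [b])).val := by
      intro b l h
      simp only [reverseTopological, Timed.val_bind, Timed.val_filterL, Timed.val_op,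
        Timed.val_allL]
      rw [← hready, h]
      rfl
    have hmem : ∀ b, b ∈ ready ↔ b ∉ acc ∧ ∀ c, child b c = true → c ∈ acc := by
      intro b
      simp only [hready, List.mem_filter, List.mem_finRange, true_and, Bool.and_eq_true,
        Bool.not_eq_true', decide_eq_false_iff_not, List.all_eq_true, Bool.or_eq_true,
        decide_eq_true_eq, forall_const]
      refine and_congr_right fun _ => forall_congr' fun c => ?_
      cases child b c <;> simp
    rcases hr : ready with _ | ⟨b, l⟩
    · rw [hnil hr]
      refine ⟨hacc, fun b => ?_⟩
      by_contra hb
      have : IsTrans (Fin k) fun c b => Relation.TransGen (fun b c => child b c = true) b c :=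
        ⟨fun _ _ _ h1 h2 => h2.trans h1⟩
      have : Std.Irrefl fun c b => Relation.TransGen (fun b c => child b c = true) b c :=
        ⟨fun b => hacyc b⟩
      have hwf := Finite.wellFounded_of_trans_of_irrefl
        fun c b => Relation.TransGen (fun b c => child b c = true) b c
      obtain ⟨b0, hb0, hmin⟩ := hwf.has_min {b | b ∉ acc} ⟨b, hb⟩
      have : b0 ∈ ready := (hmem b0).2 ⟨hb0, fun c hc => by
        by_contra hcacc
        exact hmin c hcacc (.single hc)⟩
      rw [hr] at this
      simp at this
    · rw [hcons b l hr]
      have hb := (hmem b).1 (by rw [hr]; simp)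
      exact ih (acc ++ [b]) (ChildrenFirst.append_singleton.2 ⟨hacc, hb⟩) (by
        simp only [List.length_append, List.length_singleton]; omega)

end Graph

/-! ### Interface values of partial subsystems -/

section Interfaces

open Relation

variable {n m k : ℕ} (M : MDP (Fin n) (Fin m)) (Goal : Finset (Fin n)) (blk : Fin n → Fin k)
  (g : GraphData n k)

theorem P_eq_zero_of_not_edge {s t : Fin n} {α : Fin m} (hα : α ∈ M.act s) (h : ¬ M.Edge s t) :
    M.P s α t = 0 := by
  by_contra hne
  exact h ⟨α, hα, lt_of_le_of_ne (M.P_nonneg s α t) (Ne.symm hne)⟩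

/-- The values in a set `D` of states that is closed under the edges depend only on the states of
the subsystem in `D`. -/
theorem setValue_congr {D : Fin n → Prop} (hD : ∀ s t, D s → M.Edge s t → D t)
    {T T' : Finset (Fin n)} (h : ∀ s, D s → (s ∈ T ↔ s ∈ T')) {q : Fin n} (hq : D q) :
    setValue M Goal T q = setValue M Goal T' q := by
  classical
  have key : ∀ T T' : Finset (Fin n), (∀ s, D s → (s ∈ T ↔ s ∈ T')) →
      setValue M Goal T q ≤ setValue M Goal T' q := by
    intro T T' h
    have hV := isBellmanOn_setValue M Goal T'
    have hP : ∀ s α t, (0 : ℝ) ≤ M.P s α t := fun s α t => by exact_mod_cast M.P_nonneg s α t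
    have hx : IsBellmanOn M Goal T fun s => if D s then setValue M Goal T' s else 1 :=
      { nonneg := fun s => by
          split_ifs
          · exact hV.nonneg s
          · exact zero_le_one
        goal := fun s hs hg => by
          split_ifs with hd
          · exact hV.goal s ((h s hd).1 hs) hg
          · exact le_rfl
        fixed := fun s hs hg hd => by simp at hd
        step := fun s hs hg _ α hα => by
          split_ifs with hd
          · refine le_trans ?_ (hV.step s ((h s hd).1 hs) hg rfl α hα)
            have h0 : ∀ t, ¬ D t → M.P s α t = 0 := fun t ht =>
              P_eq_zero_of_not_edge M hα fun he => ht (hD s t hd he)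
            rw [← Finset.sum_filter_of_ne (p := D) (by
              intro t _ hne
              by_contra ht
              rw [h0 t ht] at hne
              simp at hne)]
            rw [Finset.sum_congr rfl (g := fun t => (M.P s α t : ℝ) * setValue M Goal T' t)
              (fun t ht => by rw [if_pos (Finset.mem_filter.1 ht).2])]
            refine Finset.sum_le_sum_of_subset_of_nonneg (fun t ht => ?_)
              fun t _ _ => mul_nonneg (hP s α t) (hV.nonneg t)
            rw [Finset.mem_filter] at ht
            exact (h t ht.2).1 ht.1
          · refine le_trans (Finset.sum_le_sum fun t _ => ?_)
              ((isBellman_one M Goal T (fun _ => false) (f := fun _ => 0)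
                fun _ => zero_le_one).step s hs hg rfl α hα)
            refine mul_le_mul_of_nonneg_left ?_ (hP s α t)
            split_ifs
            · exact setValue_le_one M Goal T' t
            · exact le_rfl }
    simpa [hq] using setValue_le M Goal hx q
  exact le_antisymm (key T T' h) (key T' T fun s hs => (h s hs).symm)

open Classical in
/-- The states of the blocks below `b`, including those of `b`. -/
noncomputable def subtreeStates (b : Fin k) : Finset (Fin n) :=
  Finset.univ.filter fun s => ReflTransGen (QuotientEdge M.Edge blk) b (blk s)

theorem mem_subtreeStates {b : Fin k} {s : Fin n} :
    s ∈ subtreeStates M blk b ↔ ReflTransGen (QuotientEdge M.Edge blk) b (blk s) := by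
  simp [subtreeStates]

theorem subtreeStates_closed {b : Fin k} {s t : Fin n} (hs : s ∈ subtreeStates M blk b)
    (he : M.Edge s t) : t ∈ subtreeStates M blk b := by
  rw [mem_subtreeStates] at hs ⊢
  by_cases h : blk s = blk t
  · exact h ▸ hs
  · exact hs.tail ⟨h, s, t, rfl, rfl, he⟩

theorem setValue_congr_subtree {b : Fin k} {T T' : Finset (Fin n)}
    (h : ∀ s ∈ subtreeStates M blk b, (s ∈ T ↔ s ∈ T')) {q : Fin n}
    (hq : q ∈ subtreeStates M blk b) : setValue M Goal T q = setValue M Goal T' q :=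
  setValue_congr M Goal (D := (· ∈ subtreeStates M blk b))
    (fun _ _ hs he => subtreeStates_closed M blk hs he) h hq

theorem subtreeStates_disjoint (htree : IsDirectedTree (QuotientEdge M.Edge blk)) {b c c' : Fin k}
    (hc : QuotientEdge M.Edge blk b c) (hc' : QuotientEdge M.Edge blk b c') (hne : c ≠ c')
    {s : Fin n} (hs : s ∈ subtreeStates M blk c) : s ∉ subtreeStates M blk c' := fun hs' =>
  hne (htree.eq_of_common_descendant hc hc' ((mem_subtreeStates M blk).1 hs)
    ((mem_subtreeStates M blk).1 hs'))

theorem blk_ne_of_mem_subtree (htree : IsDirectedTree (QuotientEdge M.Edge blk)) {b c : Fin k}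
    (hc : QuotientEdge M.Edge blk b c) {s : Fin n} (hs : s ∈ subtreeStates M blk c) :
    blk s ≠ b := by
  rintro rfl
  exact htree.not_transGen_self _ (TransGen.head' hc ((mem_subtreeStates M blk).1 hs))

theorem subtreeStates_subset {b c : Fin k} (hc : QuotientEdge M.Edge blk b c) :
    subtreeStates M blk c ⊆ subtreeStates M blk b := fun s hs => by
  rw [mem_subtreeStates] at hs ⊢
  exact hs.head hc

open Classical in
/-- The values, in the subsystem induced by `T`, of the interface states of the blocks in `C`. -/
noncomputable def interfaceValue (C : Fin k → Prop) (T : Finset (Fin n)) (q : Fin n) : ℝ :=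
  if C (blk q) ∧ g.inc q = true then setValue M Goal T q else 0

theorem interfaceValue_of {C : Fin k → Prop} {T : Finset (Fin n)} {q : Fin n} (h : C (blk q))
    (hq : g.inc q = true) : interfaceValue M Goal blk g C T q = setValue M Goal T q :=
  if_pos ⟨h, hq⟩

theorem interfaceValue_nonneg (C : Fin k → Prop) (T : Finset (Fin n)) (q : Fin n) :
    0 ≤ interfaceValue M Goal blk g C T q := by
  unfold interfaceValue
  split_ifs
  · exact (isBellmanOn_setValue M Goal T).nonneg q
  · exact le_rfl

theorem interfaceValue_le_one (C : Fin k → Prop) (T : Finset (Fin n)) (q : Fin n) :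
    interfaceValue M Goal blk g C T q ≤ 1 := by
  unfold interfaceValue
  split_ifs
  · exact setValue_le_one M Goal T q
  · exact zero_le_one

/-- The stored values are the interface values of partial subsystems below `b`. -/
def Sound (b : Fin k) (L : List (PartialSubsystem n)) : Prop :=
  ∀ U ∈ L, U.states ⊆ subtreeStates M blk b ∧
    realVec U.val = interfaceValue M Goal blk g (· = b) U.states

/-- The interface values of every subsystem `T` are dominated by stored partial subsystems that have
at most as many states as `T` has below `b`. -/
def Complete (b : Fin k) (L : List (PartialSubsystem n)) : Prop :=
  ∀ T, Dominates (levelPoints L (T ∩ subtreeStates M blk b).card)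
    (interfaceValue M Goal blk g (· = b) T)

/-! ### Combining the partial subsystems of the children -/

/-- One partial subsystem more, for the child `c`. -/
def combine (c : Fin k) (T U : PartialSubsystem n) : PartialSubsystem n :=
  ⟨T.states ∪ U.states, fun q => if blk q = c then U.val q else T.val q⟩

/-- The combinations of partial subsystems for all the children in a list. -/
def combinations (psubsys : Fin k → List (PartialSubsystem n)) (cs : List (Fin k)) :
    List (PartialSubsystem n) :=
  cs.foldl (fun combos c => combos.flatMap fun T => (psubsys c).map fun U => combine blk c T U)
    [⟨∅, fun _ => 0⟩]

theorem val_successorPoints (psubsys : Fin k → List (PartialSubsystem n)) (b : Fin k) :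
    (successorPoints g blk psubsys b).val =
      combinations blk psubsys ((List.finRange k).filter fun c => g.child b c) := by
  simp only [successorPoints, Timed.val_bind, Timed.val_filterL, Timed.val_op, Timed.val_foldL,
    Timed.val_flatMapL, Timed.val_mapL, Timed.val_tabulate, combinations]
  rfl

theorem mem_combinations_append (psubsys : Fin k → List (PartialSubsystem n)) (cs : List (Fin k))
    (c : Fin k) (V : PartialSubsystem n) :
    V ∈ combinations blk psubsys (cs ++ [c]) ↔
      ∃ T ∈ combinations blk psubsys cs, ∃ U ∈ psubsys c, V = combine blk c T U := by
  simp only [combinations, List.foldl_append, List.foldl_cons, List.foldl_nil, List.mem_flatMap,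
    List.mem_map]
  simp only [eq_comm]

theorem combinations_sound (htree : IsDirectedTree (QuotientEdge M.Edge blk))
    {psubsys : Fin k → List (PartialSubsystem n)} {b : Fin k} {cs : List (Fin k)}
    (hcs : ∀ c ∈ cs, QuotientEdge M.Edge blk b c) (hnd : cs.Nodup)
    (hs : ∀ c ∈ cs, Sound M Goal blk g c (psubsys c)) :
    ∀ U ∈ combinations blk psubsys cs,
      (∀ s ∈ U.states, ∃ c ∈ cs, s ∈ subtreeStates M blk c) ∧
      realVec U.val = interfaceValue M Goal blk g (· ∈ cs) U.states := by
  induction cs using List.reverseRecOn with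
  | nil =>
    intro U hU
    simp only [combinations, List.foldl_nil, List.mem_singleton] at hU
    subst hU
    refine ⟨by simp, ?_⟩
    funext q
    simp [realVec, interfaceValue]
  | append_singleton cs c ih =>
    intro V hV
    obtain ⟨T, hT, U, hU, rfl⟩ := (mem_combinations_append blk psubsys cs c V).1 hV
    rw [List.nodup_append] at hnd
    have hc : c ∉ cs := fun h => hnd.2.2 c h c (by simp) rfl
    obtain ⟨hT1, hT2⟩ := ih (fun d hd => hcs d (by simp [hd])) hnd.1
      (fun d hd => hs d (by simp [hd])) T hT
    obtain ⟨hU1, hU2⟩ := hs c (by simp) U hU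
    have hcE := hcs c (by simp)
    refine ⟨fun s hs => ?_, ?_⟩
    · rcases Finset.mem_union.1 hs with h | h
      · obtain ⟨d, hd, h⟩ := hT1 s h
        exact ⟨d, by simp [hd], h⟩
      · exact ⟨c, by simp, hU1 h⟩
    · funext q
      by_cases hq : blk q = c
      · have h1 : realVec (combine blk c T U).val q = realVec U.val q := by
          simp [realVec, combine, hq]
        have hsub : q ∈ subtreeStates M blk c := (mem_subtreeStates M blk).2 (hq ▸ .refl)
        rw [h1, hU2]
        simp only [interfaceValue, hq, List.mem_append, List.mem_singleton, or_true, true_and]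
        split_ifs
        · refine setValue_congr_subtree M Goal blk (b := c) (fun s hs => ?_) hsub
          simp only [combine, Finset.mem_union]
          refine ⟨Or.inr, fun h => h.resolve_left fun h => ?_⟩
          obtain ⟨d, hd, hd'⟩ := hT1 s h
          exact subtreeStates_disjoint M blk htree hcE (hcs d (by simp [hd]))
            (by rintro rfl; exact hc hd) hs hd'
        · rfl
      · have h1 : realVec (combine blk c T U).val q = realVec T.val q := by
          simp [realVec, combine, hq]
        rw [h1, hT2]
        simp only [interfaceValue, hq, List.mem_append, List.mem_singleton, or_false]
        split_ifs with h
        · have hsub : q ∈ subtreeStates M blk (blk q) := (mem_subtreeStates M blk).2 .refl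
          refine setValue_congr_subtree M Goal blk (b := blk q) (fun s hs => ?_) hsub
          simp only [combine, Finset.mem_union]
          refine ⟨Or.inl, fun h' => h'.resolve_right fun h' => ?_⟩
          exact subtreeStates_disjoint M blk htree (hcs (blk q) (by simp [h.1])) hcE hq hs (hU1 h')
        · rfl

/-- Choosing the coordinates outside of the block `c`, or those in it. -/
noncomputable def coordinates (p : Fin k → Prop) [DecidablePred p] :
    (Fin n → ℝ) →ₗ[ℝ] (Fin n → ℝ) where
  toFun v q := if p (blk q) then v q else 0
  map_add' v w := by funext q; simp only [Pi.add_apply]; split_ifs <;> simp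
  map_smul' a v := by funext q; simp

open Pointwise in
theorem dominates_combine {K L : List (PartialSubsystem n)} {i j : ℕ} {c : Fin k}
    {v u : Fin n → ℝ} (hv : Dominates (levelPoints K i) v) (hu : Dominates (levelPoints L j) u)
    {N : List (PartialSubsystem n)} (hN : ∀ T ∈ K, ∀ U ∈ L, combine blk c T U ∈ N) :
    Dominates (levelPoints N (i + j)) fun q => if blk q = c then u q else v q := by
  obtain ⟨v', hv', hvle⟩ := hv
  obtain ⟨u', hu', hule⟩ := hu
  set A := coordinates (n := n) blk (fun d => ¬ d = c)
  set B := coordinates (n := n) blk (fun d => d = c)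
  refine ⟨A v' + B u', ?_, fun q => ?_⟩
  · have h1 : A v' ∈ convexHull ℝ (A '' levelPoints K i) := by
      rw [← A.image_convexHull]; exact ⟨v', hv', rfl⟩
    have h2 : B u' ∈ convexHull ℝ (B '' levelPoints L j) := by
      rw [← B.image_convexHull]; exact ⟨u', hu', rfl⟩
    have h3 : A v' + B u' ∈ convexHull ℝ (A '' levelPoints K i + B '' levelPoints L j) := by
      rw [convexHull_add]; exact Set.add_mem_add h1 h2
    refine convexHull_mono ?_ h3
    rintro _ ⟨_, ⟨_, ⟨T, hT, hTc, rfl⟩, rfl⟩, _, ⟨_, ⟨U, hU, hUc, rfl⟩, rfl⟩, rfl⟩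
    refine ⟨_, hN T hT U hU, (Finset.card_union_le _ _).trans (add_le_add hTc hUc), ?_⟩
    funext q
    by_cases hq : blk q = c <;> simp [A, B, coordinates, realVec, combine, hq]
  · by_cases hq : blk q = c
    · simpa [A, B, coordinates, hq] using hule q
    · simpa [A, B, coordinates, hq] using hvle q

theorem combinations_complete {psubsys : Fin k → List (PartialSubsystem n)} {cs : List (Fin k)}
    (hc : ∀ c ∈ cs, Complete M Goal blk g c (psubsys c)) (T : Finset (Fin n)) :
    Dominates (levelPoints (combinations blk psubsys cs)
      (cs.map fun c => (T ∩ subtreeStates M blk c).card).sum)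
      (interfaceValue M Goal blk g (· ∈ cs) T) := by
  induction cs using List.reverseRecOn with
  | nil =>
    refine dominates_of_mem ⟨⟨∅, fun _ => 0⟩, by simp [combinations], by simp, ?_⟩
    funext q
    simp [realVec, interfaceValue]
  | append_singleton cs c ih =>
    have h := dominates_combine blk (c := c) (ih fun d hd => hc d (by simp [hd]))
      (hc c (by simp) T) (N := combinations blk psubsys (cs ++ [c]))
      (fun T hT U hU => (mem_combinations_append blk psubsys cs c _).2 ⟨T, hT, U, hU, rfl⟩)
    simp only [List.map_append, List.sum_append, List.map_cons, List.map_nil, List.sum_singleton]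
    convert h using 1
    funext q
    by_cases hq : blk q = c
    · simp [interfaceValue, hq]
    · simp [interfaceValue, hq]

end Interfaces

/-! ### Processing a block -/

section Blocks

open Relation

variable {n m k : ℕ} (M : MDP (Fin n) (Fin m)) (Goal : Finset (Fin n)) (blk : Fin n → Fin k)
  (g : GraphData n k)

/-- The indicator array of the interface states below `b`. -/
def outArray (b : Fin k) (q : Fin n) : Bool := g.child b (blk q) && g.inc q

theorem states_newSubsystem (b : Fin k) (X : Finset (Fin n)) (T : PartialSubsystem n) :
    (newSubsystem M Goal g blk b X T).val.states = X ∪ T.states := rfl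

theorem val_newSubsystem (b : Fin k) (X : Finset (Fin n)) (T : PartialSubsystem n) :
    (newSubsystem M Goal g blk b X T).val.val = fun q =>
      if blk q = b ∧ g.inc q = true ∧ q ∈ X ∪ T.states then
        (maxVal M Goal (X ∪ T.states) (outArray blk g b) T.val).val q else 0 := rfl

variable {M Goal blk g}

theorem inc_of_edge (hg : g.Correct M blk) {s t : Fin n} (he : M.Edge s t) (hne : blk s ≠ blk t) :
    g.child (blk s) (blk t) = true ∧ g.inc t = true :=
  have h : QuotientEdge M.Edge blk (blk s) (blk t) := ⟨hne, s, t, rfl, rfl, he⟩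
  ⟨(hg.child _ _).2 h, (hg.inc t).2 (Or.inr ⟨s, h, he⟩)⟩

/-- The linear program for the block, with the values of the children as the values at the exits,
returns the values of the united subsystem: both are least solutions of the same inequalities in the
block, since every edge that leaves the block leads to an interface state of a child. -/
theorem newSubsystem_sound (hg : g.Correct M blk)
    (htree : IsDirectedTree (QuotientEdge M.Edge blk)) {b : Fin k} {X : Finset (Fin n)}
    (hX : ∀ s ∈ X, blk s = b) {T : PartialSubsystem n}
    (hT : ∀ s ∈ T.states, ∃ c, g.child b c = true ∧ s ∈ subtreeStates M blk c)
    (hval : realVec T.val = interfaceValue M Goal blk g (fun c => g.child b c = true) T.states) :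
    (newSubsystem M Goal g blk b X T).val.states ⊆ subtreeStates M blk b ∧
      realVec (newSubsystem M Goal g blk b X T).val.val =
        interfaceValue M Goal blk g (· = b) (newSubsystem M Goal g blk b X T).val.states := by
  rw [states_newSubsystem, val_newSubsystem]
  set Y := X ∪ T.states with hY
  have hsub : Y ⊆ subtreeStates M blk b := by
    intro s hs
    rcases Finset.mem_union.1 hs with h | h
    · exact (mem_subtreeStates M blk).2 (hX s h ▸ .refl)
    · obtain ⟨c, hc, hs⟩ := hT s h
      exact subtreeStates_subset M blk ((hg.child b c).1 hc) hs
  refine ⟨hsub, ?_⟩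
  have hf : ∀ s, T.val s ≤ 1 := fun s => by
    have : realVec T.val s ≤ 1 := by rw [hval]; exact interfaceValue_le_one _ _ _ _ _ _ _
    exact_mod_cast (show (T.val s : ℝ) ≤ 1 from this)
  obtain ⟨hB, hleast⟩ := maxVal_spec M Goal Y (outArray blk g b) T.val hf
  have hV := isBellmanOn_setValue M Goal Y
  -- Below the block, the values in `Y` are those in `T`.
  have hout : ∀ s, outArray blk g b s = true → (T.val s : ℝ) = setValue M Goal Y s := by
    intro s hs
    simp only [outArray, Bool.and_eq_true] at hs
    have h1 : (T.val s : ℝ) = setValue M Goal T.states s :=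
      (congrFun hval s).trans (if_pos hs)
    rw [h1]
    refine setValue_congr_subtree M Goal blk (b := blk s) (fun t ht => ?_)
      ((mem_subtreeStates M blk).2 .refl)
    refine ⟨fun h => Finset.mem_union_right _ h, fun h => (Finset.mem_union.1 h).resolve_left
      fun h => ?_⟩
    exact blk_ne_of_mem_subtree M blk htree ((hg.child _ _).1 hs.1) ht (hX t h)
  have hle : ∀ s, ((maxVal M Goal Y (outArray blk g b) T.val).val s : ℝ) ≤ setValue M Goal Y s :=
    hleast _
      { nonneg := hV.nonneg
        goal := hV.goal
        fixed := fun s _ _ hd => (hout s hd).le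
        step := fun s hs hg _ => hV.step s hs hg rfl }
  have hge : ∀ s, blk s = b →
      setValue M Goal Y s ≤ ((maxVal M Goal Y (outArray blk g b) T.val).val s : ℝ) := by
    intro s hs
    set x := (maxVal M Goal Y (outArray blk g b) T.val).val
    have hx : IsBellmanOn M Goal Y fun s => if blk s = b then (x s : ℝ) else setValue M Goal Y s :=
      { nonneg := fun s => by
          split_ifs
          · exact hB.nonneg s
          · exact hV.nonneg s
        goal := fun s hs hg => by
          split_ifs
          · exact hB.goal s hs hg
          · exact hV.goal s hs hg
        fixed := fun s _ _ hd => by simp at hd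
        step := fun s hs hsg _ α hα => by
          have hP : ∀ t, (0 : ℝ) ≤ M.P s α t := fun t => by exact_mod_cast M.P_nonneg s α t
          split_ifs with hb
          · have hd : outArray blk g b s = false := by
              rw [← Bool.not_eq_true]
              simp only [outArray, Bool.and_eq_true, hb, hg.child]
              exact fun h => h.1.1 rfl
            refine le_trans (Finset.sum_le_sum fun t ht => ?_) (hB.step s hs hsg hd α hα)
            by_cases he : M.Edge s t
            · refine mul_le_mul_of_nonneg_left ?_ (hP t)
              split_ifs with htb
              · exact le_rfl
              · have hi := inc_of_edge hg he (by rw [hb]; exact Ne.symm htb)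
                have ho : outArray blk g b t = true := by
                  simp [outArray, ← hb, hi.1, hi.2]
                by_cases htg : t ∈ Goal
                · exact (setValue_le_one M Goal Y t).trans (hB.goal t ht htg)
                · rw [← hout t ho]
                  exact hB.fixed t ht htg ho
            · rw [P_eq_zero_of_not_edge M hα he]
              simp
          · refine le_trans (Finset.sum_le_sum fun t ht => ?_) (hV.step s hs hsg rfl α hα)
            by_cases he : M.Edge s t
            · refine mul_le_mul_of_nonneg_left ?_ (hP t)
              rw [if_neg]
              rcases Finset.mem_union.1 hs with h | h
              · exact absurd (hX s h) hb
              · obtain ⟨c, hc, hsc⟩ := hT s h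
                exact blk_ne_of_mem_subtree M blk htree ((hg.child b c).1 hc)
                  (subtreeStates_closed M blk hsc he)
            · rw [P_eq_zero_of_not_edge M hα he]
              simp }
    simpa [hs] using setValue_le M Goal hx s
  funext q
  simp only [realVec, interfaceValue]
  by_cases hq : blk q = b ∧ g.inc q = true
  · by_cases hqY : q ∈ Y
    · rw [if_pos ⟨hq.1, hq.2, hqY⟩, if_pos hq]
      exact le_antisymm (hle q) (hge q hq.1)
    · rw [if_neg (by tauto), if_pos hq, setValue_eq_zero M Goal hqY]
      simp
  · rw [if_neg (by tauto), if_neg hq]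
    simp

/-- The subtrees of the children of `b` are disjoint parts of the subtree of `b` outside of the
block `b`. -/
theorem card_filter_add_sum_le (hg : g.Correct M blk)
    (htree : IsDirectedTree (QuotientEdge M.Edge blk)) (b : Fin k) (T : Finset (Fin n)) :
    (T.filter fun s => blk s = b).card + (((List.finRange k).filter fun c => g.child b c).map
      fun c => (T ∩ subtreeStates M blk c).card).sum ≤ (T ∩ subtreeStates M blk b).card := by
  rw [← List.sum_toFinset _ ((List.nodup_finRange k).filter _),
    ← Finset.card_biUnion, ← Finset.card_union_of_disjoint]
  · refine Finset.card_le_card fun s hs => ?_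
    rcases Finset.mem_union.1 hs with h | h
    · rw [Finset.mem_filter] at h
      exact Finset.mem_inter.2 ⟨h.1, (mem_subtreeStates M blk).2 (h.2 ▸ .refl)⟩
    · obtain ⟨c, hc, h⟩ := Finset.mem_biUnion.1 h
      have hc : g.child b c = true := by simpa using hc
      exact Finset.mem_inter.2 ⟨(Finset.mem_inter.1 h).1,
        subtreeStates_subset M blk ((hg.child b c).1 hc) (Finset.mem_inter.1 h).2⟩
  · rw [Finset.disjoint_left]
    intro s hs h
    obtain ⟨c, hc, h⟩ := Finset.mem_biUnion.1 h
    have hc : g.child b c = true := by simpa using hc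
    exact blk_ne_of_mem_subtree M blk htree ((hg.child b c).1 hc) (Finset.mem_inter.1 h).2
      (Finset.mem_filter.1 hs).2
  · intro c hc c' hc' hne
    rw [Function.onFun, Finset.disjoint_left]
    intro s hs hs'
    have hc : g.child b c = true := by simpa using hc
    have hc' : g.child b c' = true := by simpa using hc'
    exact subtreeStates_disjoint M blk htree ((hg.child b c).1 hc) ((hg.child b c').1 hc') hne
      (Finset.mem_inter.1 hs).2 (Finset.mem_inter.1 hs').2

/-- The values of `T` at the interface of `b` are dominated by the new partial subsystems for the
set of the states of `T` in `b`, because the value is a convex function of the values below the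
block. -/
theorem newSubsystem_complete (hg : g.Correct M blk)
    (htree : IsDirectedTree (QuotientEdge M.Edge blk)) {b : Fin k}
    {succ : List (PartialSubsystem n)}
    (hsucc : ∀ U ∈ succ,
      realVec U.val = interfaceValue M Goal blk g (fun c => g.child b c = true) U.states)
    {T : Finset (Fin n)}
    (hdom : Dominates (levelPoints succ
      (((List.finRange k).filter fun c => g.child b c).map
        fun c => (T ∩ subtreeStates M blk c).card).sum)
      (interfaceValue M Goal blk g (fun c => g.child b c = true) T)) :
    Dominates (levelPoints (succ.map fun U =>
        (newSubsystem M Goal g blk b (T.filter fun s => blk s = b) U).val)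
        (T ∩ subtreeStates M blk b).card)
      (interfaceValue M Goal blk g (· = b) T) := by
  set X := T.filter fun s => blk s = b with hX
  have hcard := card_filter_add_sum_le hg htree b T
  obtain ⟨u, hu, hule⟩ := hdom
  obtain ⟨ι, _, w, z, hw0, hw1, hz, rfl⟩ := mem_convexHull_iff_exists_fintype.1 hu
  choose U hU hUc hUz using hz
  let Y : ι → Finset (Fin n) := fun i => X ∪ (U i).states
  let x : ι → Fin n → ℝ := fun i s => (maxVal M Goal (Y i) (outArray blk g b) (U i).val).val s
  have hf : ∀ i s, (U i).val s ≤ 1 := fun i s => by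
    have : realVec (U i).val s ≤ 1 := by
      rw [hsucc _ (hU i)]; exact interfaceValue_le_one _ _ _ _ _ _ _
    exact_mod_cast (show ((U i).val s : ℝ) ≤ 1 from this)
  have hB : ∀ i, IsBellman M Goal (Y i) (outArray blk g b) (fun s => ((U i).val s : ℝ)) (x i) :=
    fun i => (maxVal_spec M Goal (Y i) (outArray blk g b) (U i).val (hf i)).1
  have hV := isBellmanOn_setValue M Goal T
  -- The average `∑ i, w i * x i` bounds the value in the block from above; the minimum keeps the
  -- inequalities of the states outside of the block.
  have hmain : IsBellmanOn M Goal T fun s =>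
      if blk s = b then min (setValue M Goal T s) (∑ i, w i * x i s) else setValue M Goal T s :=
    { nonneg := fun s => by
        split_ifs
        · exact le_min (hV.nonneg s) (Finset.sum_nonneg fun i _ =>
            mul_nonneg (hw0 i) ((hB i).nonneg s))
        · exact hV.nonneg s
      goal := fun s hs hgoal => by
        split_ifs with hb
        · refine le_min (hV.goal s hs hgoal) ?_
          rw [← hw1]
          refine Finset.sum_le_sum fun i _ => le_mul_of_one_le_right (hw0 i) ?_
          exact (hB i).goal s (Finset.mem_union_left _ (by simp [hX, hs, hb])) hgoal
        · exact hV.goal s hs hgoal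
      fixed := fun s _ _ hd => by simp at hd
      step := fun s hs hsg _ α hα => by
        have hP : ∀ t, (0 : ℝ) ≤ M.P s α t := fun t => by exact_mod_cast M.P_nonneg s α t
        have h1 : ∑ t ∈ T, (M.P s α t : ℝ) * (if blk t = b then
            min (setValue M Goal T t) (∑ i, w i * x i t) else setValue M Goal T t) ≤
            setValue M Goal T s := by
          refine le_trans (Finset.sum_le_sum fun t _ => mul_le_mul_of_nonneg_left ?_ (hP t))
            (hV.step s hs hsg rfl α hα)
          split_ifs
          · exact min_le_left _ _
          · exact le_rfl
        split_ifs with hb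
        swap
        · exact h1
        refine le_min h1 ?_
        have hd : outArray blk g b s = false := by
          rw [← Bool.not_eq_true]
          simp only [outArray, Bool.and_eq_true, hb, hg.child]
          exact fun h => h.1.1 rfl
        -- Averaging the Bellman inequalities of the systems for the `U i`.
        have h2 : ∑ i, w i * ∑ t ∈ Y i, (M.P s α t : ℝ) * x i t ≤ ∑ i, w i * x i s :=
          Finset.sum_le_sum fun i _ => mul_le_mul_of_nonneg_left
            ((hB i).step s (Finset.mem_union_left _ (by simp [hX, hs, hb])) hsg hd α hα) (hw0 i)
        refine le_trans ?_ h2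
        have h3 : ∀ i, ∑ t ∈ Y i, (M.P s α t : ℝ) * x i t =
            ∑ t, (M.P s α t : ℝ) * (if t ∈ Y i then x i t else 0) := by
          intro i
          simp [Finset.sum_ite_mem]
        simp only [h3, Finset.mul_sum]
        rw [Finset.sum_comm]
        refine le_trans (Finset.sum_le_sum (g := fun t => ∑ i, w i * ((M.P s α t : ℝ) *
          (if t ∈ Y i then x i t else 0))) fun t ht => ?_) ?_
        · by_cases he : M.Edge s t
          swap
          · rw [P_eq_zero_of_not_edge M hα he]; simp
          have h4 : ∑ i, w i * ((M.P s α t : ℝ) * (if t ∈ Y i then x i t else 0)) =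
              (M.P s α t : ℝ) * ∑ i, w i * (if t ∈ Y i then x i t else 0) := by
            rw [Finset.mul_sum]; exact Finset.sum_congr rfl fun i _ => by ring
          rw [h4]
          refine mul_le_mul_of_nonneg_left ?_ (hP t)
          split_ifs with htb
          · refine (min_le_right _ _).trans (le_of_eq (Finset.sum_congr rfl fun i _ => ?_))
            rw [if_pos (Finset.mem_union_left _ (by simp [hX, ht, htb]))]
          · have hi := inc_of_edge hg he (by rw [hb]; exact Ne.symm htb)
            rw [hb] at hi
            have ho : outArray blk g b t = true := by simp [outArray, hi.1, hi.2]
            have h5 := hule t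
            rw [interfaceValue_of M Goal blk g (by exact hi.1) hi.2] at h5
            refine h5.trans ?_
            simp only [Finset.sum_apply, Pi.smul_apply, smul_eq_mul]
            refine Finset.sum_le_sum fun i _ => mul_le_mul_of_nonneg_left ?_ (hw0 i)
            rw [hUz i]
            split_ifs with htY
            · by_cases htg : t ∈ Goal
              · exact le_trans (show ((U i).val t : ℝ) ≤ 1 by exact_mod_cast hf i t)
                  ((hB i).goal t htY htg)
              · exact (hB i).fixed t htY htg ho
            · rw [hsucc _ (hU i), interfaceValue_of M Goal blk g (by exact hi.1) hi.2,
                setValue_eq_zero M Goal fun h => htY (Finset.mem_union_right _ h)]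
        · refine Finset.sum_le_sum_of_subset_of_nonneg (Finset.subset_univ T) fun t _ _ =>
            Finset.sum_nonneg fun i _ => mul_nonneg (hw0 i) (mul_nonneg (hP t) ?_)
          split_ifs
          · exact (hB i).nonneg t
          · exact le_rfl }
  refine ⟨∑ i, w i • realVec (newSubsystem M Goal g blk b X (U i)).val.val,
    mem_convexHull_of_exists_fintype w _ hw0 hw1 (fun i => ⟨_, List.mem_map.2 ⟨U i, hU i, rfl⟩,
      ?_, rfl⟩) rfl, fun q => ?_⟩
  · rw [states_newSubsystem]
    exact (Finset.card_union_le _ _).trans ((Nat.add_le_add_left (hUc i) _).trans hcard)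
  · simp only [Finset.sum_apply, Pi.smul_apply, smul_eq_mul]
    have hpos : 0 ≤ ∑ i, w i * realVec (newSubsystem M Goal g blk b X (U i)).val.val q := by
      refine Finset.sum_nonneg fun i _ => mul_nonneg (hw0 i) ?_
      rw [val_newSubsystem]
      simp only [realVec]
      split_ifs
      · exact (hB i).nonneg q
      · simp
    by_cases hq : blk q = b ∧ g.inc q = true
    · rw [interfaceValue_of M Goal blk g (by exact hq.1) hq.2]
      by_cases hqT : q ∈ T
      · have h := setValue_le M Goal hmain q
        rw [if_pos hq.1] at h
        refine (h.trans (min_le_right _ _)).trans (le_of_eq (Finset.sum_congr rfl fun i _ => ?_))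
        rw [val_newSubsystem]
        simp only [realVec]
        rw [if_pos ⟨hq.1, hq.2, Finset.mem_union_left _ (by simp [hX, hqT, hq.1])⟩]
      · rw [setValue_eq_zero M Goal hqT]
        exact hpos
    · rw [interfaceValue, if_neg hq]
      exact hpos

/-! ### The filter on the subsets of a block -/

theorem satisfiesFilter_iff (hg : g.Correct M blk) (X : Finset (Fin n)) :
    (satisfiesFilter g Goal X).val = true ↔ ∀ s ∈ X,
      (g.inc s = true ∨ ∃ s' ∈ X, M.Edge s' s) ∧
      (g.exit s = true ∨ s ∈ Goal ∨ ∃ s' ∈ X, M.Edge s s') := by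
  simp only [satisfiesFilter, Timed.val_allL, Timed.val_bind, Timed.val_anyL, Timed.val_op,
    List.all_eq_true, List.mem_finRange, true_implies, Bool.or_eq_true, Bool.and_eq_true,
    decide_eq_true_eq, List.any_eq_true, true_and, hg.edge]
  refine forall_congr' fun s => ?_
  by_cases hs : s ∈ X <;> simp [hs, or_assoc]

/-- A state that violates the filter can be removed: either it is not reachable within the subsystem
from outside, or its value is zero. -/
theorem exists_satisfiesFilter (hg : g.Correct M blk) (b : Fin k) (T : Finset (Fin n)) :
    ∃ T' ⊆ T, (satisfiesFilter g Goal (T'.filter fun s => blk s = b)).val = true ∧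
      interfaceValue M Goal blk g (· = b) T ≤ interfaceValue M Goal blk g (· = b) T' := by
  induction T using Finset.strongInduction with
  | H T ih =>
    by_cases hf : (satisfiesFilter g Goal (T.filter fun s => blk s = b)).val = true
    · exact ⟨T, subset_rfl, hf, le_rfl⟩
    rw [satisfiesFilter_iff hg] at hf
    push Not at hf
    obtain ⟨s, hs, hbad⟩ := hf
    rw [Finset.mem_filter] at hs
    obtain ⟨hsT, hsb⟩ := hs
    have hV := isBellmanOn_setValue M Goal T
    have hV' := isBellmanOn_setValue M Goal (T.erase s)
    have hstep : ∀ q, g.inc q = true →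
        setValue M Goal T q ≤ setValue M Goal (T.erase s) q := by
      intro q hq
      by_cases hpre : g.inc s = true ∨ ∃ s' ∈ T.filter (fun s => blk s = b), M.Edge s' s
      · -- The state has no successor and is no goal state.
        obtain ⟨hexit, hgoal, hsucc⟩ := hbad hpre
        have hnoedge : ∀ t ∈ T, ¬ M.Edge s t := by
          intro t ht he
          by_cases htb : blk t = b
          · exact hsucc t (Finset.mem_filter.2 ⟨ht, htb⟩) he
          · exact hexit ((hg.exit s).2 ⟨t, by rwa [hsb], he⟩)
        have hs0 : setValue M Goal (T.erase s) s = 0 := setValue_eq_zero M Goal (by simp)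
        refine setValue_le M Goal (T := T) (x := setValue M Goal (T.erase s))
          { nonneg := hV'.nonneg
            goal := fun t ht htg => hV'.goal t (Finset.mem_erase.2
              ⟨by rintro rfl; exact hgoal htg, ht⟩) htg
            fixed := fun t _ _ hd => by simp at hd
            step := fun t ht htg _ α hα => ?_ } q
        by_cases hts : t = s
        · subst hts
          rw [Finset.sum_eq_zero fun u hu => by
            rw [P_eq_zero_of_not_edge M hα (hnoedge u hu)]; simp]
          exact hV'.nonneg t
        · refine le_trans (le_of_eq ?_) (hV'.step t (Finset.mem_erase.2 ⟨hts, ht⟩) htg rfl α hα)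
          rw [← Finset.add_sum_erase T _ hsT, hs0, mul_zero, zero_add]
      · push Not at hpre
        obtain ⟨hinc, hpred⟩ := hpre
        have hnoedge : ∀ t ∈ T, ¬ M.Edge t s := by
          intro t ht he
          by_cases htb : blk t = b
          · exact hpred t (Finset.mem_filter.2 ⟨ht, htb⟩) he
          · exact hinc (inc_of_edge hg he (by rwa [hsb])).2
        have hqs : q ≠ s := by rintro rfl; exact hinc hq
        have hx : IsBellmanOn M Goal T fun t => if t = s then setValue M Goal T t
            else min (setValue M Goal T t) (setValue M Goal (T.erase s) t) :=
          { nonneg := fun t => by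
              split_ifs
              · exact hV.nonneg t
              · exact le_min (hV.nonneg t) (hV'.nonneg t)
            goal := fun t ht htg => by
              split_ifs with hts
              · exact hV.goal t ht htg
              · exact le_min (hV.goal t ht htg)
                  (hV'.goal t (Finset.mem_erase.2 ⟨hts, ht⟩) htg)
            fixed := fun t _ _ hd => by simp at hd
            step := fun t ht htg _ α hα => by
              have hP : ∀ u, (0 : ℝ) ≤ M.P t α u := fun u => by exact_mod_cast M.P_nonneg t α u
              have h1 : ∑ u ∈ T, (M.P t α u : ℝ) * (if u = s then setValue M Goal T u
                  else min (setValue M Goal T u) (setValue M Goal (T.erase s) u)) ≤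
                  setValue M Goal T t := by
                refine le_trans (Finset.sum_le_sum fun u _ => mul_le_mul_of_nonneg_left ?_ (hP u))
                  (hV.step t ht htg rfl α hα)
                split_ifs
                · exact le_rfl
                · exact min_le_left _ _
              split_ifs with hts
              · exact h1
              refine le_min h1 ?_
              refine le_trans ?_ (hV'.step t (Finset.mem_erase.2 ⟨hts, ht⟩) htg rfl α hα)
              rw [← Finset.add_sum_erase T _ hsT,
                P_eq_zero_of_not_edge M hα (hnoedge t ht), Rat.cast_zero, zero_mul, zero_add]
              refine Finset.sum_le_sum fun u hu => mul_le_mul_of_nonneg_left ?_ (hP u)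
              rw [if_neg (Finset.mem_erase.1 hu).1]
              exact min_le_right _ _ }
        have h := setValue_le M Goal hx q
        rw [if_neg hqs] at h
        exact h.trans (min_le_right _ _)
    obtain ⟨T', hT', hf', hle⟩ := ih (T.erase s) (Finset.erase_ssubset hsT)
    refine ⟨T', hT'.trans (Finset.erase_subset _ _), hf', le_trans (fun q => ?_) hle⟩
    unfold interfaceValue
    split_ifs with hq
    · exact hstep q hq.2
    · exact le_rfl

/-! ### The invariants of the stored partial subsystems -/

theorem val_processBlock (psubsys : Fin k → List (PartialSubsystem n)) (b : Fin k) :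
    (processBlock M Goal g blk psubsys b).val =
      (((subsetsOf ((List.finRange n).filter fun s => decide (blk s = b))).val).filter
        fun X => (satisfiesFilter g Goal X).val).foldl
      (fun stored X => (removeDominated
        (((List.finRange n).filter fun s => decide (blk s = b)).filter fun s => g.inc s)
        (stored ++ (successorPoints g blk psubsys b).val.map fun T =>
          (newSubsystem M Goal g blk b X T).val)).val) [] := by
  simp only [processBlock, Timed.val_bind, Timed.val_filterL, Timed.val_op, Timed.val_foldL,
    Timed.val_mapL, Timed.val_append]

/-- Soundness and completeness pass from the children to the parent. -/
theorem processBlock_spec (hg : g.Correct M blk)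
    (htree : IsDirectedTree (QuotientEdge M.Edge blk)) {psubsys : Fin k → List (PartialSubsystem n)}
    {b : Fin k} (hs : ∀ c, g.child b c = true → Sound M Goal blk g c (psubsys c))
    (hc : ∀ c, g.child b c = true → Complete M Goal blk g c (psubsys c)) :
    Sound M Goal blk g b (processBlock M Goal g blk psubsys b).val ∧
      Complete M Goal blk g b (processBlock M Goal g blk psubsys b).val := by
  rw [val_processBlock]
  set block := (List.finRange n).filter fun s => decide (blk s = b) with hblock
  set I := block.filter fun s => g.inc s with hI
  set models := (subsetsOf block).val.filter fun X => (satisfiesFilter g Goal X).val with hmodels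
  set cs := (List.finRange k).filter fun c => g.child b c with hcs
  have hmemcs : ∀ c, c ∈ cs ↔ g.child b c = true := by simp [hcs]
  rw [val_successorPoints]
  set succ := combinations blk psubsys cs with hsucc
  have hmemeq : interfaceValue M Goal blk g (· ∈ cs) =
      interfaceValue M Goal blk g (fun c => g.child b c = true) := by
    congr 1
    funext c
    exact propext (hmemcs c)
  have hsound := combinations_sound M Goal blk g htree (b := b) (cs := cs)
    (fun c h => (hg.child b c).1 ((hmemcs c).1 h)) ((List.nodup_finRange k).filter _)
    (fun c h => hs c ((hmemcs c).1 h))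
  have hcomplete := combinations_complete M Goal blk g (cs := cs)
    (fun c h => hc c ((hmemcs c).1 h))
  rw [hmemeq] at hsound hcomplete
  rw [← hsucc] at hsound hcomplete
  have hblockX : ∀ X ∈ models, ∀ s ∈ X, blk s = b := by
    intro X hX s hs
    rw [hmodels, List.mem_filter, mem_subsetsOf] at hX
    simpa [hblock] using hX.1 s hs
  have hnew : ∀ X ∈ models, Sound M Goal blk g b
      (succ.map fun T => (newSubsystem M Goal g blk b X T).val) := by
    intro X hX U hU
    obtain ⟨T, hT, rfl⟩ := List.mem_map.1 hU
    obtain ⟨h1, h2⟩ := hsound T hT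
    exact newSubsystem_sound hg htree (hblockX X hX)
      (fun s hs => by
        obtain ⟨c, hc, h⟩ := h1 s hs
        exact ⟨c, (hmemcs c).1 hc, h⟩) h2
  have happ : ∀ L L', Sound M Goal blk g b L → Sound M Goal blk g b L' →
      Sound M Goal blk g b (L ++ L') := by
    intro L L' h h' U hU
    rcases List.mem_append.1 hU with hU | hU
    · exact h U hU
    · exact h' U hU
  have hred : ∀ L, Sound M Goal blk g b L →
      Sound M Goal blk g b (removeDominated I L).val :=
    fun L h U hU => h U ((mem_removeDominated I L U).1 hU).1
  have hdom : ∀ L, Sound M Goal blk g b L → ∀ j v, Dominates (levelPoints L j) v →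
      Dominates (levelPoints (removeDominated I L).val j) v := by
    intro L hL j v
    refine removeDominated_dominates (fun U hU q => ?_) (fun U hU q hq => ?_) j
    · have h : 0 ≤ realVec U.val q := by
        rw [(hL U hU).2]; exact interfaceValue_nonneg _ _ _ _ _ _ _
      exact_mod_cast (show (0 : ℝ) ≤ U.val q from h)
    · have h : realVec U.val q = 0 := by
        rw [(hL U hU).2, interfaceValue, if_neg]
        rintro ⟨h1, h2⟩
        exact hq (by simp [hI, hblock, h1, h2])
      simpa [realVec] using h
  have hfold : ∀ (ms : List (Finset (Fin n))) (stored : List (PartialSubsystem n)),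
      (∀ X ∈ ms, X ∈ models) → Sound M Goal blk g b stored →
      Sound M Goal blk g b (ms.foldl (fun stored X => (removeDominated I
        (stored ++ succ.map fun T => (newSubsystem M Goal g blk b X T).val)).val) stored) ∧
      (∀ j v, Dominates (levelPoints stored j) v → Dominates (levelPoints
        (ms.foldl (fun stored X => (removeDominated I
          (stored ++ succ.map fun T => (newSubsystem M Goal g blk b X T).val)).val) stored) j) v) ∧
      ∀ X ∈ ms, ∀ j v, Dominates (levelPoints
        (succ.map fun T => (newSubsystem M Goal g blk b X T).val) j) v → Dominates (levelPoints
        (ms.foldl (fun stored X => (removeDominated I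
          (stored ++ succ.map fun T => (newSubsystem M Goal g blk b X T).val)).val) stored) j)
            v := by
    intro ms
    induction ms with
    | nil => exact fun stored _ h => ⟨h, fun _ _ h => h, by simp⟩
    | cons X ms ih =>
      intro stored hms hst
      have hall := happ _ _ hst (hnew X (hms X (by simp)))
      obtain ⟨h1, h2, h3⟩ := ih _ (fun Y hY => hms Y (by simp [hY])) (hred _ hall)
      rw [List.foldl_cons]
      refine ⟨h1, fun j v h => h2 j v (hdom _ hall j v (h.mono (levelPoints_mono
        (by simp +contextual) le_rfl))), fun Y hY j v h => ?_⟩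
      rcases List.mem_cons.1 hY with rfl | hY
      · exact h2 j v (hdom _ hall j v (h.mono (levelPoints_mono
          (fun U hU => List.mem_append_right _ hU) le_rfl)))
      · exact h3 Y hY j v h
  obtain ⟨h1, -, h3⟩ := hfold models [] (fun _ h => h) (by intro U hU; simp at hU)
  refine ⟨h1, fun T => ?_⟩
  obtain ⟨T', hT', hf, hle⟩ := exists_satisfiesFilter (Goal := Goal) hg b T
  have hmem : T'.filter (fun s => blk s = b) ∈ models := by
    rw [hmodels, List.mem_filter, mem_subsetsOf]
    exact ⟨fun s hs => by simpa [hblock] using (Finset.mem_filter.1 hs).2, hf⟩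
  have h := h3 _ hmem _ _ (newSubsystem_complete hg htree (fun U hU => (hsound U hU).2)
    (hcomplete T'))
  have h' := h.mono (levelPoints_mono (fun _ h => h)
    (Finset.card_le_card (Finset.inter_subset_inter_right hT')))
  obtain ⟨w, hw, hwle⟩ := h'
  exact ⟨w, hw, hle.trans hwle⟩

/-! ### The result of the algorithm -/

/-- The lists that are stored after the blocks of `order` have been processed. -/
def storedSubsystems (M : MDP (Fin n) (Fin m)) (Goal : Finset (Fin n)) (blk : Fin n → Fin k)
    (g : GraphData n k) (order : List (Fin k)) : Fin k → List (PartialSubsystem n) :=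
  order.foldl (fun ps b c => if c = b then (processBlock M Goal g blk ps b).val else ps c)
    fun _ => []

theorem storedSubsystems_spec (hg : g.Correct M blk)
    (htree : IsDirectedTree (QuotientEdge M.Edge blk)) {order : List (Fin k)}
    (horder : ChildrenFirst g.child order) :
    ∀ b ∈ order, Sound M Goal blk g b (storedSubsystems M Goal blk g order b) ∧
      Complete M Goal blk g b (storedSubsystems M Goal blk g order b) := by
  induction order using List.reverseRecOn with
  | nil => simp
  | append_singleton order b ih =>
    obtain ⟨h1, hb, hch⟩ := ChildrenFirst.append_singleton.1 horder
    have hval : storedSubsystems M Goal blk g (order ++ [b]) = fun c => if c = b then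
        (processBlock M Goal g blk (storedSubsystems M Goal blk g order) b).val
        else storedSubsystems M Goal blk g order c := by
      simp only [storedSubsystems, List.foldl_append, List.foldl_cons, List.foldl_nil]
    intro c hc
    rw [hval]
    by_cases hcb : c = b
    · subst hcb
      simp only [if_true]
      exact processBlock_spec hg htree (fun d hd => (ih h1 d (hch d hd)).1)
        (fun d hd => (ih h1 d (hch d hd)).2)
    · simp only [hcb, if_false]
      exact ih h1 c (by simpa [hcb] using hc)

theorem foldl_smallest_spec (L : List (PartialSubsystem n)) :
    (L = [] ∧ L.foldl (fun (best : Option (PartialSubsystem n)) U => (match best with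
      | none => Timed.op 1 (some U)
      | some V => Timed.op (2 * n + 1)
        (if V.states.card ≤ U.states.card then some V else some U) : Timed _).val) none = none) ∨
    ∃ V ∈ L, L.foldl (fun (best : Option (PartialSubsystem n)) U => (match best with
      | none => Timed.op 1 (some U)
      | some V => Timed.op (2 * n + 1)
        (if V.states.card ≤ U.states.card then some V else some U) : Timed _).val) none = some V ∧
      ∀ U ∈ L, V.states.card ≤ U.states.card := by
  have key : ∀ (L : List (PartialSubsystem n)) (W : PartialSubsystem n), ∃ V ∈ W :: L,
      L.foldl (fun (best : Option (PartialSubsystem n)) U => (match best with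
      | none => Timed.op 1 (some U)
      | some V => Timed.op (2 * n + 1)
        (if V.states.card ≤ U.states.card then some V else some U) : Timed _).val) (some W) =
        some V ∧ ∀ U ∈ W :: L, V.states.card ≤ U.states.card := by
    intro L
    induction L with
    | nil => intro W; exact ⟨W, by simp, rfl, by simp⟩
    | cons A L ih =>
      intro W
      simp only [List.foldl_cons, Timed.val_op]
      by_cases h : W.states.card ≤ A.states.card
      · rw [if_pos h]
        obtain ⟨V, hV, h1, h2⟩ := ih W
        refine ⟨V, ?_, h1, fun U hU => ?_⟩
        · rcases List.mem_cons.1 hV with rfl | hV <;> simp_all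
        · rcases List.mem_cons.1 hU with rfl | hU
          · exact h2 _ (by simp)
          · rcases List.mem_cons.1 hU with rfl | hU
            · exact (h2 W (by simp)).trans h
            · exact h2 U (by simp [hU])
      · rw [if_neg h]
        obtain ⟨V, hV, h1, h2⟩ := ih A
        refine ⟨V, by simp [hV], h1, fun U hU => ?_⟩
        rcases List.mem_cons.1 hU with rfl | hU
        · exact (h2 A (by simp)).trans (by omega)
        · exact h2 U hU
  rcases L with _ | ⟨W, L⟩
  · exact Or.inl ⟨rfl, rfl⟩
  · right
    obtain ⟨V, hV, h1, h2⟩ := key L W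
    exact ⟨V, hV, h1, h2⟩

/-- The algorithm returns the smallest partial subsystem that reaches the threshold in a list that
is sound and complete for the root block. -/
theorem treeAlgorithm_val (M : MDP (Fin n) (Fin m)) (Goal : Finset (Fin n)) (blk : Fin n → Fin k)
    (lam : ℚ) (hpart : IsDirectedTreePartition M.Edge blk) :
    ∃ (root : Fin k) (L : List (PartialSubsystem n)),
      (∀ b, ¬ QuotientEdge M.Edge blk b root) ∧
      Sound M Goal blk (graphData M blk).val root L ∧
      Complete M Goal blk (graphData M blk).val root L ∧
      (((treeAlgorithm M Goal blk lam).val = none ∧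
          ∀ U ∈ L, ¬ lam ≤ ∑ s, M.init s * U.val s) ∨
        ∃ V ∈ L, (treeAlgorithm M Goal blk lam).val = some V.states ∧
          lam ≤ ∑ s, M.init s * V.val s ∧
          ∀ U ∈ L, lam ≤ ∑ s, M.init s * U.val s → V.states.card ≤ U.states.card) := by
  have htree := hpart.2
  obtain ⟨root, hroot⟩ := htree.exists_root
  set g := (graphData M blk).val with hgdef
  have hg : g.Correct M blk := graphData_correct M blk
  have hrel : (fun b c => g.child b c = true) = QuotientEdge M.Edge blk := by
    funext b c; exact propext (hg.child b c)
  obtain ⟨ho1, ho2⟩ := reverseTopological_spec (child := g.child)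
    (by rw [hrel]; exact htree.not_transGen_self) k [] (fun l₁ b l₂ h => by simp at h) (by simp)
  set order := (reverseTopological g.child k []).val with horder
  obtain ⟨hS, hC⟩ := storedSubsystems_spec (Goal := Goal) hg htree ho1 root (ho2 root)
  set L := storedSubsystems M Goal blk g order root with hL
  refine ⟨root, L, hroot, hS, hC, ?_⟩
  have hroots : ∃ l, (List.finRange k).filter (fun b => !(List.finRange k).any
      fun c => g.child c b) = root :: l := by
    have hmem : ∀ b, b ∈ (List.finRange k).filter (fun b => !(List.finRange k).any
        fun c => g.child c b) ↔ b = root := by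
      intro b
      have h1 : b ∈ (List.finRange k).filter (fun b => !(List.finRange k).any
          fun c => g.child c b) ↔ ∀ c, ¬ QuotientEdge M.Edge blk c b := by
        simp [← hg.child]
      rw [h1]
      exact ⟨fun h => htree.eq_root hroot h, fun h => h ▸ hroot⟩
    rcases hl : (List.finRange k).filter (fun b => !(List.finRange k).any
      fun c => g.child c b) with _ | ⟨b, l⟩
    · have := (hmem root).2 rfl
      rw [hl] at this
      simp at this
    · have := (hmem b).1 (by rw [hl]; simp)
      exact ⟨l, by rw [this]⟩
  obtain ⟨l, hroots⟩ := hroots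
  have hval : (treeAlgorithm M Goal blk lam).val =
      ((L.filter fun U => decide (lam ≤ ∑ s, M.init s * U.val s)).foldl
        (fun (best : Option (PartialSubsystem n)) U => (match best with
      | none => Timed.op 1 (some U)
      | some V => Timed.op (2 * n + 1)
        (if V.states.card ≤ U.states.card then some V else some U) : Timed _).val) none).map
        PartialSubsystem.states := by
    simp only [treeAlgorithm, Timed.val_bind, Timed.val_foldL, Timed.val_tabulate,
      Timed.val_filterL, Timed.val_anyL, Timed.val_op]
    rw [← hgdef, hroots]
    simp only [Timed.val_bind, Timed.val_foldL, Timed.val_filterL, val_sumQ, val_mulQ, val_leQ,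
      sum_map_finRange, Timed.val_op]
    rfl
  rw [hval]
  rcases foldl_smallest_spec (L.filter fun U => decide (lam ≤ ∑ s, M.init s * U.val s)) with
    ⟨h1, h2⟩ | ⟨V, hV, h1, h2⟩
  · left
    rw [h2]
    refine ⟨rfl, fun U hU hle => ?_⟩
    have : U ∈ L.filter fun U => decide (lam ≤ ∑ s, M.init s * U.val s) := by simp [hU, hle]
    rw [h1] at this
    simp at this
  · right
    rw [h1]
    simp only [List.mem_filter, decide_eq_true_eq] at hV h2
    exact ⟨V, hV.1, rfl, hV.2, fun U hU hle => h2 U ⟨hU, hle⟩⟩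

/-- If the values in `T` reach the threshold, then so does a stored subsystem with at most as many
states, since the initial probabilities are a linear functional. -/
theorem exists_stored_of_le {lam : ℚ} (hg : g.Correct M blk)
    (hinit : ∀ s, 0 < M.init s → ∀ b, ¬ QuotientEdge M.Edge blk b (blk s)) {root : Fin k}
    (htree : IsDirectedTree (QuotientEdge M.Edge blk))
    (hroot : ∀ b, ¬ QuotientEdge M.Edge blk b root) {L : List (PartialSubsystem n)}
    (hC : Complete M Goal blk g root L) {T : Finset (Fin n)}
    (hT : (lam : ℝ) ≤ ∑ s, (M.init s : ℝ) * setValue M Goal T s) :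
    ∃ U ∈ L, U.states.card ≤ T.card ∧ lam ≤ ∑ s, M.init s * U.val s := by
  obtain ⟨w, hw, hle⟩ := hC T
  have hi : ∀ s, (0 : ℝ) ≤ M.init s := fun s => by exact_mod_cast M.init_nonneg s
  have h1 : (lam : ℝ) ≤ ∑ s, (M.init s : ℝ) * w s := by
    refine hT.trans (Finset.sum_le_sum fun s _ => ?_)
    rcases (M.init_nonneg s).lt_or_eq with hs | hs
    · have hb : blk s = root := htree.eq_root hroot (hinit s hs)
      have := hle s
      rw [interfaceValue_of M Goal blk g (by exact hb) ((hg.inc s).2 (Or.inl hs))] at this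
      exact mul_le_mul_of_nonneg_left this (hi s)
    · simp [← hs]
  by_contra hno
  push Not at hno
  have hconv : convexHull ℝ (levelPoints L (T ∩ subtreeStates M blk root).card) ⊆
      {w | ∑ s, (M.init s : ℝ) * w s < lam} := by
    refine convexHull_min ?_ ?_
    · rintro _ ⟨U, hU, hc, rfl⟩
      have := hno U hU (hc.trans (Finset.card_le_card Finset.inter_subset_left))
      simp only [Set.mem_ofPred_eq, realVec]
      exact_mod_cast this
    · refine convex_halfSpace_lt (f := fun w : Fin n → ℝ => ∑ s, (M.init s : ℝ) * w s)
        ⟨fun x y => ?_, fun c x => ?_⟩ _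
      · simp [mul_add, Finset.sum_add_distrib]
      · simp only [Pi.smul_apply, smul_eq_mul, Finset.mul_sum]
        exact Finset.sum_congr rfl fun s _ => by ring
  exact absurd h1 (not_le.2 (hconv hw))

/-- The threshold is compared with the value of the induced subsystem, since all initial states are
interface states of the root block. -/
theorem isWitness_of_le {lam : ℚ} (hg : g.Correct M blk)
    (hinit : ∀ s, 0 < M.init s → ∀ b, ¬ QuotientEdge M.Edge blk b (blk s)) {root : Fin k}
    (htree : IsDirectedTree (QuotientEdge M.Edge blk))
    (hroot : ∀ b, ¬ QuotientEdge M.Edge blk b root) {L : List (PartialSubsystem n)}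
    (hS : Sound M Goal blk g root L) {V : PartialSubsystem n} (hV : V ∈ L)
    (hle : lam ≤ ∑ s, M.init s * V.val s) : IsWitness (M.induced V.states) Goal lam := by
  refine le_trans ?_ (setValue_le_prMax_induced M Goal V.states)
  have h1 : (lam : ℝ) ≤ ∑ s, (M.init s : ℝ) * realVec V.val s := by
    simp only [realVec]
    exact_mod_cast hle
  refine h1.trans (le_of_eq (Finset.sum_congr rfl fun s _ => ?_))
  rcases (M.init_nonneg s).lt_or_eq with hs | hs
  · have hb : blk s = root := htree.eq_root hroot (hinit s hs)
    rw [(hS V hV).2, interfaceValue_of M Goal blk g (by exact hb) ((hg.inc s).2 (Or.inl hs))]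
  · simp [← hs]

/-- If a subset is returned it is a minimal witness, and otherwise there is none. -/
theorem treeAlgorithm_correct (M : MDP (Fin n) (Fin m)) (Goal : Finset (Fin n))
    (blk : Fin n → Fin k) (lam : ℚ) (hpart : IsDirectedTreePartition M.Edge blk)
    (hinit : ∀ s, 0 < M.init s → ∀ b, ¬ QuotientEdge M.Edge blk b (blk s)) :
    (∀ S' : Finset (Fin n), (treeAlgorithm M Goal blk lam).val = some S' →
      IsMinimalWitness M Goal lam S') ∧
    ((treeAlgorithm M Goal blk lam).val = none →
      ∀ (T : Finset (Fin n)) (M' : MDP {s // s ∈ T} (Fin m)),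
        IsSubsystem M M' → ¬ IsWitness M' Goal lam) := by
  obtain ⟨root, L, hroot, hS, hC, hval⟩ := treeAlgorithm_val M Goal blk lam hpart
  have hg := graphData_correct M blk
  have hsub : ∀ (T : Finset (Fin n)) (M' : MDP {s // s ∈ T} (Fin m)), IsSubsystem M M' →
      IsWitness M' Goal lam → ∃ U ∈ L, U.states.card ≤ T.card ∧ lam ≤ ∑ s, M.init s * U.val s :=
    fun T M' hM' hw => exists_stored_of_le hg hinit hpart.2 hroot hC
      (le_trans hw (prMax_le_setValue M Goal hM'))
  refine ⟨fun S' hS' => ?_, fun hnone T M' hM' hw => ?_⟩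
  · rcases hval with ⟨h1, -⟩ | ⟨V, hV, h1, h2, h3⟩
    · rw [h1] at hS'
      simp at hS'
    · rw [h1, Option.some.injEq] at hS'
      subst hS'
      refine ⟨isWitness_of_le hg hinit hpart.2 hroot hS hV h2, fun T M' hM' hw => ?_⟩
      obtain ⟨U, hU, hc, hle⟩ := hsub T M' hM' hw
      exact (h3 U hU hle).trans hc
  · rcases hval with ⟨-, h2⟩ | ⟨V, -, h1, -⟩
    · obtain ⟨U, hU, -, hle⟩ := hsub T M' hM' hw
      exact h2 U hU hle
    · rw [h1] at hnone
      simp at hnone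

end Blocks

/-! ### Step counts of the combinators -/

section TimedTimes

open Timed

variable {α β : Type}

namespace Timed

@[simp] theorem time_bind (x : Timed α) (f : α → Timed β) :
    (x >>= f).time = x.time + (f x.val).time := rfl
@[simp] theorem time_op (c : ℕ) (a : α) : (op c a).time = c := rfl
@[simp] theorem time_append (l r : List α) : (append l r).time = l.length + 1 := rfl

/-- A bound for a loop of at most `L` rounds of at most `t` steps. -/
def loopTime (L t : ℕ) : ℕ := L * (t + 1) + 1

theorem le_loopTime {l L t : ℕ} (h : l ≤ L) : l * (t + 1) + 1 ≤ loopTime L t := by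
  unfold loopTime; gcongr

theorem loopTime_mono {L L' t t' : ℕ} (hL : L ≤ L') (ht : t ≤ t') :
    loopTime L t ≤ loopTime L' t' := by
  unfold loopTime; gcongr

variable {l : List α} {L t : ℕ}

theorem time_mapL_le {f : α → Timed β} (hl : l.length ≤ L) (h : ∀ a ∈ l, (f a).time ≤ t) :
    (mapL f l).time ≤ loopTime L t := by
  refine le_trans ?_ (le_loopTime hl)
  clear hl
  induction l with
  | nil => simp [mapL]
  | cons a l ih =>
    have h1 := ih fun b hb => h b (by simp [hb])
    have h2 := h a (by simp)
    simp only [mapL, time_bind, time_op, List.length_cons, Nat.succ_mul]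
    omega

theorem time_flatMapL_le {f : α → Timed (List β)} {w : ℕ} (hl : l.length ≤ L)
    (h : ∀ a ∈ l, (f a).time ≤ t) (hw : ∀ a ∈ l, (f a).val.length ≤ w) :
    (flatMapL f l).time ≤ loopTime L (t + w) := by
  refine le_trans ?_ (le_loopTime hl)
  clear hl
  induction l with
  | nil => simp [flatMapL]
  | cons a l ih =>
    have h1 := ih (fun b hb => h b (by simp [hb])) (fun b hb => hw b (by simp [hb]))
    have h2 := h a (by simp)
    have h3 := hw a (by simp)
    simp only [flatMapL, time_bind, time_append, List.length_cons, Nat.succ_mul]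
    omega

theorem time_filterL_le {p : α → Timed Bool} (hl : l.length ≤ L) (h : ∀ a ∈ l, (p a).time ≤ t) :
    (filterL p l).time ≤ loopTime L t := by
  refine le_trans ?_ (le_loopTime hl)
  clear hl
  induction l with
  | nil => simp [filterL]
  | cons a l ih =>
    have h1 := ih fun b hb => h b (by simp [hb])
    have h2 := h a (by simp)
    simp only [filterL, time_bind, time_op, List.length_cons, Nat.succ_mul]
    omega

theorem time_anyL_le {p : α → Timed Bool} (hl : l.length ≤ L) (h : ∀ a ∈ l, (p a).time ≤ t) :
    (anyL p l).time ≤ loopTime L t := by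
  refine le_trans ?_ (le_loopTime hl)
  clear hl
  induction l with
  | nil => simp [anyL]
  | cons a l ih =>
    have h1 := ih fun b hb => h b (by simp [hb])
    have h2 := h a (by simp)
    simp only [anyL, time_bind, time_op, List.length_cons, Nat.succ_mul]
    omega

theorem time_allL_le {p : α → Timed Bool} (hl : l.length ≤ L) (h : ∀ a ∈ l, (p a).time ≤ t) :
    (allL p l).time ≤ loopTime L t := by
  refine le_trans ?_ (le_loopTime hl)
  clear hl
  induction l with
  | nil => simp [allL]
  | cons a l ih =>
    have h1 := ih fun b hb => h b (by simp [hb])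
    have h2 := h a (by simp)
    simp only [allL, time_bind, time_op, List.length_cons, Nat.succ_mul]
    omega

/-- The loop invariant `I` may depend on the number of the rounds that are done. -/
theorem foldL_induction {f : β → α → Timed β} (I : ℕ → β → Prop) {x : β} (hx : I 0 x)
    (hl : l.length ≤ L) (h : ∀ j y a, j < l.length → a ∈ l → I j y →
      (f y a).time ≤ t ∧ I (j + 1) (f y a).val) :
    (foldL f x l).time ≤ loopTime L t ∧ I l.length (foldL f x l).val := by
  suffices H : ∀ (l' : List α) (i : ℕ) (y : β), i + l'.length = l.length → (∀ a ∈ l', a ∈ l) →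
      I i y → (foldL f y l').time ≤ l'.length * (t + 1) + 1 ∧ I l.length (foldL f y l').val by
    obtain ⟨h1, h2⟩ := H l 0 x (by simp) (fun _ h => h) hx
    exact ⟨h1.trans (le_loopTime hl), h2⟩
  intro l'
  induction l' with
  | nil =>
    intro i y hi _ hy
    simp only [List.length_nil, add_zero] at hi
    subst hi
    exact ⟨by simp [foldL], hy⟩
  | cons a l' ih =>
    intro i y hi hmem hy
    simp only [List.length_cons] at hi
    obtain ⟨h1, h2⟩ := h i y a (by omega) (hmem a (by simp)) hy
    obtain ⟨h3, h4⟩ := ih (i + 1) _ (by omega) (fun b hb => hmem b (by simp [hb])) h2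
    refine ⟨?_, h4⟩
    simp only [foldL, time_bind, time_op, List.length_cons, Nat.succ_mul]
    omega

theorem length_toList (ι : Type) [FinEnum ι] : (FinEnum.toList ι).length = FinEnum.card ι := by
  simp [FinEnum.toList]

theorem time_tabulate_le {ι : Type} [FinEnum ι] {f : ι → Timed β} (hl : FinEnum.card ι ≤ L)
    (h : ∀ i, (f i).time ≤ t) : (tabulate f).time ≤ loopTime L t := by
  rw [← length_toList] at hl
  refine le_trans ?_ (le_loopTime hl)
  clear hl
  simp only [tabulate, add_le_add_iff_right]
  generalize FinEnum.toList ι = l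
  induction l with
  | nil => simp
  | cons a l ih =>
    have h2 := h a
    simp only [List.map_cons, List.sum_cons, List.length_cons, Nat.succ_mul]
    omega

end Timed

end TimedTimes

/-! ### Bit lengths of rational numbers -/

section Bits

/-- Numerator and denominator of `q` have at most `β` bits. -/
def BitBound (β : ℕ) (q : ℚ) : Prop := q.num.natAbs < 2 ^ β ∧ q.den < 2 ^ β

/-- A bound for the cost of one arithmetic operation on numbers of `β` bits. -/
def arithCost (β : ℕ) : ℕ := (4 * β + 1) ^ 2

variable {β γ : ℕ} {a b : ℚ}

theorem BitBound.mono (h : BitBound β a) (hβ : β ≤ γ) : BitBound γ a :=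
  have := Nat.pow_le_pow_right (n := 2) (by norm_num) hβ
  ⟨h.1.trans_le this, h.2.trans_le this⟩

theorem BitBound.one_le (h : BitBound β a) : 1 ≤ β := by
  by_contra hβ
  obtain rfl : β = 0 := by omega
  have := h.2
  have := a.den_pos
  omega

theorem bitBound_of_ratBits_le (h : ratBits a ≤ β) : BitBound β a := by
  unfold ratBits at h
  exact ⟨Nat.size_le.1 (by omega), Nat.size_le.1 (by omega)⟩

theorem BitBound.ratCost_le (ha : BitBound β a) (hb : BitBound β b) :
    ratCost a b ≤ arithCost β := by
  have h1 := Nat.size_le.2 ha.1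
  have h2 := Nat.size_le.2 ha.2
  have h3 := Nat.size_le.2 hb.1
  have h4 := Nat.size_le.2 hb.2
  unfold ratCost arithCost ratBits
  exact Nat.pow_le_pow_left (by omega) 2

theorem bitBound_zero : BitBound 1 0 := by simp [BitBound]
theorem bitBound_one : BitBound 1 1 := by simp [BitBound]

theorem bitBound_div_int {x : ℤ} {y : ℕ} (hy : 0 < y) (hx : x.natAbs < 2 ^ β) (hy' : y < 2 ^ β) :
    BitBound β (x / y) := by
  have h : (x / y : ℚ) = Rat.divInt x y := by rw [Rat.divInt_eq_div]; simp
  rw [h]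
  have h1 : (Rat.divInt x y).num ∣ x := Rat.num_dvd x (by positivity)
  have h2 : ((Rat.divInt x y).den : ℤ) ∣ y := Rat.den_dvd x y
  refine ⟨?_, lt_of_le_of_lt (Nat.le_of_dvd hy (Int.natCast_dvd_natCast.1 h2)) hy'⟩
  rcases eq_or_ne x 0 with rfl | hx0
  · simp
  · exact lt_of_le_of_lt (Nat.le_of_dvd (Int.natAbs_pos.2 hx0) (Int.natAbs_dvd_natAbs.2 h1)) hx

theorem BitBound.mul (ha : BitBound β a) (hb : BitBound γ b) : BitBound (β + γ) (a * b) := by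
  have h : a * b = ((a.num * b.num : ℤ) : ℚ) / ((a.den * b.den : ℕ) : ℚ) := by
    conv_lhs => rw [← Rat.num_div_den a, ← Rat.num_div_den b]
    push_cast
    rw [div_mul_div_comm]
  rw [h]
  refine bitBound_div_int (Nat.mul_pos a.den_pos b.den_pos) ?_ ?_
  · rw [Int.natAbs_mul, pow_add]
    exact Nat.mul_lt_mul'' ha.1 hb.1
  · rw [pow_add]
    exact Nat.mul_lt_mul'' ha.2 hb.2

theorem BitBound.neg (ha : BitBound β a) : BitBound β (-a) := by
  simpa [BitBound] using ha

theorem bitBound_neg_one : BitBound 1 (-1) := bitBound_one.neg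

theorem add_eq_div_int (a b : ℚ) : a + b =
    ((a.num * b.den + b.num * a.den : ℤ) : ℚ) / ((a.den * b.den : ℕ) : ℚ) := by
  have ha : (a.den : ℚ) ≠ 0 := by exact_mod_cast a.den_pos.ne'
  have hb : (b.den : ℚ) ≠ 0 := by exact_mod_cast b.den_pos.ne'
  conv_lhs => rw [← Rat.num_div_den a, ← Rat.num_div_den b]
  push_cast
  rw [div_add_div _ _ ha hb]
  ring

theorem BitBound.add (ha : BitBound β a) (hb : BitBound γ b) : BitBound (β + γ + 1) (a + b) := by
  rw [add_eq_div_int]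
  refine bitBound_div_int (Nat.mul_pos a.den_pos b.den_pos) ?_ ?_
  · refine lt_of_le_of_lt (Int.natAbs_add_le _ _) ?_
    rw [Int.natAbs_mul, Int.natAbs_mul, Int.natAbs_natCast, Int.natAbs_natCast, pow_succ, pow_add]
    have h1 := Nat.mul_lt_mul'' ha.1 hb.2
    have h2 := Nat.mul_lt_mul'' hb.1 ha.2
    rw [mul_comm (2 ^ γ)] at h2
    omega
  · refine lt_of_lt_of_le (Nat.mul_lt_mul'' ha.2 hb.2) ?_
    rw [← pow_add]
    exact Nat.pow_le_pow_right (by norm_num) (by omega)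

theorem BitBound.sub (ha : BitBound β a) (hb : BitBound γ b) : BitBound (β + γ + 1) (a - b) := by
  rw [sub_eq_add_neg]
  exact ha.add hb.neg

theorem BitBound.inv (ha : BitBound β a) : BitBound β a⁻¹ := by
  rcases eq_or_ne a 0 with rfl | h0
  · simpa using ha
  · refine ⟨?_, ?_⟩
    · rw [Rat.num_inv, Int.natAbs_mul, Int.natAbs_natCast]
      have h1 : a.num.sign.natAbs = 1 := Int.natAbs_sign_of_ne_zero (Rat.num_ne_zero.2 h0)
      rw [h1, one_mul]
      exact ha.2
    · rw [Rat.den_inv_of_ne_zero h0]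
      exact ha.1

theorem BitBound.div (ha : BitBound β a) (hb : BitBound γ b) : BitBound (β + γ) (a / b) := by
  rw [div_eq_mul_inv]
  exact ha.mul hb.inv

/-- The bits of a sum of many terms grow linearly: the denominator divides the product of the
denominators. -/
theorem bitBound_list_sum {l : List ℚ} (h : ∀ q ∈ l, BitBound β q) :
    BitBound ((β + 1) * l.length + 1) l.sum := by
  have key : l.sum.num.natAbs ≤ l.length * 2 ^ (β * l.length) ∧
      l.sum.den ≤ 2 ^ (β * l.length) := by
    induction l with
    | nil => simp
    | cons q l ih =>
      obtain ⟨h1, h2⟩ := ih fun x hx => h x (by simp [hx])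
      have hq := h q (by simp)
      have hmul : 2 ^ β * 2 ^ (β * l.length) = 2 ^ (β * (l.length + 1)) := by
        rw [← pow_add]; ring_nf
      rw [List.sum_cons, add_eq_div_int, List.length_cons, ← hmul]
      have hd : 0 < q.den * l.sum.den := Nat.mul_pos q.den_pos l.sum.den_pos
      generalize hx : q.num * (l.sum.den : ℤ) + l.sum.num * (q.den : ℤ) = x
      have hdiv : (x / (q.den * l.sum.den : ℕ) : ℚ) = Rat.divInt x (q.den * l.sum.den : ℕ) := by
        rw [Rat.divInt_eq_div]; simp
      rw [hdiv]
      constructor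
      · have hle : (Rat.divInt x (q.den * l.sum.den : ℕ)).num.natAbs ≤ x.natAbs := by
          rcases eq_or_ne x 0 with rfl | hx0
          · simp
          · exact Nat.le_of_dvd (Int.natAbs_pos.2 hx0)
              (Int.natAbs_dvd_natAbs.2 (Rat.num_dvd x (by exact_mod_cast hd.ne')))
        refine hle.trans ?_
        rw [← hx]
        refine (Int.natAbs_add_le _ _).trans ?_
        rw [Int.natAbs_mul, Int.natAbs_mul, Int.natAbs_natCast, Int.natAbs_natCast]
        have h3 := Nat.mul_le_mul hq.1.le h2
        have h4 := Nat.mul_le_mul h1 hq.2.le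
        calc _ ≤ 2 ^ β * 2 ^ (β * l.length) + l.length * 2 ^ (β * l.length) * 2 ^ β :=
              add_le_add h3 h4
          _ = _ := by ring
      · exact (Nat.le_of_dvd hd (Int.natCast_dvd_natCast.1 (Rat.den_dvd x _))).trans
          (Nat.mul_le_mul hq.2.le h2)
  have hlt : l.length < 2 ^ l.length := Nat.lt_two_pow_self
  have hpow : 2 ^ ((β + 1) * l.length + 1) = 2 * (2 ^ l.length * 2 ^ (β * l.length)) := by
    rw [← pow_add, pow_succ, mul_comm]; ring_nf
  have hpos : 0 < 2 ^ (β * l.length) := by positivity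
  constructor
  · rw [hpow]
    calc _ ≤ _ := key.1
      _ ≤ 2 ^ l.length * 2 ^ (β * l.length) := Nat.mul_le_mul_right _ hlt.le
      _ < _ := by have : 0 < 2 ^ l.length * 2 ^ (β * l.length) := by positivity
                  omega
  · rw [hpow]
    calc _ ≤ _ := key.2
      _ ≤ 2 ^ l.length * 2 ^ (β * l.length) := Nat.le_mul_of_pos_left _ (by positivity)
      _ < _ := by have : 0 < 2 ^ l.length * 2 ^ (β * l.length) := by positivity
                  omega

theorem time_addQ_le (ha : BitBound β a) (hb : BitBound β b) : (addQ a b).time ≤ arithCost β :=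
  ha.ratCost_le hb
theorem time_subQ_le (ha : BitBound β a) (hb : BitBound β b) : (subQ a b).time ≤ arithCost β :=
  ha.ratCost_le hb
theorem time_mulQ_le (ha : BitBound β a) (hb : BitBound β b) : (mulQ a b).time ≤ arithCost β :=
  ha.ratCost_le hb
theorem time_divQ_le (ha : BitBound β a) (hb : BitBound β b) : (divQ a b).time ≤ arithCost β :=
  ha.ratCost_le hb
theorem time_leQ_le (ha : BitBound β a) (hb : BitBound β b) : (leQ a b).time ≤ arithCost β :=
  ha.ratCost_le hb
theorem time_eqQ_le (ha : BitBound β a) (hb : BitBound β b) : (eqQ a b).time ≤ arithCost β :=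
  ha.ratCost_le hb

/-- The number of bits of a sum of at most `L` numbers of `β` bits. -/
def sumBits (L β : ℕ) : ℕ := (β + 1) * (L + 1) + 1

theorem le_sumBits (L β : ℕ) : β ≤ sumBits L β := by
  unfold sumBits; nlinarith [Nat.zero_le (β * L)]

theorem bitBound_sumQ {ι : Type} {f : ι → Timed ℚ} {l : List ι} {L : ℕ} (hl : l.length ≤ L)
    (h : ∀ i ∈ l, BitBound β (f i).val) : BitBound (sumBits L β) (sumQ f l).val := by
  rw [val_sumQ]
  refine (bitBound_list_sum (β := β) (by
    intro q hq
    obtain ⟨i, hi, rfl⟩ := List.mem_map.1 hq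
    exact h i hi)).mono ?_
  unfold sumBits
  rw [List.length_map]
  gcongr
  omega

theorem time_sumQ_le {ι : Type} {f : ι → Timed ℚ} {l : List ι} {L t : ℕ} (hl : l.length ≤ L)
    (h : ∀ i ∈ l, BitBound β (f i).val) (ht : ∀ i ∈ l, (f i).time ≤ t) :
    (sumQ f l).time ≤ Timed.loopTime L (t + arithCost (sumBits L β)) := by
  suffices H : (sumQ f l).time ≤ l.length * (t + arithCost (sumBits L β) + 1) + 1 from
    H.trans (Timed.le_loopTime hl)
  induction l with
  | nil => simp [sumQ]
  | cons a l ih =>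
    have hl' : l.length ≤ L := by simp only [List.length_cons] at hl; omega
    have h1 := ih hl' (fun b hb => h b (by simp [hb])) (fun b hb => ht b (by simp [hb]))
    have h2 := ht a (by simp)
    have h3 := time_addQ_le ((h a (by simp)).mono (le_sumBits L β))
      (bitBound_sumQ hl' fun b hb => h b (by simp [hb]))
    simp only [sumQ, Timed.time_bind, List.length_cons, Nat.succ_mul]
    omega

end Bits

/-! ### Step counts of the linear programs -/

section LinearProgramTimes

open Timed

variable {ρ ι : Type} [FinEnum ρ] [FinEnum ι]

theorem card_option (ι : Type) [FinEnum ι] : FinEnum.card (Option ι) = FinEnum.card ι + 1 := rfl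

/-- All entries of the system have at most `β` bits. -/
def TableauBits (β : ℕ) (T : ρ → Option ι → ℚ) : Prop := ∀ i l, BitBound β (T i l)

/-- A bound for the time of a pivot in a system of `r` rows and `c` columns. -/
def pivotTime (r c β : ℕ) : ℕ :=
  loopTime (c + 1) (arithCost β) + loopTime r (loopTime (c + 1) (1 + 2 * arithCost (3 * β)))

variable {r c β : ℕ} {T : ρ → Option ι → ℚ}

omit [FinEnum ι] [FinEnum ρ] in
theorem TableauBits.mono (hT : TableauBits β T) {γ : ℕ} (h : β ≤ γ) : TableauBits γ T :=
  fun i l => (hT i l).mono h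

/-- Numerators and denominators grow by a constant factor in each pivot. -/
theorem TableauBits.pivot (hT : TableauBits β T) (i : ρ) (j : ι) :
    TableauBits (5 * β) (pivot T i j).val := by
  intro i' l
  have h1 := (hT i' l).one_le
  rw [val_pivot]
  dsimp only
  split_ifs
  · exact ((hT i l).div (hT i (some j))).mono (by omega)
  · exact ((hT i' l).sub ((hT i' (some j)).mul ((hT i l).div (hT i (some j))))).mono (by omega)

theorem time_pivot_le (hr : FinEnum.card ρ ≤ r) (hc : FinEnum.card ι ≤ c) (hT : TableauBits β T)
    (i : ρ) (j : ι) : (pivot T i j).time ≤ pivotTime r c β := by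
  have hc' : FinEnum.card (Option ι) ≤ c + 1 := by rw [card_option]; omega
  simp only [pivot, time_bind]
  refine add_le_add (time_tabulate_le hc' fun l => time_divQ_le (hT i l) (hT i (some j)))
    (time_tabulate_le hr fun i' => time_tabulate_le hc' fun l => ?_)
  split_ifs
  · simp
  · simp only [time_bind, val_tabulate, val_divQ, val_mulQ]
    have hβ := (hT i l).one_le
    have hrow : BitBound (2 * β) (T i l / T i (some j)) :=
      ((hT i l).div (hT i (some j))).mono (by omega)
    have h1 := time_mulQ_le (β := 3 * β) ((hT i' (some j)).mono (by omega))
      (hrow.mono (by omega))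
    have h2 := time_subQ_le (β := 3 * β) ((hT i' l).mono (by omega))
      (((hT i' (some j)).mul hrow).mono (by omega))
    omega

/-- A bound for the cost of one step of the enumeration that is not a recursive call. -/
def branchTime (r c β : ℕ) : ℕ :=
  loopTime c 1 + arithCost β + pivotTime r c β + (c + 1) ^ r + 5

/-- A bound for the time of the enumeration of the basic solutions. -/
def basicTime (r c β : ℕ) : ℕ := (c + 2) ^ r * (2 * branchTime r c β)

omit [FinEnum ι] in
theorem length_flatMap_le {α β : Type} (l : List α) (f : α → List β) (w : ℕ)
    (h : ∀ a ∈ l, (f a).length ≤ w) : (l.flatMap f).length ≤ l.length * w := by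
  induction l with
  | nil => simp
  | cons a l ih =>
    have h1 := ih fun b hb => h b (by simp [hb])
    have h2 := h a (by simp)
    simp only [List.flatMap_cons, List.length_append, List.length_cons, Nat.succ_mul]
    omega

/-- The basic solutions for which row `i` is a pivot row with column `j`. -/
def solutionsWithPivot (l : List ρ) (T : ρ → Option ι → ℚ) (basis : ι → Option ρ) (i : ρ) (j : ι) :
    Timed (List (ι → ℚ)) := do
  let z ← eqQ (T i (some j)) 0
  if z then op 1 []
  else do
    let T' ← pivot T i j
    let basis' ← tabulate (fun j' => op 1 (if j' = j then some i else basis j'))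
    basicSolutions l T' basis'

theorem basicSolutions_cons (i : ρ) (l : List ρ) (T : ρ → Option ι → ℚ) (basis : ι → Option ρ) :
    basicSolutions (i :: l) T basis = (do
      let skipped ← basicSolutions l T basis
      let used ← flatMapL (solutionsWithPivot l T basis i) (FinEnum.toList ι)
      append skipped used) := rfl

theorem val_solutionsWithPivot (l : List ρ) (T : ρ → Option ι → ℚ) (basis : ι → Option ρ) (i : ρ)
    (j : ι) : (solutionsWithPivot l T basis i j).val = if T i (some j) = 0 then [] else
      (basicSolutions l (pivot T i j).val fun j' => if j' = j then some i else basis j').val := by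
  simp only [solutionsWithPivot, val_bind, val_eqQ]
  by_cases h : T i (some j) = 0
  · simp [h]
  · simp [h]

theorem time_solutionsWithPivot_le (hr : FinEnum.card ρ ≤ r) (hc : FinEnum.card ι ≤ c)
    (l : List ρ) (hT : TableauBits β T) (basis : ι → Option ρ) (i : ρ) (j : ι) (t : ℕ)
    (ht : (basicSolutions l (pivot T i j).val
      fun j' => if j' = j then some i else basis j').time ≤ t) :
    (solutionsWithPivot l T basis i j).time ≤
      arithCost β + (pivotTime r c β + loopTime c 1 + t + 1) := by
  simp only [solutionsWithPivot, time_bind, val_eqQ]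
  refine add_le_add (time_eqQ_le (hT i (some j)) (bitBound_zero.mono (hT i (some j)).one_le)) ?_
  by_cases h : T i (some j) = 0
  · simp [h]
  · simp only [h, decide_false, Bool.false_eq_true, if_false, time_bind]
    have h1 := time_pivot_le hr hc hT i j
    have h2 := time_tabulate_le (L := c) (t := 1) hc
      (f := fun j' => op 1 (if j' = j then some i else basis j')) fun _ => by simp
    simp only [val_tabulate, val_op]
    omega

theorem length_basicSolutions_le (hc : FinEnum.card ι ≤ c) (l : List ρ) (T : ρ → Option ι → ℚ)
    (basis : ι → Option ρ) : (basicSolutions l T basis).val.length ≤ (c + 1) ^ l.length := by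
  induction l generalizing T basis with
  | nil => simp [basicSolutions]
  | cons i l ih =>
    simp only [basicSolutions_cons, val_bind, val_append, List.length_append, val_flatMapL]
    have h1 := ih T basis
    have h2 := length_flatMap_le (FinEnum.toList ι)
      (fun j => (solutionsWithPivot l T basis i j).val) ((c + 1) ^ l.length) (by
      intro j _
      rw [val_solutionsWithPivot]
      split_ifs
      · simp
      · exact ih _ _)
    rw [length_toList] at h2
    refine (add_le_add h1 h2).trans ?_
    rw [List.length_cons, pow_succ]
    nlinarith [Nat.mul_le_mul_right ((c + 1) ^ l.length) hc]

/-- The entries grow by a factor of `5` per row of the list. -/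
theorem bits_basicSolutions {B : ℕ} (l : List ρ) (T : ρ → Option ι → ℚ) (basis : ι → Option ρ)
    (hT : TableauBits β T) (hβ : 1 ≤ β) (hB : 5 ^ l.length * β ≤ B) :
    ∀ y ∈ (basicSolutions l T basis).val, ∀ j, BitBound B (y j) := by
  induction l generalizing T basis β with
  | nil =>
    simp only [List.length_nil, pow_zero, one_mul] at hB
    simp only [basicSolutions, val_bind, val_tabulate, val_op, List.mem_singleton,
      forall_eq]
    intro j
    rcases basis j with _ | i
    · exact bitBound_zero.mono (hβ.trans hB)
    · exact (hT i none).mono hB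
  | cons i l ih =>
    rw [List.length_cons, pow_succ, mul_assoc] at hB
    intro y hy
    simp only [basicSolutions_cons, val_bind, val_append, List.mem_append, val_flatMapL,
      List.mem_flatMap] at hy
    rcases hy with hy | ⟨j, -, hy⟩
    · exact ih T basis hT hβ (le_trans (Nat.mul_le_mul_left _ (by omega)) hB) y hy
    · rw [val_solutionsWithPivot] at hy
      split_ifs at hy
      · simp at hy
      · exact ih _ _ (hT.pivot i j) (by omega) hB y hy

/-- Each row branches into at most `c + 1` recursive calls. The summand `branchTime` on the left
makes the induction go through: it pays for what is done outside of the calls. -/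
theorem time_basicSolutions_le {B : ℕ} (hr : FinEnum.card ρ ≤ r) (hc : FinEnum.card ι ≤ c)
    (l : List ρ) (T : ρ → Option ι → ℚ) (basis : ι → Option ρ) (hT : TableauBits β T)
    (hβ : 1 ≤ β) (hB : 5 ^ l.length * β ≤ B) (hl : l.length ≤ r) :
    (basicSolutions l T basis).time + branchTime r c B ≤
      (c + 2) ^ l.length * (2 * branchTime r c B) := by
  induction l generalizing T basis β with
  | nil =>
    simp only [basicSolutions, time_bind, time_op, List.length_nil, pow_zero, one_mul]
    rw [two_mul, add_le_add_iff_right]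
    refine (Nat.add_le_add_right (time_tabulate_le hc (t := 1) fun _ => by simp) 1).trans ?_
    unfold branchTime
    omega
  | cons i l ih =>
    rw [List.length_cons] at hl
    rw [List.length_cons, pow_succ, mul_assoc] at hB
    have hβB : β ≤ B := le_trans (by nlinarith [Nat.one_le_pow l.length 5 (by norm_num)]) hB
    have hB' : 5 ^ l.length * β ≤ B := le_trans (Nat.mul_le_mul_left _ (by omega)) hB
    have h1 := ih T basis hT hβ hB' (by omega)
    have hlen := length_basicSolutions_le hc l T basis
    have hpow : (c + 1) ^ l.length ≤ (c + 1) ^ r := Nat.pow_le_pow_right (by omega) (by omega)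
    have hle : branchTime r c B ≤ (c + 2) ^ l.length * (2 * branchTime r c B) := by
      have := Nat.one_le_pow l.length (c + 2) (by omega)
      nlinarith
    obtain ⟨t, ht⟩ := Nat.exists_eq_add_of_le' hle
    have hflat := time_flatMapL_le (L := c) (l := FinEnum.toList ι) (w := (c + 1) ^ r)
      (t := arithCost B + (pivotTime r c B + loopTime c 1 + t + 1))
      (f := solutionsWithPivot l T basis i) (by rw [length_toList]; exact hc) (by
        intro j _
        refine time_solutionsWithPivot_le hr hc l (hT.mono hβB) basis i j t ?_
        have h5 := ih (pivot T i j).val (fun j' => if j' = j then some i else basis j')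
            (hT.pivot i j) (by omega) hB (by omega)
        omega) (by
        intro j _
        rw [val_solutionsWithPivot]
        split_ifs
        · simp
        · exact (length_basicSolutions_le hc l _ _).trans hpow)
    simp only [basicSolutions_cons, time_bind, time_append]
    have hflat' : loopTime c (arithCost B + (pivotTime r c B + loopTime c 1 + t + 1) +
        (c + 1) ^ r) ≤ c * (t + branchTime r c B) + 1 := by
      have hstep : arithCost B + (pivotTime r c B + loopTime c 1 + t + 1) + (c + 1) ^ r + 1 ≤
          t + branchTime r c B := by unfold branchTime; omega
      exact Nat.add_le_add_right (Nat.mul_le_mul_left c hstep) 1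
    have hbr : (c + 1) ^ r + 5 ≤ branchTime r c B := by unfold branchTime; omega
    have hfin : (c + 2) ^ (l.length + 1) * (2 * branchTime r c B) =
        c * (t + branchTime r c B) + 2 * (t + branchTime r c B) := by
      rw [← ht, pow_succ]; ring
    rw [List.length_cons, hfin]
    omega

/-- The bits that suffice for all numbers in the test of feasibility. -/
def feasibleBits (c β γ : ℕ) : ℕ := sumBits c (β + γ)

/-- A bound for the time of the test of feasibility. -/
def feasibleTime (r c β γ : ℕ) : ℕ :=
  loopTime c (arithCost (β + γ)) + loopTime r (loopTime c
    (arithCost (β + γ) + arithCost (feasibleBits c β γ)) + arithCost (feasibleBits c β γ)) + 1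

theorem time_isFeasible_le {γ : ℕ} (hr : FinEnum.card ρ ≤ r) (hc : FinEnum.card ι ≤ c)
    (hT : TableauBits β T) {y : ι → ℚ} (hβ : 1 ≤ β) (hy : ∀ j, BitBound γ (y j)) :
    (isFeasible T y).time ≤ feasibleTime r c β γ := by
  rw [← length_toList] at hr hc
  simp only [isFeasible, time_bind, time_op]
  unfold feasibleTime
  rw [add_assoc]
  refine add_le_add (time_allL_le hc fun j _ => time_leQ_le (bitBound_zero.mono (by omega))
    ((hy j).mono (by omega))) (add_le_add (time_allL_le hr fun i _ => ?_) le_rfl)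
  refine add_le_add (time_sumQ_le hc (fun j _ => (hT i (some j)).mul (hy j))
    fun j _ => time_mulQ_le ((hT i (some j)).mono (by omega)) ((hy j).mono (by omega)))
    (time_eqQ_le (bitBound_sumQ hc fun j _ => (hT i (some j)).mul (hy j))
      ((hT i none).mono ?_))
  exact le_trans (by omega) (le_sumBits c (β + γ))

/-- The bits of a basic solution of a system with `r` rows and entries of `β` bits. -/
def solutionBits (r β : ℕ) : ℕ := 5 ^ r * β

/-- A bound for the time of the enumeration of the basic feasible solutions. -/
def basicFeasibleTime (r c β : ℕ) : ℕ :=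
  loopTime c 1 + basicTime r c (solutionBits r β) +
    loopTime ((c + 1) ^ r) (feasibleTime r c β (solutionBits r β))

theorem basicFeasible_bound (hr : FinEnum.card ρ ≤ r) (hc : FinEnum.card ι ≤ c)
    (hT : TableauBits β T) (hβ : 1 ≤ β) :
    (basicFeasible T).time ≤ basicFeasibleTime r c β ∧
      (basicFeasible T).val.length ≤ (c + 1) ^ r ∧
      ∀ y ∈ (basicFeasible T).val, ∀ j, BitBound (solutionBits r β) (y j) := by
  have hl : (FinEnum.toList ρ).length ≤ r := by rw [length_toList]; exact hr
  have hB : 5 ^ (FinEnum.toList ρ).length * β ≤ solutionBits r β :=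
    Nat.mul_le_mul_right _ (Nat.pow_le_pow_right (by norm_num) hl)
  have hlen : (basicSolutions (FinEnum.toList ρ) T fun _ => none).val.length ≤ (c + 1) ^ r :=
    (length_basicSolutions_le hc _ _ _).trans (Nat.pow_le_pow_right (by omega) hl)
  have hbits := bits_basicSolutions (FinEnum.toList ρ) T (fun _ => none) hT hβ hB
  refine ⟨?_, ?_, ?_⟩
  · simp only [basicFeasible, time_bind, val_tabulate, val_op]
    unfold basicFeasibleTime
    rw [add_assoc]
    refine add_le_add (time_tabulate_le hc fun _ => by simp) (add_le_add ?_
      (time_filterL_le hlen fun y hy => time_isFeasible_le hr hc hT hβ (hbits y hy)))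
    have h1 := time_basicSolutions_le hr hc _ T (fun _ => none) hT hβ hB hl
    have h2 : (c + 2) ^ (FinEnum.toList ρ).length *
        (2 * branchTime r c (solutionBits r β)) ≤ basicTime r c (solutionBits r β) :=
      Nat.mul_le_mul_right _ (Nat.pow_le_pow_right (by omega) hl)
    omega
  · simp only [basicFeasible, val_bind, val_tabulate, val_op, val_filterL]
    exact (List.length_filter_le _ _).trans hlen
  · intro y hy
    simp only [basicFeasible, val_bind, val_tabulate, val_op, val_filterL, List.mem_filter] at hy
    exact hbits y hy.1

omit [FinEnum ι] in
theorem time_argminObjective_le {obj : (ι → ℚ) → Timed ℚ} {ys : List (ι → ℚ)} {L t γ : ℕ}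
    (hL : ys.length ≤ L) (ht : ∀ y ∈ ys, (obj y).time ≤ t)
    (hγ : ∀ y ∈ ys, BitBound γ (obj y).val) :
    (argminObjective obj ys).time ≤ loopTime L (t + arithCost γ + 1) + 1 := by
  simp only [argminObjective, time_bind, time_op, add_le_add_iff_right]
  refine (foldL_induction (fun _ (best : Option ((ι → ℚ) × ℚ)) => ∀ p ∈ best, BitBound γ p.2)
    (by simp) hL fun j best y _ hy hbest => ?_).1
  have h1 := ht y hy
  have h2 := hγ y hy
  rcases best with _ | ⟨z, w⟩
  · refine ⟨by simp only [time_bind, time_op]; omega, ?_⟩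
    simpa using h2
  · have hw : BitBound γ w := hbest _ rfl
    have h3 := time_leQ_le hw h2
    refine ⟨by simp only [time_bind, time_op]; omega, ?_⟩
    simp only [val_bind, val_op]
    split_ifs
    · simpa using hw
    · simpa using h2

/-! ### The time of the computation of the values -/

variable {n m k : ℕ} {M : MDP (Fin n) (Fin m)} {N : ℕ}

/-- The enabled transitions and the initial distribution of `M` have probabilities of at most `N`
bits, and there are at most `N` states and actions. -/
structure SizeBound (M : MDP (Fin n) (Fin m)) (N : ℕ) : Prop where
  states : n ≤ N
  actions : m ≤ N
  pos : 1 ≤ N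
  bits : ∀ s, ∀ α ∈ M.act s, ∀ t, BitBound N (M.P s α t)
  init : ∀ s, BitBound N (M.init s)

theorem tableauBits_valueConstraints (hM : SizeBound M N) (Goal X : Finset (Fin n))
    (dom : Fin n → Bool) {f : Fin n → ℚ} (hβ : N ≤ β) (hf : ∀ s, BitBound β (f s)) :
    TableauBits (β + 2) (valueConstraints M Goal X dom f).val := by
  have hpos := hM.pos
  have h01 : ∀ p : Prop, [Decidable p] → BitBound 1 (if p then (1 : ℚ) else 0) := by
    intro p _
    split_ifs
    · exact bitBound_one
    · exact bitBound_zero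
  intro r c
  rw [val_valueConstraints]
  by_cases hr : r.1 ∉ X ∨ r.2 ∉ M.act r.1
  · rw [if_pos hr]; exact bitBound_zero.mono (by omega)
  rw [if_neg hr]
  push Not at hr
  rcases c with _ | t | r'
  · dsimp only
    split_ifs
    · exact bitBound_one.mono (by omega)
    · exact (hf _).mono (by omega)
    · exact bitBound_zero.mono (by omega)
  · dsimp only
    have hp : BitBound N (if r.1 ∈ Goal ∨ dom r.1 = true ∨ t ∉ X then 0 else M.P r.1 r.2 t) := by
      split_ifs
      · exact bitBound_zero.mono hpos
      · exact hM.bits _ _ hr.2 _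
    exact ((h01 (t = r.1)).sub hp).mono (by omega)
  · dsimp only
    split_ifs
    · exact bitBound_neg_one.mono (by omega)
    · exact bitBound_zero.mono (by omega)

theorem card_rows_le (hM : SizeBound M N) : FinEnum.card (Fin n × Fin m) ≤ N * N := by
  rw [FinEnum.card_eq_fintypeCard, Fintype.card_prod, Fintype.card_fin, Fintype.card_fin]
  exact Nat.mul_le_mul hM.states hM.actions

theorem card_columns_le (hM : SizeBound M N) :
    FinEnum.card (Fin n ⊕ Fin n × Fin m) ≤ N + N * N := by
  rw [FinEnum.card_eq_fintypeCard, Fintype.card_sum, Fintype.card_prod, Fintype.card_fin,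
    Fintype.card_fin]
  exact add_le_add hM.states (Nat.mul_le_mul hM.states hM.actions)

/-- A bound for the time of the linear program for the values. -/
def maxValTime (N β : ℕ) : ℕ :=
  loopTime (N * N) (loopTime (N + N * N + 1) (5 + arithCost (β + 2))) +
    basicFeasibleTime (N * N) (N + N * N) (β + 2) +
    (loopTime ((N + N * N + 1) ^ (N * N)) (loopTime N
      (1 + arithCost (sumBits N (solutionBits (N * N) (β + 2)))) +
        arithCost (sumBits N (solutionBits (N * N) (β + 2))) + 1) + 1) + loopTime N 1

theorem maxVal_bound (hM : SizeBound M N) (Goal X : Finset (Fin n))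
    (dom : Fin n → Bool) {f : Fin n → ℚ} (hβ : N ≤ β) (hf : ∀ s, BitBound β (f s)) :
    (maxVal M Goal X dom f).time ≤ maxValTime N β ∧
      ∀ s, BitBound (solutionBits (N * N) (β + 2)) ((maxVal M Goal X dom f).val s) := by
  have hT := tableauBits_valueConstraints hM Goal X dom hβ hf
  have hpos := hM.pos
  obtain ⟨h1, h2, h3⟩ := basicFeasible_bound (card_rows_le hM) (card_columns_le hM) hT (by omega)
  have hn : (List.finRange n).length ≤ N := by simpa using hM.states
  have hn' : FinEnum.card (Fin n) ≤ N := by rw [FinEnum.card_fin]; exact hM.states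
  have hc : FinEnum.card (Option (Fin n ⊕ Fin n × Fin m)) ≤ N + N * N + 1 := by
    rw [card_option]; exact Nat.succ_le_succ (card_columns_le hM)
  have h0 : (valueConstraints M Goal X dom f).time ≤
      loopTime (N * N) (loopTime (N + N * N + 1) (5 + arithCost (β + 2))) := by
    refine time_tabulate_le (card_rows_le hM) fun r => time_tabulate_le hc fun c => ?_
    by_cases hr : r.1 ∉ X ∨ r.2 ∉ M.act r.1
    · rw [if_pos hr]; simp
    · rw [if_neg hr]
      push Not at hr
      rcases c with _ | t | r'
      · simp
      · simp only [time_bind, time_op, val_op]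
        refine Nat.add_le_add_left (time_subQ_le ?_ ?_) 5
        · split_ifs
          · exact bitBound_one.mono (by omega)
          · exact bitBound_zero.mono (by omega)
        · split_ifs
          · exact bitBound_zero.mono (by omega)
          · exact (hM.bits _ _ hr.2 _).mono (by omega)
      · simp
  have h4 := time_argminObjective_le (ι := Fin n ⊕ Fin n × Fin m)
    (obj := fun y => sumQ (fun s => op 1 (y (Sum.inl s))) (List.finRange n)) h2
    (fun y hy => time_sumQ_le (t := 1) hn (fun s _ => h3 y hy (Sum.inl s)) fun s _ => by simp)
    (fun y hy => bitBound_sumQ hn fun s _ => h3 y hy (Sum.inl s))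
  have h5 := argminObjective_spec
    (fun y : Fin n ⊕ Fin n × Fin m → ℚ => sumQ (fun s => op 1 (y (Sum.inl s)))
      (List.finRange n)) (basicFeasible (valueConstraints M Goal X dom f).val).val
  constructor
  · simp only [maxVal, time_bind]
    unfold maxValTime
    rw [add_assoc, add_assoc]
    refine add_le_add h0 (add_le_add h1 (add_le_add h4 ?_))
    rcases (argminObjective _ _).val with _ | y
    · exact time_tabulate_le hn' fun _ => by simp
    · exact time_tabulate_le hn' fun _ => by simp
  · intro s
    rcases h5 with ⟨-, h5⟩ | ⟨y, hy, h5, -⟩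
    · simp only [maxVal, val_bind, h5]
      exact bitBound_zero.mono (Nat.mul_pos (Nat.pow_pos (by norm_num)) (by omega))
    · simp only [maxVal, val_bind, h5]
      exact h3 y hy (Sum.inl s)

end LinearProgramTimes

/-! ### Step counts of the removal of dominated subsystems -/

section RemovalTimes

open Timed

variable {n N β : ℕ}

theorem length_subsetsOf (l : List (Fin n)) : (subsetsOf l).val.length = 2 ^ l.length := by
  induction l with
  | nil => simp [subsetsOf]
  | cons s l ih =>
    simp only [subsetsOf, val_bind, val_append, val_mapL, List.length_append, List.length_map, ih,
      List.length_cons, pow_succ]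
    ring

/-- A bound for the time of the enumeration of the subsets of a set of at most `N` elements. -/
def subsetsTime (N : ℕ) : ℕ := (N + 1) * (loopTime (2 ^ N) (N + 1) + 2 ^ N + 1)

theorem time_subsetsOf_le (hn : n ≤ N) {l : List (Fin n)} (hl : l.length ≤ N) :
    (subsetsOf l).time ≤ subsetsTime N := by
  suffices H : (subsetsOf l).time ≤ (l.length + 1) * (loopTime (2 ^ N) (N + 1) + 2 ^ N + 1) from
    H.trans (Nat.mul_le_mul_right _ (by omega))
  induction l with
  | nil =>
    simp only [subsetsOf, time_op, List.length_nil, zero_add, one_mul]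
    have h : loopTime 1 (N + 1) ≤ loopTime (2 ^ N) (N + 1) :=
      loopTime_mono Nat.one_le_two_pow le_rfl
    have h' : loopTime 1 (N + 1) = N + 3 := by unfold loopTime; ring
    have := Nat.one_le_two_pow (n := N)
    omega
  | cons s l ih =>
    rw [List.length_cons] at hl ⊢
    have h1 := ih (by omega)
    have hlen : (subsetsOf l).val.length ≤ 2 ^ N := by
      rw [length_subsetsOf]; exact Nat.pow_le_pow_right (by norm_num) (by omega)
    have h2 := time_mapL_le (t := N + 1) (f := fun X => op (n + 1) (insert s X)) hlen
      fun X _ => by simp only [time_op]; omega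
    rw [add_mul, one_mul]
    simp only [subsetsOf, time_bind, time_append]
    omega

/-- A bound for the time of the enumeration of the projections of a vector. -/
def projectionsTime (N : ℕ) : ℕ := subsetsTime N + loopTime (2 ^ N) (loopTime N 1)

theorem card_fin_le (hn : n ≤ N) : FinEnum.card (Fin n) ≤ N := by rw [FinEnum.card_fin]; exact hn

theorem length_finRange_le (hn : n ≤ N) : (List.finRange n).length ≤ N := by simpa using hn

theorem length_subsetsOf_le {I : List (Fin n)} (hI : I.length ≤ N) :
    (subsetsOf I).val.length ≤ 2 ^ N := by
  rw [length_subsetsOf]; exact Nat.pow_le_pow_right (by norm_num) hI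

theorem time_projections_le (hn : n ≤ N) {I : List (Fin n)} (hI : I.length ≤ N)
    (θ : Fin n → ℚ) : (projections I θ).time ≤ projectionsTime N := by
  simp only [projections, time_bind]
  exact add_le_add (time_subsetsOf_le hn hI) (time_mapL_le (length_subsetsOf_le hI)
    fun D _ => time_tabulate_le (card_fin_le hn) fun q => by simp)

theorem length_projections_le {I : List (Fin n)} (hI : I.length ≤ N) (θ : Fin n → ℚ) :
    (projections I θ).val.length ≤ 2 ^ N := by
  simp only [projections, val_bind, val_mapL, List.length_map]
  exact length_subsetsOf_le hI

theorem bitBound_projections {I : List (Fin n)} {θ v : Fin n → ℚ} (hθ : ∀ q, BitBound β (θ q))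
    (hv : v ∈ (projections I θ).val) (q : Fin n) : BitBound β (v q) := by
  obtain ⟨D, -, rfl⟩ := (mem_projections I θ v).1 hv
  dsimp only
  split_ifs
  · exact hθ q
  · exact bitBound_zero.mono (hθ q).one_le

theorem time_vecEq_le (hn : n ≤ N) {v w : Fin n → ℚ} (hv : ∀ q, BitBound β (v q))
    (hw : ∀ q, BitBound β (w q)) : (vecEq v w).time ≤ loopTime N (arithCost β) :=
  time_allL_le (length_finRange_le hn) fun q _ => time_eqQ_le (hv q) (hw q)

/-- A bound for the time of the test of membership in the convex hull of `H` points. -/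
def inHullTime (N H β : ℕ) : ℕ :=
  loopTime (N + 1) (loopTime (H + 1) 1) + basicFeasibleTime (N + 1) H β + 1

theorem time_inConvexHull_le {H : ℕ} (hn : n ≤ N) {pts : List (Fin n → ℚ)}
    (hH : pts.length ≤ H) (hβ : 1 ≤ β) (hpts : ∀ p ∈ pts, ∀ q, BitBound β (p q)) {p : Fin n → ℚ}
    (hp : ∀ q, BitBound β (p q)) : (inConvexHull pts p).time ≤ inHullTime N H β := by
  have hr : FinEnum.card (Option (Fin n)) ≤ N + 1 := by
    rw [card_option, FinEnum.card_fin]; omega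
  have hc : FinEnum.card (Fin pts.length) ≤ H := by rw [FinEnum.card_fin]; exact hH
  have hc' : FinEnum.card (Option (Fin pts.length)) ≤ H + 1 := by
    rw [card_option]; omega
  simp only [inConvexHull, time_bind, time_op]
  unfold inHullTime
  rw [add_assoc]
  refine add_le_add (time_tabulate_le hr fun r => time_tabulate_le hc' fun c => ?_)
    (Nat.add_le_add_right (basicFeasible_bound hr hc ?_ hβ).1 1)
  · rcases r with _ | q
    · simp
    · rcases c with _ | j <;> simp
  · intro r c
    rcases r with _ | q
    · exact bitBound_one.mono hβ
    · rcases c with _ | j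
      · exact hp q
      · exact hpts _ (List.get_mem pts j) q

/-- A bound for the time of the computation of the vertices of the convex hull of `H` points. -/
def hullVerticesTime (N H β : ℕ) : ℕ :=
  loopTime H (loopTime H (loopTime N (arithCost β) + 1) + (inHullTime N H β + 1))

theorem time_hullVertices_le {H : ℕ} (hn : n ≤ N) {pts : List (Fin n → ℚ)}
    (hH : pts.length ≤ H) (hβ : 1 ≤ β) (hpts : ∀ p ∈ pts, ∀ q, BitBound β (p q)) :
    (hullVertices pts).time ≤ hullVerticesTime N H β := by
  refine time_filterL_le hH fun p hp => ?_
  simp only [time_bind, val_filterL, time_op]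
  refine add_le_add (time_filterL_le hH fun q hq => ?_)
    (Nat.add_le_add_right (time_inConvexHull_le hn ((List.length_filter_le _ _).trans hH) hβ
      (fun q hq => hpts q (List.mem_of_mem_filter hq)) (hpts p hp)) 1)
  simp only [time_bind, time_op]
  exact Nat.add_le_add_right (time_vecEq_le hn (hpts q hq) (hpts p hp)) 1

/-- The entries of the value vectors have at most `β` bits. -/
def SubsystemBits (β : ℕ) (L : List (PartialSubsystem n)) : Prop :=
  ∀ U ∈ L, ∀ q, BitBound β (U.val q)

/-- A bound for the number of the points that are collected from `Λ` partial subsystems. -/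
def pointsBound (N Λ : ℕ) : ℕ := (N + 1) * (Λ * 2 ^ N)

/-- A bound for the time of one round of `removeDominated` for at most `Λ` partial subsystems. -/
def removeRoundTime (N Λ β : ℕ) : ℕ :=
  loopTime Λ (N + 1) + (loopTime Λ (projectionsTime N + 2 ^ N) + ((pointsBound N Λ + 1) +
    (hullVerticesTime N (pointsBound N Λ) β +
      (loopTime Λ (loopTime (pointsBound N Λ) (loopTime N (arithCost β))) +
        (((N + 1) * Λ + 1) + 1)))))

/-- A bound for the time of `removeDominated` for at most `Λ` partial subsystems. -/
def removeTime (N Λ β : ℕ) : ℕ :=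
  loopTime Λ (N + 1) + (loopTime (N + 1) (removeRoundTime N Λ β) + 1)

theorem foldl_max_le {L : List (PartialSubsystem n)} {c : ℕ} (hc : c ≤ n) :
    L.foldl (fun c U => max c U.states.card) c ≤ n := by
  induction L generalizing c with
  | nil => exact hc
  | cons U L ih => exact ih (max_le hc (by simpa using Finset.card_le_univ U.states))

theorem time_removeDominated_le {Λ : ℕ} (hn : n ≤ N) {I : List (Fin n)} (hI : I.length ≤ N)
    {L : List (PartialSubsystem n)} (hL : L.length ≤ Λ) (hβ : 1 ≤ β) (hbits : SubsystemBits β L) :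
    (removeDominated I L).time ≤ removeTime N Λ β := by
  have hsize : (List.range (L.foldl (fun c U => max c U.states.card) 0 + 1)).length ≤ N + 1 := by
    have := foldl_max_le (L := L) (Nat.zero_le n)
    rw [List.length_range]; omega
  simp only [removeDominated, time_bind, time_op]
  refine add_le_add (foldL_induction (fun _ _ => True) trivial hL fun _ _ U _ _ _ => ?_).1
    (Nat.add_le_add_right ?_ 1)
  · exact ⟨by simp only [time_op]; omega, trivial⟩
  simp only [val_foldL, val_op]
  -- The points of each round are at most the projections of all members of `L`.
  refine (foldL_induction (fun j (HR : List (Fin n → ℚ) × List (PartialSubsystem n)) =>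
    HR.1.length ≤ j * (Λ * 2 ^ N) ∧ (∀ v ∈ HR.1, ∀ q, BitBound β (v q)) ∧ HR.2.length ≤ j * Λ)
    (by simp) hsize fun i HR j hi _ hHR => ?_).1
  obtain ⟨h1, h2, h3⟩ := hHR
  have hiN : i + 1 ≤ N + 1 := by omega
  set Lj := L.filter fun U => decide (U.states.card = j) with hLj
  have hLjlen : Lj.length ≤ Λ := (List.length_filter_le _ _).trans hL
  have hLjmem : ∀ U ∈ Lj, ∀ q, BitBound β (U.val q) :=
    fun U hU => hbits U (List.mem_of_mem_filter hU)
  set H := HR.1 ++ Lj.flatMap fun U => (projections I U.val).val with hHdef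
  have hpts : (Lj.flatMap fun U => (projections I U.val).val).length ≤ Λ * 2 ^ N :=
    (length_flatMap_le _ _ _ fun U _ => length_projections_le hI U.val).trans
      (Nat.mul_le_mul_right _ hLjlen)
  have hHlen : H.length ≤ (i + 1) * (Λ * 2 ^ N) := by
    rw [hHdef, List.length_append, Nat.succ_mul]; omega
  have hHlen' : H.length ≤ pointsBound N Λ := hHlen.trans (Nat.mul_le_mul_right _ hiN)
  have hHbits : ∀ v ∈ H, ∀ q, BitBound β (v q) := by
    intro v hv
    rcases List.mem_append.1 hv with hv | hv
    · exact h2 v hv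
    · obtain ⟨U, hU, hv⟩ := List.mem_flatMap.1 hv
      exact bitBound_projections (hLjmem U hU) hv
  have hR : ∀ V : List (Fin n → ℚ), (Lj.filter fun U =>
      V.any fun v => (vecEq v U.val).val).length ≤ Λ :=
    fun V => (List.length_filter_le _ _).trans hLjlen
  have hmul : ∀ x, i * x + x ≤ (N + 1) * x := fun x => by
    rw [← Nat.succ_mul]; exact Nat.mul_le_mul_right _ hiN
  have hVlen : (hullVertices H).val.length ≤ pointsBound N Λ := by
    refine le_trans ?_ hHlen'
    simp only [hullVertices, val_filterL]
    exact List.length_filter_le _ _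
  simp only [time_bind, time_append, time_op, val_bind, val_append, val_op, val_filterL,
    val_flatMapL, val_anyL, ← hLj, ← hHdef]
  refine ⟨?_, hHlen, hHbits, ?_⟩
  · unfold removeRoundTime
    refine add_le_add (time_filterL_le hL fun U _ => by simp only [time_op]; omega)
      (add_le_add (time_flatMapL_le hLjlen (fun U _ => time_projections_le hn hI U.val)
        fun U _ => length_projections_le hI U.val) (add_le_add ?_
        (add_le_add (time_hullVertices_le hn hHlen' hβ hHbits)
        (add_le_add (time_filterL_le hLjlen fun U hU => time_anyL_le hVlen fun v hv =>
          time_vecEq_le hn (hHbits v ((mem_hullVertices H v).1 hv).1) (hLjmem U hU)) ?_))))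
    · have := hmul (Λ * 2 ^ N)
      unfold pointsBound
      omega
    · have := hmul Λ
      omega
  · rw [List.length_append, Nat.succ_mul]
    exact add_le_add h3 (hR _)

/-- Every partial subsystem is kept at most once, in the round of its size. -/
theorem length_removeDominated_le (I : List (Fin n)) (L : List (PartialSubsystem n)) :
    (removeDominated I L).val.length ≤ L.length := by
  rw [val_removeDominated]
  refine le_trans ?_ (List.length_filter_le (fun U : PartialSubsystem n => decide
    (U.states.card < L.foldl (fun c U => max c U.states.card) 0 + 1)) L)
  generalize L.foldl (fun c U => max c U.states.card) 0 + 1 = r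
  induction r with
  | zero => simp
  | succ r ih =>
    rw [List.range_succ, List.foldl_append, List.foldl_cons, List.foldl_nil]
    have hsplit : ∀ L : List (PartialSubsystem n),
        (L.filter fun U => decide (U.states.card < r + 1)).length =
          (L.filter fun U => decide (U.states.card < r)).length +
            (L.filter fun U => decide (U.states.card = r)).length := by
      intro L
      induction L with
      | nil => rfl
      | cons U L ih =>
        simp only [List.filter_cons, decide_eq_true_eq, apply_ite List.length, List.length_cons]
        split_ifs <;> omega
    rw [hsplit, removeDominatedStep, List.length_append]
    exact add_le_add ih (List.length_filter_le _ _)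

end RemovalTimes

/-! ### Step counts of the graph algorithms -/

section GraphTimes

open Timed

variable {n m k N : ℕ} {M : MDP (Fin n) (Fin m)}

/-- A bound for the time of the computation of the graph data. -/
def graphTime (N : ℕ) : ℕ :=
  loopTime N (loopTime N (loopTime N (arithCost N + 1))) +
    (loopTime N (loopTime N (loopTime N (loopTime N 5))) +
      (loopTime N (arithCost N + (loopTime N 3 + 1)) + (loopTime N (loopTime N 3) + 1)))

theorem time_graphData_le (hM : SizeBound M N) (hk : k ≤ N) (blk : Fin n → Fin k) :
    (graphData M blk).time ≤ graphTime N := by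
  have hn := hM.states
  have hl := length_finRange_le hn
  have hm := length_finRange_le hM.actions
  simp only [graphData, time_bind, time_op]
  refine add_le_add (time_tabulate_le (card_fin_le hn) fun s => time_tabulate_le (card_fin_le hn)
    fun t => time_anyL_le hm fun α _ => ?_) (add_le_add (time_tabulate_le (card_fin_le hk)
    fun b => time_tabulate_le (card_fin_le hk) fun c => time_anyL_le hl fun s _ =>
      time_anyL_le hl fun t _ => by simp) (add_le_add (time_tabulate_le (card_fin_le hn)
    fun t => ?_) (Nat.add_le_add_right (time_tabulate_le (card_fin_le hn) fun s =>
      time_anyL_le hl fun t _ => by simp) 1)))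
  · split_ifs with h
    · exact Nat.add_le_add_right (time_leQ_le (hM.bits s α h t) (bitBound_zero.mono hM.pos)) 1
    · simp
  · exact add_le_add (time_leQ_le (hM.init t) (bitBound_zero.mono hM.pos))
      (Nat.add_le_add_right (time_anyL_le hl fun s _ => by simp) 1)

/-- A bound for the time of one step of the topological sorting. -/
def topologicalStepTime (N : ℕ) : ℕ := loopTime N (2 * N + 4 + loopTime N (N + 2)) + N + 2

/-- Every round lists one more block, so that there are at most as many rounds as blocks. -/
theorem reverseTopological_bound (hk : k ≤ N) (child : Fin k → Fin k → Bool) (fuel : ℕ)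
    (acc : List (Fin k)) (h : acc.length + fuel ≤ N) :
    (reverseTopological child fuel acc).time ≤ (fuel + 1) * topologicalStepTime N ∧
      (reverseTopological child fuel acc).val.length ≤ acc.length + fuel := by
  induction fuel generalizing acc with
  | zero =>
    refine ⟨?_, le_rfl⟩
    simp only [reverseTopological, time_op, zero_add, one_mul]
    unfold topologicalStepTime
    omega
  | succ fuel ih =>
    have hready := time_filterL_le (t := 2 * N + 4 + loopTime N (N + 2)) (length_finRange_le hk)
      (p := fun b => (do
        let listed ← op (k + 1) (decide (b ∈ acc))
        let below ← allL (fun c => op (k + 2) (!child b c || decide (c ∈ acc))) (List.finRange k)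
        op 1 (!listed && below) : Timed Bool)) fun b _ => by
      have := time_allL_le (t := N + 2) (p := fun c => op (k + 2)
        (!child b c || decide (c ∈ acc))) (length_finRange_le hk) fun c _ => by
          simp only [time_op]; omega
      simp only [time_bind, time_op]
      omega
    have hstep : loopTime N (2 * N + 4 + loopTime N (N + 2)) + (acc.length + 1) + 1 ≤
        topologicalStepTime N := by unfold topologicalStepTime; omega
    simp only [reverseTopological]
    rw [Nat.succ_mul]
    simp only [time_bind, val_bind] at hready ⊢
    split
    · simp only [time_op, val_op]
      refine ⟨?_, by omega⟩
      omega
    · rename_i b l _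
      simp only [time_bind, val_bind, time_append, val_append]
      obtain ⟨h1, h2⟩ := ih (acc ++ [b]) (by
        simp only [List.length_append, List.length_singleton]; omega)
      simp only [List.length_append, List.length_singleton] at h2
      refine ⟨?_, by omega⟩
      omega

end GraphTimes

/-! ### Step counts of the algorithm -/

section AlgorithmTimes

open Timed

variable {n m k N β : ℕ} {M : MDP (Fin n) (Fin m)} {Goal : Finset (Fin n)} {blk : Fin n → Fin k}
  {g : GraphData n k}

/-- A bound for the time of the test of the filter. -/
def filterTime (N : ℕ) : ℕ := loopTime N (loopTime N 2 + (loopTime N 2 + 5))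

theorem time_satisfiesFilter_le (hn : n ≤ N) (X : Finset (Fin n)) :
    (satisfiesFilter g Goal X).time ≤ filterTime N := by
  have hl := length_finRange_le hn
  refine time_allL_le hl fun s _ => ?_
  simp only [time_bind, time_op]
  exact add_le_add (time_anyL_le hl fun _ _ => by simp)
    (Nat.add_le_add_right (time_anyL_le hl fun _ _ => by simp) 5)

/-- A bound for the number of combinations of partial subsystems of the children, if at most `2 ^ N`
are stored for each. It is too large to be iterated along the tree: the lists that are stored for a
block are bounded by `length_processBlock_le`. -/
def combinationsBound (N : ℕ) : ℕ := (2 ^ N) ^ N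

/-- A bound for the time of the enumeration of the combinations. -/
def successorTime (N : ℕ) : ℕ :=
  loopTime N 1 + loopTime N (loopTime (combinationsBound N)
    (loopTime (2 ^ N) (N + 1 + (loopTime N 2 + 1)) + 2 ^ N))

theorem successorPoints_bound (hn : n ≤ N) (hk : k ≤ N)
    {psubsys : Fin k → List (PartialSubsystem n)}
    (hlen : ∀ c, (psubsys c).length ≤ 2 ^ N) (hβ : 1 ≤ β) (hbits : ∀ c, SubsystemBits β (psubsys c))
    (b : Fin k) : (successorPoints g blk psubsys b).time ≤ successorTime N ∧
      (successorPoints g blk psubsys b).val.length ≤ combinationsBound N ∧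
      SubsystemBits β (successorPoints g blk psubsys b).val := by
  have hchildren : ((List.finRange k).filter fun c => g.child b c).length ≤ N :=
    (List.length_filter_le _ _).trans (length_finRange_le hk)
  have hpow : ∀ j ≤ N, (2 ^ N) ^ j ≤ combinationsBound N := fun j hj =>
    Nat.pow_le_pow_right Nat.one_le_two_pow hj
  have hfold := foldL_induction (L := N)
    (t := loopTime (combinationsBound N) (loopTime (2 ^ N) (N + 1 + (loopTime N 2 + 1)) + 2 ^ N))
    (f := fun (combos : List (PartialSubsystem n)) c => flatMapL (fun T => mapL (fun U => do
      let X ← op (n + 1) (T.states ∪ U.states)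
      let v ← tabulate (fun q => op 2 (if blk q = c then U.val q else T.val q))
      op 1 ⟨X, v⟩) (psubsys c)) combos)
    (fun j combos => combos.length ≤ (2 ^ N) ^ j ∧ SubsystemBits β combos)
    (x := [⟨∅, fun _ => 0⟩]) (l := (List.finRange k).filter fun c => g.child b c)
    ⟨by simp, fun U hU q => by
      rw [List.mem_singleton] at hU
      subst hU
      exact bitBound_zero.mono hβ⟩ hchildren fun j combos c hj _ hI => by
    obtain ⟨h1, h2⟩ := hI
    refine ⟨time_flatMapL_le (h1.trans (hpow j (by omega))) (fun T _ => time_mapL_le (hlen c)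
      fun U _ => ?_) fun T _ => by simpa using hlen c, ?_, fun V hV q => ?_⟩
    · simp only [time_bind, time_op]
      exact add_le_add (by omega) (Nat.add_le_add_right
        (time_tabulate_le (card_fin_le hn) fun _ => by simp) 1)
    · simp only [val_flatMapL, val_mapL, pow_succ]
      exact (length_flatMap_le _ _ _ fun T _ => by rw [List.length_map]; exact hlen c).trans
        (Nat.mul_le_mul_right _ h1)
    · simp only [val_flatMapL, val_mapL, List.mem_flatMap, List.mem_map] at hV
      obtain ⟨T, hT, U, hU, rfl⟩ := hV
      simp only [val_bind, val_op, val_tabulate]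
      split_ifs
      · exact hbits c U hU q
      · exact h2 T hT q
  simp only [successorPoints, time_bind, val_bind, val_filterL, val_op]
  exact ⟨add_le_add (time_filterL_le (length_finRange_le hk) fun _ _ => by simp) hfold.1,
    hfold.2.1.trans (hpow _ hchildren), hfold.2.2⟩

/-- A bound for the time of the computation of a new partial subsystem. -/
def newTime (N β : ℕ) : ℕ :=
  N + 1 + (loopTime N 3 + (maxValTime N β + (loopTime N 4 + 1)))

theorem newSubsystem_bound (hM : SizeBound M N) (hβ : N ≤ β) {T : PartialSubsystem n}
    (hT : ∀ q, BitBound β (T.val q)) (b : Fin k) (X : Finset (Fin n)) :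
    (newSubsystem M Goal g blk b X T).time ≤ newTime N β ∧
      ∀ q, BitBound (solutionBits (N * N) (β + 2))
        ((newSubsystem M Goal g blk b X T).val.val q) := by
  have hn := hM.states
  have h := fun dom => maxVal_bound hM Goal (X ∪ T.states) dom hβ hT
  constructor
  · simp only [newSubsystem, time_bind, time_op, val_op, val_tabulate]
    exact add_le_add (by omega) (add_le_add (time_tabulate_le (card_fin_le hn) fun _ => by simp)
      (add_le_add (h _).1 (Nat.add_le_add_right
        (time_tabulate_le (card_fin_le hn) fun _ => by simp) 1)))
  · intro q
    rw [val_newSubsystem]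
    dsimp only
    split_ifs
    · exact (h _).2 q
    · exact bitBound_zero.mono ((h fun _ => false).2 q).one_le

/-- A bound for the number of partial subsystems that occur in processing one block. -/
def storedBound (N : ℕ) : ℕ := 2 ^ N * combinationsBound N

/-- A bound for the time of processing one block. -/
def blockTime (N β : ℕ) : ℕ :=
  loopTime N 1 + (loopTime N 1 + (subsetsTime N + (loopTime (2 ^ N) (filterTime N) +
    loopTime (2 ^ N) (successorTime N + (loopTime (combinationsBound N) (newTime N β) +
      ((storedBound N + 1) + removeTime N (storedBound N) (solutionBits (N * N) (β + 2))))))))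

theorem processBlock_bound (hM : SizeBound M N) (hk : k ≤ N)
    {psubsys : Fin k → List (PartialSubsystem n)} (hlen : ∀ c, (psubsys c).length ≤ 2 ^ N)
    (hβ : N ≤ β) (hbits : ∀ c, SubsystemBits β (psubsys c)) (b : Fin k) :
    (processBlock M Goal g blk psubsys b).time ≤ blockTime N β ∧
      SubsystemBits (solutionBits (N * N) (β + 2)) (processBlock M Goal g blk psubsys b).val := by
  have hn := hM.states
  have hpos := hM.pos
  have hγ : 1 ≤ solutionBits (N * N) (β + 2) :=
    Nat.mul_pos (Nat.pow_pos (by norm_num)) (by omega)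
  set block := (List.finRange n).filter fun s => decide (blk s = b) with hblock
  set I := block.filter fun s => g.inc s with hI
  set models := (subsetsOf block).val.filter fun X => (satisfiesFilter g Goal X).val with hmodels
  have hblocklen : block.length ≤ N := (List.length_filter_le _ _).trans (length_finRange_le hn)
  have hIlen : I.length ≤ N := (List.length_filter_le _ _).trans hblocklen
  have hmodelslen : models.length ≤ 2 ^ N :=
    (List.length_filter_le _ _).trans (length_subsetsOf_le hblocklen)
  obtain ⟨hs1, hs2, hs3⟩ := successorPoints_bound (g := g) (blk := blk) hn hk hlen
    (hpos.trans hβ) hbits b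
  have hfold := foldL_induction (L := 2 ^ N) (t := successorTime N +
      (loopTime (combinationsBound N) (newTime N β) + ((storedBound N + 1) +
        removeTime N (storedBound N) (solutionBits (N * N) (β + 2)))))
    (f := fun stored X => (do
      let succ ← successorPoints g blk psubsys b
      let new ← mapL (newSubsystem M Goal g blk b X) succ
      let all ← append stored new
      removeDominated I all : Timed _))
    (fun j stored => stored.length ≤ j * combinationsBound N ∧
      SubsystemBits (solutionBits (N * N) (β + 2)) stored)
    (x := []) (l := models) ⟨by simp, fun U hU => by simp at hU⟩ hmodelslen
    fun j stored X hj _ hI' => by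
    obtain ⟨h1, h2⟩ := hI'
    set all := stored ++ (successorPoints g blk psubsys b).val.map fun T =>
      (newSubsystem M Goal g blk b X T).val with hall
    have hallj : all.length ≤ (j + 1) * combinationsBound N := by
      rw [hall, List.length_append, List.length_map, Nat.succ_mul]; omega
    have halllen : all.length ≤ storedBound N :=
      hallj.trans (Nat.mul_le_mul_right _ (by omega))
    have hallbits : SubsystemBits (solutionBits (N * N) (β + 2)) all := by
      intro U hU
      rcases List.mem_append.1 hU with hU | hU
      · exact h2 U hU
      · obtain ⟨T, hT, rfl⟩ := List.mem_map.1 hU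
        exact (newSubsystem_bound hM hβ (hs3 T hT) b X).2
    have hstored : stored.length ≤ storedBound N := by
      refine le_trans ?_ halllen
      rw [hall, List.length_append]; omega
    simp only [time_bind, time_append, val_append, val_bind, val_mapL, ← hall]
    refine ⟨add_le_add hs1 (add_le_add (time_mapL_le hs2 fun T hT =>
      (newSubsystem_bound hM hβ (hs3 T hT) b X).1) (add_le_add (by omega)
      (time_removeDominated_le hn hIlen halllen hγ hallbits))),
      (length_removeDominated_le I all).trans hallj, fun U hU =>
        hallbits U ((mem_removeDominated I all U).1 hU).1⟩
  simp only [processBlock, time_bind, val_bind, val_filterL, val_op, ← hblock, ← hI, ← hmodels]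
  exact ⟨add_le_add (time_filterL_le (length_finRange_le hn) fun _ _ => by simp)
    (add_le_add (time_filterL_le hblocklen fun _ _ => by simp)
    (add_le_add (time_subsetsOf_le hn hblocklen)
    (add_le_add (time_filterL_le (length_subsetsOf_le hblocklen) fun X _ =>
      time_satisfiesFilter_le hn X) hfold.1))), hfold.2.2⟩

theorem length_combinations_le {psubsys : Fin k → List (PartialSubsystem n)} {e : Fin k → ℕ}
    {cs : List (Fin k)} (h : ∀ c ∈ cs, (psubsys c).length ≤ 2 ^ e c) :
    (combinations blk psubsys cs).length ≤ 2 ^ (cs.map e).sum := by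
  induction cs using List.reverseRecOn with
  | nil => simp [combinations]
  | append_singleton cs c ih =>
    have h1 := ih fun d hd => h d (by simp [hd])
    have h2 := h c (by simp)
    simp only [combinations, List.foldl_append, List.foldl_cons, List.foldl_nil] at h1 ⊢
    refine (length_flatMap_le _ _ (2 ^ e c) fun T _ => by rw [List.length_map]; exact h2).trans ?_
    simp only [List.map_append, List.sum_append, List.map_cons, List.map_nil, List.sum_singleton,
      pow_add]
    exact Nat.mul_le_mul_right _ h1

/-- The lists stay short although they are combined along the tree: the exponents for the children
and for the block add up to at most the number of states below the block. -/
theorem length_processBlock_le (hg : g.Correct M blk)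
    (htree : IsDirectedTree (QuotientEdge M.Edge blk)) {psubsys : Fin k → List (PartialSubsystem n)}
    {b : Fin k} (h : ∀ c, (psubsys c).length ≤ 2 ^ (subtreeStates M blk c).card) :
    (processBlock M Goal g blk psubsys b).val.length ≤ 2 ^ (subtreeStates M blk b).card := by
  rw [val_processBlock, val_successorPoints]
  have hcomb := length_combinations_le (blk := blk) (psubsys := psubsys)
    (cs := (List.finRange k).filter fun c => g.child b c) fun c _ => h c
  set succ := combinations blk psubsys ((List.finRange k).filter fun c => g.child b c)
  set block := (List.finRange n).filter fun s => decide (blk s = b) with hblock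
  have hmodels : ((subsetsOf block).val.filter fun X => (satisfiesFilter g Goal X).val).length ≤
      2 ^ (Finset.univ.filter fun s => blk s = b).card := by
    refine (List.length_filter_le _ _).trans (le_of_eq ?_)
    rw [length_subsetsOf, ← List.toFinset_card_of_nodup ((List.nodup_finRange n).filter _)]
    congr 2
    ext s
    simp
  have hfold : ∀ (ms : List (Finset (Fin n))) (stored : List (PartialSubsystem n)),
      (ms.foldl (fun stored X => (removeDominated (block.filter fun s => g.inc s)
        (stored ++ succ.map fun T => (newSubsystem M Goal g blk b X T).val)).val) stored).length ≤
        stored.length + ms.length * succ.length := by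
    intro ms
    induction ms with
    | nil => simp
    | cons X ms ih =>
      intro stored
      rw [List.foldl_cons, List.length_cons, Nat.succ_mul]
      refine (ih _).trans ?_
      have := length_removeDominated_le (block.filter fun s => g.inc s)
        (stored ++ succ.map fun T => (newSubsystem M Goal g blk b X T).val)
      rw [List.length_append, List.length_map] at this
      omega
  refine (hfold _ []).trans ?_
  rw [List.length_nil, zero_add]
  refine (Nat.mul_le_mul hmodels hcomb).trans ?_
  rw [← pow_add]
  refine Nat.pow_le_pow_right (by norm_num) ?_
  have hcard := card_filter_add_sum_le hg htree b Finset.univ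
  simpa only [Finset.univ_inter] using hcard

/-- The number of bits of the stored values after `j` blocks have been processed. -/
def storedBits (N : ℕ) : ℕ → ℕ
  | 0 => N
  | j + 1 => solutionBits (N * N) (storedBits N j + 2)

theorem storedBits_lt_succ (N j : ℕ) : storedBits N j < storedBits N (j + 1) := by
  simp only [storedBits, solutionBits]
  nlinarith [Nat.one_le_pow (N * N) 5 (by norm_num)]

theorem storedBits_mono (N : ℕ) : Monotone (storedBits N) :=
  monotone_nat_of_le_succ fun j => (storedBits_lt_succ N j).le

theorem storedBits_le (N j : ℕ) : storedBits N j ≤ (3 * 5 ^ (N * N)) ^ j * (N + 1) := by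
  suffices H : storedBits N j + 1 ≤ (3 * 5 ^ (N * N)) ^ j * (N + 1) by omega
  induction j with
  | zero => simp [storedBits]
  | succ j ih =>
    have h1 := Nat.one_le_pow (N * N) 5 (by norm_num)
    simp only [storedBits, solutionBits]
    calc 5 ^ (N * N) * (storedBits N j + 2) + 1
        ≤ 3 * 5 ^ (N * N) * (storedBits N j + 1) := by nlinarith
      _ ≤ 3 * 5 ^ (N * N) * ((3 * 5 ^ (N * N)) ^ j * (N + 1)) := Nat.mul_le_mul_left _ ih
      _ = _ := by ring

/-- A bound for the bits of all stored values. -/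
def finalBits (N : ℕ) : ℕ := (3 * 5 ^ (N * N)) ^ N * (N + 1)

theorem blockTime_mono {γ : ℕ} (h : β ≤ γ) : blockTime N β ≤ blockTime N γ := by
  unfold blockTime removeTime removeRoundTime hullVerticesTime inHullTime newTime maxValTime
    basicFeasibleTime basicTime branchTime pivotTime feasibleTime feasibleBits solutionBits sumBits
    arithCost loopTime
  gcongr

/-- A bound for the time of the algorithm on inputs of size `N`. -/
def totalTime (N : ℕ) : ℕ :=
  graphTime N + ((N + 1) * topologicalStepTime N + (loopTime N 1 +
    (loopTime N (blockTime N (finalBits N) + loopTime N 1) + (loopTime N (loopTime N 1 + 1) +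
      (loopTime (2 ^ N) (loopTime N (arithCost (N + finalBits N) +
          arithCost (sumBits N (N + finalBits N))) + arithCost (sumBits N (N + finalBits N))) +
        (loopTime (2 ^ N) (2 * N + 1) + 1))))))

/-- The invariant for the stored lists is preserved in any order of the blocks, hence the order need
not be known to be topological here. -/
theorem time_treeAlgorithm_le (hM : SizeBound M N) (hk : k ≤ N) {lam : ℚ} (hlam : BitBound N lam)
    (htree : IsDirectedTree (QuotientEdge M.Edge blk)) :
    (treeAlgorithm M Goal blk lam).time ≤ totalTime N := by
  have hn := hM.states
  have hpos := hM.pos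
  have hg := graphData_correct M blk
  have hcard : ∀ c, (subtreeStates M blk c).card ≤ N := fun c =>
    (Finset.card_le_univ _).trans (by simpa using hn)
  have hpow : ∀ c, 2 ^ (subtreeStates M blk c).card ≤ 2 ^ N := fun c =>
    Nat.pow_le_pow_right (by norm_num) (hcard c)
  obtain ⟨ht1, ht2⟩ := reverseTopological_bound hk (graphData M blk).val.child k []
    (by simpa using hk)
  have horder : (reverseTopological (graphData M blk).val.child k []).val.length ≤ N :=
    ht2.trans (by simpa using hk)
  have hbits : ∀ j ≤ N, storedBits N j ≤ finalBits N := fun j hj =>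
    (storedBits_mono N hj).trans (storedBits_le N N)
  have hfold := foldL_induction (L := N) (t := blockTime N (finalBits N) + loopTime N 1)
    (f := fun ps b => (do
      let L ← processBlock M Goal (graphData M blk).val blk ps b
      tabulate (fun c => op 1 (if c = b then L else ps c)) : Timed _))
    (fun j ps => ∀ c, (ps c).length ≤ 2 ^ (subtreeStates M blk c).card ∧
      SubsystemBits (storedBits N j) (ps c))
    (x := fun _ => []) (l := (reverseTopological (graphData M blk).val.child k []).val)
    (fun c => ⟨by simp, fun U hU => by simp at hU⟩) horder fun j ps b hj _ hI => by
    obtain ⟨h1, h2⟩ := processBlock_bound (Goal := Goal) (g := (graphData M blk).val) (blk := blk)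
      hM hk (fun c => (hI c).1.trans (hpow c))
      (storedBits_mono N (Nat.zero_le j)) (fun c => (hI c).2) b
    simp only [time_bind, val_bind, val_tabulate, val_op]
    refine ⟨add_le_add (h1.trans (blockTime_mono (hbits j (by omega))))
      (time_tabulate_le (card_fin_le hk) fun _ => by simp), fun c => ?_⟩
    split_ifs with hc
    · subst hc
      exact ⟨length_processBlock_le hg htree fun c => (hI c).1, h2⟩
    · exact ⟨(hI c).1, fun U hU q => ((hI c).2 U hU q).mono (storedBits_lt_succ N j).le⟩
  have hl := length_finRange_le hn
  have hlk := length_finRange_le hk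
  simp only [treeAlgorithm, time_bind, val_tabulate, val_op]
  unfold totalTime
  refine add_le_add (time_graphData_le hM hk blk) (add_le_add (ht1.trans
    (Nat.mul_le_mul_right _ (by omega))) (add_le_add (time_tabulate_le (card_fin_le hk)
    fun _ => by simp) (add_le_add hfold.1 (add_le_add (time_filterL_le hlk fun b _ => ?_) ?_))))
  · simp only [time_bind, time_op]
    exact Nat.add_le_add_right (time_anyL_le hlk fun _ _ => by simp) 1
  obtain ⟨ps, hps⟩ : ∃ ps, ps = (foldL (fun ps b => (do
      let L ← processBlock M Goal (graphData M blk).val blk ps b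
      tabulate (fun c => op 1 (if c = b then L else ps c)) : Timed _)) (fun _ => [])
      (reverseTopological (graphData M blk).val.child k []).val).val := ⟨_, rfl⟩
  have hI := hfold.2
  rw [← hps] at hI ⊢
  split
  · simp only [time_op]
    omega
  · rename_i root _ _
    have hlen : (ps root).length ≤ 2 ^ N := (hI root).1.trans (hpow root)
    have hb : ∀ U ∈ ps root, ∀ q, BitBound (finalBits N) (U.val q) := fun U hU q =>
      ((hI root).2 U hU q).mono (hbits _ horder)
    simp only [time_bind, time_op, val_filterL]
    refine add_le_add (time_filterL_le hlen fun U hU => ?_) (Nat.add_le_add_right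
      (foldL_induction (fun _ _ => True) trivial ((List.length_filter_le _ _).trans hlen)
        fun _ best U _ _ _ => ⟨?_, trivial⟩).1 1)
    · have hterm : ∀ s ∈ List.finRange n,
          BitBound (N + finalBits N) (mulQ (M.init s) (U.val s)).val :=
        fun s _ => (hM.init s).mul (hb U hU s)
      exact add_le_add (time_sumQ_le hl hterm fun s _ => time_mulQ_le
        ((hM.init s).mono (by omega)) ((hb U hU s).mono (by omega)))
        (time_leQ_le (hlam.mono (le_trans (by omega) (le_sumBits N (N + finalBits N))))
          (bitBound_sumQ hl hterm))
    · rcases best with _ | V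
      · simp
      · simp only [time_op]
        omega

theorem ratBits_pos (q : ℚ) : 1 ≤ ratBits q := by
  have : 0 < Nat.size q.den := Nat.size_pos.2 q.den_pos
  unfold ratBits
  omega

theorem sizeBound_inputSize (M : MDP (Fin n) (Fin m)) (k : ℕ) (lam : ℚ) :
    SizeBound M (inputSize M k lam) := by
  have hlam := ratBits_pos lam
  refine ⟨?_, ?_, ?_, fun s α hα t => bitBound_of_ratBits_le ?_,
    fun s => bitBound_of_ratBits_le ?_⟩
  · unfold inputSize; omega
  · unfold inputSize; omega
  · unfold inputSize; omega
  · have h1 : ratBits (M.P s α t) ≤ ∑ t, ratBits (M.P s α t) :=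
      Finset.single_le_sum (f := fun t => ratBits (M.P s α t)) (fun _ _ => Nat.zero_le _)
        (Finset.mem_univ t)
    have h2 : ∑ t, ratBits (M.P s α t) ≤ ∑ α ∈ M.act s, ∑ t, ratBits (M.P s α t) :=
      Finset.single_le_sum (f := fun α => ∑ t, ratBits (M.P s α t)) (fun _ _ => Nat.zero_le _) hα
    have h3 : ∑ α ∈ M.act s, ∑ t, ratBits (M.P s α t) ≤
        ∑ s, ∑ α ∈ M.act s, ∑ t, ratBits (M.P s α t) :=
      Finset.single_le_sum (f := fun s => ∑ α ∈ M.act s, ∑ t, ratBits (M.P s α t))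
        (fun _ _ => Nat.zero_le _) (Finset.mem_univ s)
    unfold inputSize
    omega
  · have h1 : ratBits (M.init s) ≤ ∑ s, ratBits (M.init s) :=
      Finset.single_le_sum (f := fun s => ratBits (M.init s)) (fun _ _ => Nat.zero_le _)
        (Finset.mem_univ s)
    unfold inputSize
    omega

end AlgorithmTimes

/-! ### Exponential bounds -/

section ExponentialBounds

/-- The function is bounded by a polynomial. -/
def PolyBounded (f : ℕ → ℕ) : Prop := ∃ p : Polynomial ℕ, ∀ N, f N ≤ p.eval N

/-- The function is bounded by an exponential of a polynomial. -/
def ExpBounded (f : ℕ → ℕ) : Prop := ∃ p : Polynomial ℕ, ∀ N, f N ≤ 2 ^ p.eval N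

variable {f g : ℕ → ℕ}

theorem polyBounded_const (c : ℕ) : PolyBounded fun _ => c := ⟨.C c, by simp⟩

theorem polyBounded_id : PolyBounded fun N => N := ⟨.X, by simp⟩

theorem PolyBounded.add (hf : PolyBounded f) (hg : PolyBounded g) :
    PolyBounded fun N => f N + g N := by
  obtain ⟨p, hp⟩ := hf
  obtain ⟨q, hq⟩ := hg
  exact ⟨p + q, fun N => by rw [Polynomial.eval_add]; exact add_le_add (hp N) (hq N)⟩

theorem PolyBounded.mul (hf : PolyBounded f) (hg : PolyBounded g) :
    PolyBounded fun N => f N * g N := by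
  obtain ⟨p, hp⟩ := hf
  obtain ⟨q, hq⟩ := hg
  exact ⟨p * q, fun N => by rw [Polynomial.eval_mul]; exact Nat.mul_le_mul (hp N) (hq N)⟩

theorem PolyBounded.expBounded (hf : PolyBounded f) : ExpBounded f := by
  obtain ⟨p, hp⟩ := hf
  exact ⟨p, fun N => (hp N).trans Nat.lt_two_pow_self.le⟩

theorem expBounded_const (c : ℕ) : ExpBounded fun _ => c := (polyBounded_const c).expBounded

theorem expBounded_id : ExpBounded fun N => N := polyBounded_id.expBounded

theorem ExpBounded.mul (hf : ExpBounded f) (hg : ExpBounded g) :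
    ExpBounded fun N => f N * g N := by
  obtain ⟨p, hp⟩ := hf
  obtain ⟨q, hq⟩ := hg
  refine ⟨p + q, fun N => ?_⟩
  rw [Polynomial.eval_add, pow_add]
  exact Nat.mul_le_mul (hp N) (hq N)

theorem ExpBounded.add (hf : ExpBounded f) (hg : ExpBounded g) :
    ExpBounded fun N => f N + g N := by
  obtain ⟨p, hp⟩ := hf
  obtain ⟨q, hq⟩ := hg
  refine ⟨p + q + 1, fun N => ?_⟩
  have h1 := hp N
  have h2 := hq N
  simp only [Polynomial.eval_add, Polynomial.eval_one, pow_add, pow_one]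
  have h3 := Nat.one_le_two_pow (n := p.eval N)
  have h4 := Nat.one_le_two_pow (n := q.eval N)
  nlinarith

theorem ExpBounded.pow (hf : ExpBounded f) (hg : PolyBounded g) :
    ExpBounded fun N => f N ^ g N := by
  obtain ⟨p, hp⟩ := hf
  obtain ⟨q, hq⟩ := hg
  refine ⟨p * q, fun N => ?_⟩
  rw [Polynomial.eval_mul, pow_mul]
  exact (Nat.pow_le_pow_left (hp N) _).trans (Nat.pow_le_pow_right Nat.one_le_two_pow (hq N))

theorem ExpBounded.loopTime (hf : ExpBounded f) (hg : ExpBounded g) :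
    ExpBounded fun N => Timed.loopTime (f N) (g N) :=
  (hf.mul (hg.add (expBounded_const 1))).add (expBounded_const 1)

theorem ExpBounded.arithCost (hf : ExpBounded f) : ExpBounded fun N => arithCost (f N) :=
  (((expBounded_const 4).mul hf).add (expBounded_const 1)).pow (polyBounded_const 2)

theorem ExpBounded.sumBits (hf : ExpBounded f) (hg : ExpBounded g) :
    ExpBounded fun N => sumBits (f N) (g N) :=
  ((hg.add (expBounded_const 1)).mul (hf.add (expBounded_const 1))).add (expBounded_const 1)

theorem PolyBounded.solutionBits (hf : PolyBounded f) (hg : ExpBounded g) :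
    ExpBounded fun N => solutionBits (f N) (g N) :=
  ((expBounded_const 5).pow hf).mul hg

theorem expBounded_two_pow : ExpBounded fun N => 2 ^ N := (expBounded_const 2).pow polyBounded_id

theorem PolyBounded.basicFeasibleTime (hf : PolyBounded f) {h : ℕ → ℕ} (hg : ExpBounded g)
    (hh : ExpBounded h) : ExpBounded fun N => basicFeasibleTime (f N) (g N) (h N) := by
  have hs := hf.solutionBits hh
  have h1 := expBounded_const 1
  have h2 := expBounded_const 2
  have hr := hf.expBounded
  have hc := hg.add h1
  have hpivot : ExpBounded fun N => pivotTime (f N) (g N) (TreeWitness.solutionBits (f N) (h N)) :=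
    (hc.loopTime hs.arithCost).add (hr.loopTime (hc.loopTime
      (h1.add (h2.mul ((expBounded_const 3).mul hs).arithCost))))
  have hbranch : ExpBounded fun N =>
      branchTime (f N) (g N) (TreeWitness.solutionBits (f N) (h N)) :=
    ((((hg.loopTime h1).add hs.arithCost).add hpivot).add (hc.pow hf)).add (expBounded_const 5)
  have hsum := hh.add hs
  have hfeas : ExpBounded fun N =>
      feasibleTime (f N) (g N) (h N) (TreeWitness.solutionBits (f N) (h N)) :=
    ((hg.loopTime hsum.arithCost).add (hr.loopTime ((hg.loopTime
      (hsum.arithCost.add (hg.sumBits hsum).arithCost)).add (hg.sumBits hsum).arithCost))).add h1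
  exact ((hg.loopTime h1).add (((hg.add h2).pow hf).mul (h2.mul hbranch))).add
    ((hc.pow hf).loopTime hfeas)

theorem ExpBounded.maxValTime (hf : ExpBounded f) : ExpBounded fun N => maxValTime N (f N) := by
  have hid := expBounded_id
  have h1 := expBounded_const 1
  have hr := polyBounded_id.mul polyBounded_id
  have hc := hid.add (hid.mul hid)
  have hβ := hf.add (expBounded_const 2)
  have hs := (hid.sumBits (hr.solutionBits hβ)).arithCost
  exact (((hr.expBounded.loopTime ((hc.add h1).loopTime ((expBounded_const 5).add
    hβ.arithCost))).add (hr.basicFeasibleTime hc hβ)).add ((((hc.add h1).pow hr).loopTime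
    (((hid.loopTime (h1.add hs)).add hs).add h1)).add h1)).add (hid.loopTime h1)

theorem ExpBounded.removeTime (hf : ExpBounded f) (hg : ExpBounded g) :
    ExpBounded fun N => removeTime N (f N) (g N) := by
  have hid := expBounded_id
  have h1 := expBounded_const 1
  have hN := hid.add h1
  have hproj : ExpBounded projectionsTime :=
    (hN.mul (((expBounded_two_pow.loopTime hN).add expBounded_two_pow).add h1)).add
      (expBounded_two_pow.loopTime (hid.loopTime h1))
  have hpts : ExpBounded fun N => pointsBound N (f N) := hN.mul (hf.mul expBounded_two_pow)
  have hvec := hid.loopTime hg.arithCost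
  have hhull : ExpBounded fun N => hullVerticesTime N (pointsBound N (f N)) (g N) :=
    hpts.loopTime ((hpts.loopTime (hvec.add h1)).add ((((hN.loopTime ((hpts.add h1).loopTime
      h1)).add ((polyBounded_id.add (polyBounded_const 1)).basicFeasibleTime hpts hg)).add
      h1).add h1))
  exact (hf.loopTime hN).add ((hN.loopTime ((hf.loopTime hN).add ((hf.loopTime (hproj.add
    expBounded_two_pow)).add ((hpts.add h1).add (hhull.add ((hf.loopTime (hpts.loopTime
    hvec)).add (((hN.mul hf).add h1).add h1))))))).add h1)

theorem ExpBounded.blockTime (hf : ExpBounded f) : ExpBounded fun N => blockTime N (f N) := by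
  have hid := expBounded_id
  have h1 := expBounded_const 1
  have h2 := expBounded_const 2
  have hN := hid.add h1
  have hcomb : ExpBounded combinationsBound := expBounded_two_pow.pow polyBounded_id
  have hstored : ExpBounded storedBound := expBounded_two_pow.mul hcomb
  have hsubsets : ExpBounded subsetsTime :=
    hN.mul (((expBounded_two_pow.loopTime hN).add expBounded_two_pow).add h1)
  have hfilter : ExpBounded filterTime :=
    hid.loopTime ((hid.loopTime h2).add ((hid.loopTime h2).add (expBounded_const 5)))
  have hsucc : ExpBounded successorTime :=
    (hid.loopTime h1).add (hid.loopTime (hcomb.loopTime ((expBounded_two_pow.loopTime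
      (hN.add ((hid.loopTime h2).add h1))).add expBounded_two_pow)))
  have hnew : ExpBounded fun N => newTime N (f N) :=
    hN.add ((hid.loopTime (expBounded_const 3)).add (hf.maxValTime.add
      ((hid.loopTime (expBounded_const 4)).add h1)))
  have hs := (polyBounded_id.mul polyBounded_id).solutionBits (hf.add h2)
  exact (hid.loopTime h1).add ((hid.loopTime h1).add (hsubsets.add ((expBounded_two_pow.loopTime
    hfilter).add (expBounded_two_pow.loopTime (hsucc.add ((hcomb.loopTime hnew).add
    ((hstored.add h1).add (hstored.removeTime hs))))))))

theorem expBounded_totalTime : ExpBounded totalTime := by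
  have hid := expBounded_id
  have h1 := expBounded_const 1
  have h2 := expBounded_const 2
  have h3 := expBounded_const 3
  have hN := hid.add h1
  have hbits : ExpBounded finalBits :=
    ((h3.mul ((expBounded_const 5).pow (polyBounded_id.mul polyBounded_id))).pow
      polyBounded_id).mul hN
  have hloop : ∀ {f : ℕ → ℕ}, ExpBounded f → ExpBounded fun N => Timed.loopTime N (f N) :=
    fun hf => hid.loopTime hf
  have hgraph : ExpBounded graphTime :=
    (hloop (hloop (hloop (hid.arithCost.add h1)))).add ((hloop (hloop (hloop (hloop
      (expBounded_const 5))))).add ((hloop (hid.arithCost.add ((hloop h3).add h1))).add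
      ((hloop (hloop h3)).add h1)))
  have htop : ExpBounded topologicalStepTime :=
    ((hloop (((h2.mul hid).add (expBounded_const 4)).add (hloop (hid.add h2)))).add hid).add h2
  have hsum := (hid.sumBits (hid.add hbits)).arithCost
  exact hgraph.add ((hN.mul htop).add ((hloop h1).add ((hloop (hbits.blockTime.add
    (hloop h1))).add ((hloop ((hloop h1).add h1)).add ((expBounded_two_pow.loopTime ((hloop
    ((hid.add hbits).arithCost.add hsum)).add hsum)).add ((expBounded_two_pow.loopTime
    ((h2.mul hid).add h1)).add h1))))))

end ExponentialBounds

end TreeWitness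

theorem mainTheorem6 :
    ∃ p : Polynomial ℕ,
      ∀ (n m k : ℕ) (M : TreeWitness.MDP (Fin n) (Fin m)) (Goal : Finset (Fin n))
        (blk : Fin n → Fin k) (lam : ℚ),
        (∀ s ∈ Goal, ∀ α ∈ M.act s, ∀ t, M.P s α t = 0) →
        TreeWitness.IsDirectedTreePartition M.Edge blk →
        (∀ b, (∀ s, blk s = b → s ∈ Goal) ∨ (∀ s, blk s = b → s ∉ Goal)) →
        (∀ s, 0 < M.init s → ∀ b, ¬ TreeWitness.QuotientEdge M.Edge blk b (blk s)) →
        (∀ S' : Finset (Fin n), (TreeWitness.treeAlgorithm M Goal blk lam).val = some S' →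
          TreeWitness.IsMinimalWitness M Goal lam S') ∧
        ((TreeWitness.treeAlgorithm M Goal blk lam).val = none →
          ∀ (T : Finset (Fin n)) (M' : TreeWitness.MDP {s // s ∈ T} (Fin m)),
            TreeWitness.IsSubsystem M M' → ¬ TreeWitness.IsWitness M' Goal lam) ∧
        (TreeWitness.treeAlgorithm M Goal blk lam).time ≤
          2 ^ (p.eval (TreeWitness.inputSize M k lam)) := by
  obtain ⟨p, hp⟩ := TreeWitness.expBounded_totalTime
  refine ⟨p, fun n m k M Goal blk lam _ hpart _ hinit => ?_⟩
  obtain ⟨h1, h2⟩ := TreeWitness.treeAlgorithm_correct M Goal blk lam hpart hinit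
  refine ⟨h1, h2, le_trans ?_ (hp _)⟩
  refine TreeWitness.time_treeAlgorithm_le (TreeWitness.sizeBound_inputSize M k lam) ?_
    (TreeWitness.bitBound_of_ratBits_le ?_) hpart.2
  · unfold TreeWitness.inputSize
    omega
  · unfold TreeWitness.inputSize
    omega
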